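/- Let $D=\sum_{|\alpha|\le k}a_\alpha\partial^\alpha$ be a linear differential operator of order $k\ge 0$ in $d$ variables with variable coefficients, and let $\Pi^d_s$ be the space of real polynomials in $d$ variables of total degree at most $s-1$ ($\Pi^d_0=\{0\}$), with basis $p_1,\dots,p_M$. Let $K(x,y)=\Phi(x-y)$, $\Phi:\mathbb R^d\to\mathbb R$, be a translation-invariant symmetric kernel on $\mathbb R^d$ that is conditionally positive definite of order $s\ge 0$: $\sum_{i,j}c_ic_jK(y_i,y_j)>0$ for all finite sets of distinct points $y_i$ and all $c\neq 0$ with $\sum_i c_i\,p(y_i)=0$ for all $p\in\Pi^d_s$. Let $\mathcal F_K$ be its native space, i.e. the completion, as a space of functions on $\mathbb R^d$, of the functions $\sum_i c_iK(\cdot,y_i)+p$ with $c$ as above and $p\in\Pi^d_s$, with respect to the semi-norm $\big(\sum_{i,j}c_ic_jK(y_i,y_j)\big)^{1/2}$; its semi-norm is denoted by $\|\cdot\|_K$. Let $z\in\mathbb R^d$ and let $X=\{x_1,\dots,x_N\}\subset\mathbb R^d$ consist of $N$ distinct points, not all equal to $z$. Let $S_{z,X}=\bigcup_i[z,x_i]$,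 let $B_{z,X}$ be the closed ball centered at the origin with radius $\operatorname{diam}S_{z,X}$, and $h_{z,X}=\max_j\|z-x_j\|_2$. Consider the linear system $$\sum_{j=1}^N w_jK(x_i,x_j)+\sum_{j=1}^M v_jp_j(x_i)=D'K(z,x_i)\ (1\le i\le N),\qquad \sum_{j=1}^N w_jp_i(x_j)=Dp_i(z)\ (1\le i\le M),$$ where $D'$ is $D$ applied to the first argument. Assume that its second part is consistent, i.e. solvable for $w$. Assume that $\Phi\in C^{r,\gamma}(B_{z,X})$ for some integer $r\ge 2k$ and $\gamma\in(0,1]$, i.e. $\Phi$ is $r$ times continuously differentiable on $B_{z,X}$ and $$|\Phi|_{C^{r,\gamma}(B_{z,X})}=\max_{|\alpha|=r}\ \sup_{x\ne y\in B_{z,X}}\frac{|\partial^\alpha\Phi(x)-\partial^\alpha\Phi(y)|}{\|x-y\|_2^{\gamma}}<\infty .$$ Put $q=\max\{s,\lfloor r/2\rfloor+1\}$, $\mu=(r+\gamma)/2$, let $$\rho_{q,D}(z,X,\mu)=\sup\{Dp(z):p\in\Pi^d_q,\ |p(x_j)|\le\|x_j-z\|_2^\mu,\ j=1,\dots,N\}\in[0,\infty]$$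 be the growth function, and $$C_{d,r}=\frac{2d^{r/2}}{\prod_{j=1}^{r/2}(\gamma/2+j)^2}\ (r\text{ even}),\qquad C_{d,r}=\frac{d^{r/2}}{\prod_{j=1}^{\lfloor r/2\rfloor}((1+\gamma)/2+j)^2}\ (r\text{ odd}).$$ Then $\Phi(\cdot-x_i)$ is $k$ times continuously differentiable near $z$ for all $i$, the linear system determines a unique weight vector $w^*$, and every $f\in\mathcal F_K$ is $k$ times continuously differentiable near $z$ and satisfies $$\Big|Df(z)-\sum_{j=1}^N w_j^*f(x_j)\Big|\le\rho_{q,D}(z,X,\mu)\,C_{d,r}^{1/2}\,|\Phi|^{1/2}_{C^{r,\gamma}(B_{z,X})}\,\|f\|_K .$$ The bound is of order $O(h^{(r+\gamma)/2-k})$ under scaling: let $X_h=\{z+h(x_j-z)\}$, $0<h\le1$, and suppose that $\rho_{q,D_j}(z,X,\mu)<\infty$ for each homogeneous part $D_j=\sum_{|\alpha|=j}a_\alpha\partial^\alpha$, $j\le k$. Then there is $\sigma$ such that for all $h\in(0,1]$: $\rho_{q,D}(z,X_h,\mu)\le\sigma\,h_{z,X_h}^{\mu-k}$, the unique weight vector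 $w^*$ for $z,X_h$ exists, and for all $f\in\mathcal F_K$ the error of the corresponding formula is at most $\sigma\,h_{z,X_h}^{(r+\gamma)/2-k}\,C_{d,r}^{1/2}\,|\Phi|^{1/2}_{C^{r,\gamma}(B_{z,X})}\,\|f\|_K$. -/

import Mathlib

open Filter Topology
open scoped ENNReal

noncomputable section

/-! ### Partial derivatives and differential operators -/

/-- The coordinate directions of `∂^α`, listed with multiplicity: the direction `eᵢ` occurs
`α i` times. -/
def multiDirections {d : ℕ} (α : Fin d → ℕ) (j : Fin (∑ i, α i)) : EuclideanSpace ℝ (Fin d) :=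
  EuclideanSpace.single (finSigmaFinEquiv.symm j).1 1

/-- The partial derivative `∂^α f (x)`. -/
def partialDeriv {d : ℕ} (α : Fin d → ℕ) (f : EuclideanSpace ℝ (Fin d) → ℝ)
    (x : EuclideanSpace ℝ (Fin d)) : ℝ :=
  iteratedFDeriv ℝ (∑ i, α i) f x (multiDirections α)

/-- The partial derivative `∂^α f (x)` of a function on a set `Ω` (one-sided at points of the
boundary of `Ω` that belong to `Ω`). -/
def partialDerivWithin {d : ℕ} (α : Fin d → ℕ) (Ω : Set (EuclideanSpace ℝ (Fin d)))
    (f : EuclideanSpace ℝ (Fin d) → ℝ) (x : EuclideanSpace ℝ (Fin d)) : ℝ :=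
  iteratedFDerivWithin ℝ (∑ i, α i) f Ω x (multiDirections α)

/-- The multi-indices `α` with `|α| ≤ k`. -/
def multiIndicesLE (d k : ℕ) : Finset (Fin d → ℕ) :=
  (Fintype.piFinset fun _ : Fin d => Finset.range (k + 1)).filter fun α => ∑ i, α i ≤ k

/-- `D f (z) = ∑_{|α| ≤ k} a_α(z) ∂^α f (z)`, the linear differential operator of order `k`
with variable coefficients `a_α`. -/
def diffOp {d : ℕ} (k : ℕ) (a : (Fin d → ℕ) → EuclideanSpace ℝ (Fin d) → ℝ)
    (f : EuclideanSpace ℝ (Fin d) → ℝ) (z : EuclideanSpace ℝ (Fin d)) : ℝ :=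
  ∑ α ∈ multiIndicesLE d k, a α z * partialDeriv α f z

/-- The coefficients of the homogeneous part `∑_{|α| = j} a_α ∂^α` of a differential operator. -/
def homogeneousPart {d : ℕ} (a : (Fin d → ℕ) → EuclideanSpace ℝ (Fin d) → ℝ) (j : ℕ) :
    (Fin d → ℕ) → EuclideanSpace ℝ (Fin d) → ℝ :=
  fun α x => if ∑ i, α i = j then a α x else 0

/-! ### Polynomials -/

/-- `Π^d_s`: polynomials in `d` variables all of whose monomials have total degree `< s`
(so `Π^d_0 = {0}`). -/
def polySpace (d s : ℕ) : Submodule ℝ (MvPolynomial (Fin d) ℝ) :=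
  MvPolynomial.restrictSupport ℝ {n : Fin d →₀ ℕ | n.degree < s}

/-- The polynomial function of `p`. -/
def polyFun {d : ℕ} (p : MvPolynomial (Fin d) ℝ) (x : EuclideanSpace ℝ (Fin d)) : ℝ :=
  MvPolynomial.eval (fun i => x i) p

/-! ### Conditionally positive definite kernels and their native spaces

A finitely supported `c : ℝ^d →₀ ℝ` stands for the functional `f ↦ ∑ₓ c(x) f(x)`. -/

/-- The functional `c` vanishes on `Π^d_s`. -/
def AnnihilatesPoly {d : ℕ} (s : ℕ) (c : EuclideanSpace ℝ (Fin d) →₀ ℝ) : Prop :=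
  ∀ p ∈ polySpace d s, (c.sum fun x b => b * polyFun p x) = 0

/-- The quadratic form `∑_{x,y} c(x) c(y) K(x,y)`. -/
def kernelEnergy {d : ℕ} (K : EuclideanSpace ℝ (Fin d) → EuclideanSpace ℝ (Fin d) → ℝ)
    (c : EuclideanSpace ℝ (Fin d) →₀ ℝ) : ℝ :=
  c.sum fun x b => c.sum fun y b' => b * b' * K x y

/-- The function `∑_y c(y) K(·,y)`. -/
def kernelComb {d : ℕ} (K : EuclideanSpace ℝ (Fin d) → EuclideanSpace ℝ (Fin d) → ℝ)
    (c : EuclideanSpace ℝ (Fin d) →₀ ℝ) (x : EuclideanSpace ℝ (Fin d)) : ℝ :=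
  c.sum fun y b => b * K x y

/-- `K` is a symmetric conditionally positive definite kernel of order `s` on `ℝ^d`
(strictly positive definite if `s = 0`). -/
structure IsCondPosDef {d : ℕ} (s : ℕ)
    (K : EuclideanSpace ℝ (Fin d) → EuclideanSpace ℝ (Fin d) → ℝ) : Prop where
  symm : ∀ x y, K x y = K y x
  pos : ∀ c : EuclideanSpace ℝ (Fin d) →₀ ℝ, c ≠ 0 → AnnihilatesPoly s c → 0 < kernelEnergy K c

/-- `f` is an element, of semi-norm `t`, of the completion (as a space of functions on `ℝ^d`)
of the space of functions `∑_y c(y) K(·,y) + p`, where `c` annihilates `Π^d_s` and `p ∈ Π^d_s`,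
with the semi-norm `(∑_{x,y} c(x) c(y) K(x,y))^{1/2}`: it is the pointwise limit of a Cauchy
sequence of such functions, the semi-norms of which tend to `t`. -/
def HasNativeSeminorm {d : ℕ} (K : EuclideanSpace ℝ (Fin d) → EuclideanSpace ℝ (Fin d) → ℝ)
    (s : ℕ) (f : EuclideanSpace ℝ (Fin d) → ℝ) (t : ℝ) : Prop :=
  ∃ (c : ℕ → EuclideanSpace ℝ (Fin d) →₀ ℝ) (p : ℕ → MvPolynomial (Fin d) ℝ),
    (∀ n, AnnihilatesPoly s (c n)) ∧ (∀ n, p n ∈ polySpace d s) ∧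
    (∀ ε > 0, ∃ n₀, ∀ m ≥ n₀, ∀ n ≥ n₀, √(kernelEnergy K (c m - c n)) < ε) ∧
    (∀ x, Tendsto (fun n => kernelComb K (c n) x + polyFun (p n) x) atTop (𝓝 (f x))) ∧
    Tendsto (fun n => √(kernelEnergy K (c n))) atTop (𝓝 t)

/-- The native space `F_K` of a conditionally positive definite kernel `K` of order `s`. -/
def nativeSpace {d : ℕ} (K : EuclideanSpace ℝ (Fin d) → EuclideanSpace ℝ (Fin d) → ℝ) (s : ℕ) :
    Set (EuclideanSpace ℝ (Fin d) → ℝ) :=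
  {f | ∃ t, HasNativeSeminorm K s f t}

/-- The semi-norm `‖f‖_K` of the native space (for `f ∈ F_K` there is exactly one `t` with
`HasNativeSeminorm K s f t`). -/
def nativeSeminorm {d : ℕ} (K : EuclideanSpace ℝ (Fin d) → EuclideanSpace ℝ (Fin d) → ℝ) (s : ℕ)
    (f : EuclideanSpace ℝ (Fin d) → ℝ) : ℝ :=
  sInf {t | HasNativeSeminorm K s f t}

/-! ### The numerical differentiation formula -/

/-- The polynomial part of the linear system: the formula with weights `w` is exact for
`p₁, …, p_M`. -/
def PolyExact {d N M : ℕ} (p : Fin M → MvPolynomial (Fin d) ℝ) (k : ℕ)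
    (a : (Fin d → ℕ) → EuclideanSpace ℝ (Fin d) → ℝ) (z : EuclideanSpace ℝ (Fin d))
    (x : Fin N → EuclideanSpace ℝ (Fin d)) (w : Fin N → ℝ) : Prop :=
  ∀ i, ∑ j, w j * polyFun (p i) (x j) = diffOp k a (polyFun (p i)) z

/-- `w` is the weight vector of a kernel-based numerical differentiation formula: together with
some `v` it solves the linear system
`∑ⱼ wⱼ K(xᵢ,xⱼ) + ∑ⱼ vⱼ pⱼ(xᵢ) = D'K(z,xᵢ)`, `∑ⱼ wⱼ pᵢ(xⱼ) = D pᵢ(z)`. -/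
def IsKernelWeights {d N M : ℕ}
    (K : EuclideanSpace ℝ (Fin d) → EuclideanSpace ℝ (Fin d) → ℝ)
    (p : Fin M → MvPolynomial (Fin d) ℝ) (k : ℕ)
    (a : (Fin d → ℕ) → EuclideanSpace ℝ (Fin d) → ℝ) (z : EuclideanSpace ℝ (Fin d))
    (x : Fin N → EuclideanSpace ℝ (Fin d)) (w : Fin N → ℝ) : Prop :=
  (∃ v : Fin M → ℝ, ∀ i, ∑ j, w j * K (x i) (x j) + ∑ j, v j * polyFun (p j) (x i)
      = diffOp k a (fun y => K y (x i)) z) ∧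
    PolyExact p k a z x w

/-- The growth function
`ρ_{q,D}(z,X,μ) = sup {D p(z) : p ∈ Π^d_q, |p(xⱼ)| ≤ ‖xⱼ - z‖^μ for all j} ∈ [0,∞]`
(`p = 0` is admitted, so only the non-negative values `D p(z)` matter). -/
def growthFunction {d N : ℕ} (q k : ℕ) (a : (Fin d → ℕ) → EuclideanSpace ℝ (Fin d) → ℝ)
    (z : EuclideanSpace ℝ (Fin d)) (x : Fin N → EuclideanSpace ℝ (Fin d)) (μ : ℝ) : ℝ≥0∞ :=
  ⨆ p ∈ polySpace d q, ⨆ _ : ∀ j, |polyFun p (x j)| ≤ ‖x j - z‖ ^ μ,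
    ENNReal.ofReal (diffOp k a (polyFun p) z)

/-- `h_{z,X} = maxⱼ ‖z - xⱼ‖`. -/
def radiusAt {d N : ℕ} (z : EuclideanSpace ℝ (Fin d)) (x : Fin N → EuclideanSpace ℝ (Fin d)) : ℝ :=
  ⨆ j, ‖z - x j‖

/-- The points `z + h (xⱼ - z)`. -/
def scalePoints {d N : ℕ} (z : EuclideanSpace ℝ (Fin d)) (x : Fin N → EuclideanSpace ℝ (Fin d))
    (h : ℝ) : Fin N → EuclideanSpace ℝ (Fin d) :=
  fun j => z + h • (x j - z)

/-! ### Hölder classes -/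

/-- `S_{z,X}`, the union of the segments `[z,xᵢ]`. -/
def starSet {d N : ℕ} (z : EuclideanSpace ℝ (Fin d)) (x : Fin N → EuclideanSpace ℝ (Fin d)) :
    Set (EuclideanSpace ℝ (Fin d)) :=
  ⋃ i, segment ℝ z (x i)

/-- `B_{z,X}`, the closed ball centered at the origin with radius `diam S_{z,X}`. -/
def diffBall {d N : ℕ} (z : EuclideanSpace ℝ (Fin d)) (x : Fin N → EuclideanSpace ℝ (Fin d)) :
    Set (EuclideanSpace ℝ (Fin d)) :=
  Metric.closedBall 0 (Metric.diam (starSet z x))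

/-- The semi-norm `|f|_{C^{r,γ}(Ω)}`, the maximum over `|α| = r` of the Hölder constants of
`∂^α f` on `Ω`. -/
def holderSeminorm {d : ℕ} (r : ℕ) (γ : ℝ) (Ω : Set (EuclideanSpace ℝ (Fin d)))
    (f : EuclideanSpace ℝ (Fin d) → ℝ) : ℝ≥0∞ :=
  ⨆ α ∈ {α : Fin d → ℕ | ∑ i, α i = r}, ⨆ x ∈ Ω, ⨆ y ∈ Ω, ⨆ _ : x ≠ y,
    ENNReal.ofReal (|partialDerivWithin α Ω f x - partialDerivWithin α Ω f y| / ‖x - y‖ ^ γ)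

/-- `f ∈ C^{r,γ}(Ω)`. -/
def MemHolderClass {d : ℕ} (r : ℕ) (γ : ℝ) (Ω : Set (EuclideanSpace ℝ (Fin d)))
    (f : EuclideanSpace ℝ (Fin d) → ℝ) : Prop :=
  ContDiffOn ℝ r f Ω ∧ holderSeminorm r γ Ω f < ∞

/-- The constant `C_{d,r}` (it depends on `γ` as well). -/
def holderConst (d r : ℕ) (γ : ℝ) : ℝ :=
  if Even r then
    2 * (d : ℝ) ^ ((r : ℝ) / 2) / ∏ j ∈ Finset.Icc 1 (r / 2), (γ / 2 + (j : ℝ)) ^ 2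
  else
    (d : ℝ) ^ ((r : ℝ) / 2) / ∏ j ∈ Finset.Icc 1 (r / 2), ((1 + γ) / 2 + (j : ℝ)) ^ 2

end

/-! Write n = ⌊r/2⌋ and μ = (r+γ)/2. Correcting point evaluations by functionals dual to a basis of
Π^d_s gives a feature map F into a Hilbert space such that every native f is ⟨F ·, g⟩ plus a
polynomial, where ‖g‖ is the semi-norm of f (`IsCondPosDef.exists_feature_map`). The correcting
functionals are supported near z, so ⟨F x, F y⟩ inherits 2n derivatives near (z, z) from Φ, and this
makes F of class C^n at z (`contDiffOn_of_contDiffOn_inner`). As k ≤ n, the operator D can be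
applied to F and to all native functions.

For weights exact on Π^d_s the error of f is therefore ⟨e_w, g⟩, with e_w the `errorRepresenter`.
The linear system says precisely that w is exact and that e_w is orthogonal to all ∑ u_j F(x_j) with
u annihilating Π^d_s (`isKernelWeights_iff`). So orthogonal projection gives existence, strict
positivity gives uniqueness, and Pythagoras shows that e_{w*} has the smallest norm among all exact
formulas.

It remains to exhibit one good competitor. Linear programming duality (`exists_weights_of_le`) turns
a finite growth function ρ into weights w that are exact on Π^d_q and satisfy ∑ |w_j| ‖x_j - z‖^μ ≤
ρ. For such w each application of the error functional sees only a Taylor remainder of degree n, and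
applying it in both arguments of the kernel gives ‖e_w‖² = ∑ w_i w_j R(x_i - z, z - x_j), where R is
the remainder of Φ(t u + s v) in both variables. Finally |R(u, v)| ≤ C_{d,r} |Φ| ‖u‖^μ ‖v‖^μ
(`abs_doubleRemainder_le_holderSeminorm`), so the double sum factors into a square.

If ρ = ∞ the bound is trivial unless another factor vanishes: C_{d,r} > 0, the Hölder semi-norm is
nonzero by positive definiteness, and for semi-norm zero the error is zero. For scaled points,
competitors are built from the weights of the homogeneous parts D_i multiplied by h^{-i}
(`exists_weights_scalePoints`). -/

/-! ### Taylor remainders in one and two variables -/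

/-- A bound for the remainder of the Taylor expansion at `0`, when the last derivative is
Hölder-like at `0`. -/
theorem abs_taylor_remainder_le_aux {ν C : ℝ} (hν : 0 < ν) (n : ℕ) (φ : ℕ → ℝ → ℝ)
    (hφ : ∀ m < n, ∀ t ∈ Set.Icc (0 : ℝ) 1, HasDerivAt (φ m) (φ (m + 1) t) t)
    (hC : ∀ t ∈ Set.Icc (0 : ℝ) 1, |φ n t - φ n 0| ≤ C * t ^ ν) :
    ∀ t ∈ Set.Icc (0 : ℝ) 1,
      |φ 0 t - ∑ m ∈ Finset.range (n + 1), φ m 0 * t ^ m / m.factorial| ≤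
        C / (∏ j ∈ Finset.Icc 1 n, (ν + (j : ℝ))) * t ^ (ν + n) := by
  induction n generalizing φ with
  | zero =>
    intro t ht
    simpa using hC t ht
  | succ n ih =>
    have ih' := ih (fun m => φ (m + 1)) (fun m hm t ht => hφ (m + 1) (by omega) t ht) hC
    set P : ℝ := ∏ j ∈ Finset.Icc 1 n, (ν + (j : ℝ)) with hP
    have hPpos : 0 < P := Finset.prod_pos fun j _ => by positivity
    have hPs : ∏ j ∈ Finset.Icc 1 (n + 1), (ν + (j : ℝ)) = P * (ν + ((n + 1 : ℕ) : ℝ)) := by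
      rw [Finset.prod_Icc_succ_top (by omega)]
    have hpos : 0 < ν + ((n + 1 : ℕ) : ℝ) := by positivity
    have hcpos : 0 < ν + (n : ℝ) := by positivity
    set f : ℝ → ℝ := fun t => φ 0 t -
      ∑ m ∈ Finset.range (n + 1 + 1), φ m 0 * t ^ m / m.factorial with hf
    have hderivsum : ∀ t : ℝ, HasDerivAt
        (fun t : ℝ => ∑ m ∈ Finset.range (n + 1 + 1), φ m 0 * t ^ m / m.factorial)
        (∑ m ∈ Finset.range (n + 1), φ (m + 1) 0 * t ^ m / m.factorial) t := by
      intro t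
      have h1 : ∀ m : ℕ, HasDerivAt (fun t : ℝ => φ m 0 * t ^ m / m.factorial)
          (φ m 0 * (m * t ^ (m - 1)) / m.factorial) t := fun m =>
        ((hasDerivAt_pow m t).const_mul _).div_const _
      have h2 := HasDerivAt.fun_sum (u := Finset.range (n + 1 + 1)) fun m _ => h1 m
      refine h2.congr_deriv ?_
      rw [Finset.sum_range_succ']
      simp only [Nat.cast_zero, zero_mul, mul_zero, zero_div, add_zero]
      refine Finset.sum_congr rfl fun m _ => ?_
      rw [Nat.factorial_succ]
      have : (m.factorial : ℝ) ≠ 0 := by positivity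
      push_cast
      field_simp
    have hfd : ∀ t ∈ Set.Icc (0 : ℝ) 1, HasDerivAt f
        (φ 1 t - ∑ m ∈ Finset.range (n + 1), φ (m + 1) 0 * t ^ m / m.factorial) t := fun t ht =>
      (hφ 0 (by omega) t ht).sub (hderivsum t)
    have hB : ∀ t : ℝ, 0 ≤ t → HasDerivAt
        (fun t : ℝ => C / (P * (ν + ((n + 1 : ℕ) : ℝ))) * t ^ (ν + ((n + 1 : ℕ) : ℝ)))
        (C / P * t ^ (ν + (n : ℝ))) t := by
      intro t _
      have h := (Real.hasDerivAt_rpow_const (x := t) (p := ν + ((n + 1 : ℕ) : ℝ))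
        (Or.inr (by push_cast; linarith [show (0 : ℝ) ≤ n by positivity]))).const_mul
          (C / (P * (ν + ((n + 1 : ℕ) : ℝ))))
      refine h.congr_deriv ?_
      have : ν + ((n + 1 : ℕ) : ℝ) - 1 = ν + n := by push_cast; ring
      rw [this]
      field_simp
    intro t ht
    rw [hPs]
    -- The derivative of the remainder is the remainder of the shifted family, bounded by induction;
    -- integrating that bound produces the new factor ν + n + 1 in the denominator.
    have key := image_norm_le_of_norm_deriv_right_le_deriv_boundary' (a := (0 : ℝ)) (b := 1)
      (f := f) (f' := fun t => φ 1 t - ∑ m ∈ Finset.range (n + 1), φ (m + 1) 0 * t ^ m / m.factorial)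
      (B := fun t : ℝ => C / (P * (ν + ((n + 1 : ℕ) : ℝ))) * t ^ (ν + ((n + 1 : ℕ) : ℝ)))
      (B' := fun t => C / P * t ^ (ν + (n : ℝ)))
      (fun t ht => (hfd t ht).continuousAt.continuousWithinAt)
      (fun t ht => (hfd t (Set.Ico_subset_Icc_self ht)).hasDerivWithinAt)
      (by
        have : f 0 = 0 := by
          simp only [hf]
          rw [Finset.sum_range_succ']
          simp
        rw [this, Real.zero_rpow hpos.ne']
        simp)
      (fun t ht => (hB t ht.1).continuousAt.continuousWithinAt)
      (fun t ht => (hB t ht.1).hasDerivWithinAt)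
      (fun t ht => by
        rw [Real.norm_eq_abs]
        exact ih' t (Set.Ico_subset_Icc_self ht))
    exact key ht

theorem abs_taylor_remainder_le {ν C : ℝ} (hν : 0 < ν) (n : ℕ) (φ : ℕ → ℝ → ℝ)
    (hφ : ∀ m < n, ∀ t ∈ Set.Icc (0 : ℝ) 1, HasDerivAt (φ m) (φ (m + 1) t) t)
    (hC : ∀ t ∈ Set.Icc (0 : ℝ) 1, |φ n t - φ n 0| ≤ C * t ^ ν) :
    |φ 0 1 - ∑ m ∈ Finset.range (n + 1), φ m 0 / m.factorial| ≤
        C / (∏ j ∈ Finset.Icc 1 n, (ν + (j : ℝ))) := by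
  simpa using abs_taylor_remainder_le_aux hν n φ hφ hC 1 (by simp)

/-- The two-variable version: `ψ m l` is the derivative of order `m` in the first and of order `l`
in the second variable. -/
theorem abs_double_taylor_remainder_le {ν C : ℝ} (hν : 0 < ν) (n : ℕ)
    (ψ : ℕ → ℕ → ℝ → ℝ → ℝ)
    (h₁ : ∀ m < n, ∀ l ≤ n, ∀ t ∈ Set.Icc (0 : ℝ) 1, ∀ s ∈ Set.Icc (0 : ℝ) 1,
      HasDerivAt (fun t => ψ m l t s) (ψ (m + 1) l t s) t)
    (h₂ : ∀ l < n, ∀ t ∈ Set.Icc (0 : ℝ) 1, ∀ s ∈ Set.Icc (0 : ℝ) 1,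
      HasDerivAt (ψ n l t) (ψ n (l + 1) t s) s)
    (hC : ∀ t ∈ Set.Icc (0 : ℝ) 1, ∀ s ∈ Set.Icc (0 : ℝ) 1,
      |(ψ n n t s - ψ n n 0 s) - (ψ n n t 0 - ψ n n 0 0)| ≤ C * t ^ ν * s ^ ν) :
    |(ψ 0 0 1 1 - ∑ l ∈ Finset.range (n + 1), ψ 0 l 1 0 / l.factorial) -
      ∑ m ∈ Finset.range (n + 1), (ψ m 0 0 1 -
        ∑ l ∈ Finset.range (n + 1), ψ m l 0 0 / l.factorial) / m.factorial| ≤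
      C / ∏ j ∈ Finset.Icc 1 n, (ν + (j : ℝ)) ^ 2 := by
  have h01 : (0 : ℝ) ∈ Set.Icc (0 : ℝ) 1 := by simp
  have h11 : (1 : ℝ) ∈ Set.Icc (0 : ℝ) 1 := by simp
  -- The one-variable estimate in t is applied to the remainder in s. Its Hölder hypothesis is in
  -- turn the one-variable estimate in s, with constant C t^ν, for the differences ψ n l t - ψ n l
  -- 0. Each application contributes one copy of the product.
  have key := abs_taylor_remainder_le (ν := ν) (C := C / ∏ j ∈ Finset.Icc 1 n, (ν + (j : ℝ))) hν n
    (fun m t => ψ m 0 t 1 - ∑ l ∈ Finset.range (n + 1), ψ m l t 0 / l.factorial) ?_ ?_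
  · rw [Finset.prod_pow, sq, ← div_div]
    exact key
  · intro m hm t ht
    refine (h₁ m hm 0 (by omega) t ht 1 h11).sub (HasDerivAt.fun_sum fun l hl => ?_)
    exact (h₁ m hm l (by simpa [Nat.lt_succ_iff] using hl) t ht 0 h01).div_const _
  · intro t ht
    have := abs_taylor_remainder_le (ν := ν) (C := C * t ^ ν) hν n
      (fun l s => ψ n l t s - ψ n l 0 s) (fun l hl s hs =>
        (h₂ l hl t ht s hs).sub (h₂ l hl 0 h01 s hs)) (fun s hs => hC t ht s hs)
    convert this using 1
    · congr 1
      simp only [sub_div, Finset.sum_sub_distrib]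
      ring
    · ring

/-! ### Iterated directional derivatives -/

section DirDeriv

variable {E : Type*} [NormedAddCommGroup E] [NormedSpace ℝ E]

/-- The iterated derivative of `f` in the directions of the list `L`. -/
noncomputable def dirDeriv : List E → (E → ℝ) → E → ℝ
  | [], f => f
  | a :: L, f => fun x => fderiv ℝ (dirDeriv L f) x a

theorem ContDiffOn.dirDeriv {U : Set E} (hU : IsOpen U) {f : E → ℝ} (L : List E) {m : ℕ}
    (hf : ContDiffOn ℝ ((L.length + m : ℕ) : ℕ∞) f U) :
    ContDiffOn ℝ (m : ℕ∞) (dirDeriv L f) U := by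
  induction L generalizing m with
  | nil => simpa [_root_.dirDeriv] using hf
  | cons a L ih =>
    have h1 : ContDiffOn ℝ ((m + 1 : ℕ) : ℕ∞) (_root_.dirDeriv L f) U :=
      ih (by simpa [add_assoc, add_comm 1 m] using hf)
    have h2 : ContDiffOn ℝ (m : ℕ∞) (fderiv ℝ (_root_.dirDeriv L f)) U :=
      h1.fderiv_of_isOpen hU (by norm_cast)
    exact h2.clm_apply contDiffOn_const

theorem dirDeriv_append (L L' : List E) (f : E → ℝ) :
    dirDeriv (L ++ L') f = dirDeriv L (dirDeriv L' f) := by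
  induction L with
  | nil => rfl
  | cons a L ih => simp [dirDeriv, ih]

theorem dirDeriv_congr {U : Set E} (hU : IsOpen U) {f g : E → ℝ} (h : Set.EqOn f g U)
    (L : List E) : Set.EqOn (dirDeriv L f) (dirDeriv L g) U := by
  induction L with
  | nil => exact h
  | cons a L ih =>
    intro x hx
    have : dirDeriv L f =ᶠ[𝓝 x] dirDeriv L g := ih.eventuallyEq_of_mem (hU.mem_nhds hx)
    simp only [dirDeriv, this.fderiv_eq]

theorem dirDeriv_swap {U : Set E} (hU : IsOpen U) {f : E → ℝ} (hf : ContDiffOn ℝ 2 f U)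
    (a b : E) : Set.EqOn (dirDeriv [a, b] f) (dirDeriv [b, a] f) U := by
  intro x hx
  have hc : ContDiffAt ℝ 2 f x := hf.contDiffAt (hU.mem_nhds hx)
  have hd : DifferentiableAt ℝ (fderiv ℝ f) x :=
    (hc.fderiv_right (m := 1) (by norm_num)).differentiableAt one_ne_zero
  have hs := hc.isSymmSndFDerivAt (by simp)
  have key : ∀ a b : E, dirDeriv [a, b] f x = fderiv ℝ (fderiv ℝ f) x a b := fun a b => by
    simp only [dirDeriv]
    rw [fderiv_clm_apply hd (differentiableAt_const _)]
    simp
  rw [key, key, hs.eq]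

/-- Permutations of lists are generated by adjacent transpositions, so the symmetry of the second
derivative suffices. Lists of directions make this induction and the later mixing of u, v and
coordinate directions convenient. -/
theorem dirDeriv_perm {U : Set E} (hU : IsOpen U) {f : E → ℝ} {L L' : List E}
    (hL : L.Perm L') (hf : ContDiffOn ℝ (L.length : ℕ∞) f U) :
    Set.EqOn (dirDeriv L f) (dirDeriv L' f) U := by
  induction hL with
  | nil => exact fun _ _ => rfl
  | @cons a L L' hp ih =>
    have h1 := ih (hf.of_le (by simp))
    exact dirDeriv_congr hU h1 [a]
  | swap a b L =>
    have : ContDiffOn ℝ ((2 : ℕ) : ℕ∞) (dirDeriv L f) U :=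
      ContDiffOn.dirDeriv hU L (by simpa [add_assoc, one_add_one_eq_two] using hf)
    exact dirDeriv_swap hU (by exact_mod_cast this) b a
  | trans h1 h2 ih1 ih2 =>
    exact (ih1 hf).trans (ih2 (by rwa [← h1.length_eq]))

theorem dirDeriv_comp_const_sub (f : E → ℝ) (c : E) (v : E) (l : ℕ) (y : E) :
    dirDeriv (List.replicate l v) (fun y => f (c - y)) y =
      dirDeriv (List.replicate l (-v)) f (c - y) := by
  induction l generalizing y with
  | zero => rfl
  | succ l ih =>
    simp only [List.replicate_succ, dirDeriv]
    have : dirDeriv (List.replicate l v) (fun y => f (c - y)) =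
      fun y => dirDeriv (List.replicate l (-v)) f (c - y) := funext ih
    rw [this]
    have h1 := (ContinuousLinearEquiv.neg ℝ (M := E)).comp_right_fderiv
      (f := fun y => dirDeriv (List.replicate l (-v)) f (c + y)) (x := y)
    rw [fderiv_comp_add_left] at h1
    have h2 := congrArg (fun T : E →L[ℝ] ℝ => T v) h1
    simpa [Function.comp_def, sub_eq_add_neg] using h2

theorem iteratedFDeriv_eq_dirDeriv {U : Set E} (hU : IsOpen U) {f : E → ℝ} {m : ℕ}
    (hf : ContDiffOn ℝ (m : ℕ∞) f U) (v : Fin m → E) {x : E} (hx : x ∈ U) :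
    iteratedFDeriv ℝ m f x v = dirDeriv (List.ofFn v) f x := by
  induction m generalizing x with
  | zero => simp [dirDeriv]
  | succ m ih =>
    have hd : DifferentiableAt ℝ (iteratedFDeriv ℝ m f) x := by
      have := (hf.contDiffAt (hU.mem_nhds hx)).differentiableAt_iteratedFDeriv (m := m)
        (by norm_cast; omega)
      exact this
    rw [hd.iteratedFDeriv_succ_apply_left', List.ofFn_succ]
    simp only [dirDeriv]
    have h : (fun y => iteratedFDeriv ℝ m f y (Fin.tail v)) =ᶠ[𝓝 x]
        dirDeriv (List.ofFn fun i => v i.succ) f := by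
      filter_upwards [hU.mem_nhds hx] with y hy
      exact ih (hf.of_le (by norm_cast; omega)) _ hy
    rw [h.fderiv_eq]

theorem iteratedFDeriv_const_eq_dirDeriv {U : Set E} (hU : IsOpen U) {f : E → ℝ} {m : ℕ}
    (hf : ContDiffOn ℝ (m : ℕ∞) f U) (v : E) {x : E} (hx : x ∈ U) :
    iteratedFDeriv ℝ m f x (fun _ => v) = dirDeriv (List.replicate m v) f x := by
  rw [iteratedFDeriv_eq_dirDeriv hU hf _ hx, List.ofFn_const]

theorem iteratedFDeriv_comp_perm_of_contDiffOn {U : Set E} (hU : IsOpen U) {f : E → ℝ} {m : ℕ}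
    (hf : ContDiffOn ℝ (m : ℕ∞) f U) (v : Fin m → E) (σ : Equiv.Perm (Fin m)) {x : E}
    (hx : x ∈ U) :
    iteratedFDeriv ℝ m f x (fun i => v (σ i)) = iteratedFDeriv ℝ m f x v := by
  rw [iteratedFDeriv_eq_dirDeriv hU hf _ hx, iteratedFDeriv_eq_dirDeriv hU hf _ hx]
  refine dirDeriv_perm hU ?_ (by simpa using hf) hx
  exact Equiv.Perm.ofFn_comp_perm σ v

end DirDeriv

/-! ### Hölder bounds for directional derivatives -/

section Holder

variable {d : ℕ}

local notation "E" => EuclideanSpace ℝ (Fin d)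

/-- Both lists contain each coordinate direction equally often: the block of index i has exactly
`J.count i` elements. This links derivatives along lists to the multi-index derivatives in the
Hölder semi-norm. -/
theorem ofFn_multiDirections_perm (J : List (Fin d)) :
    ((J.map fun i => (EuclideanSpace.single i 1 : E))).Perm
      (List.ofFn (multiDirections fun i => J.count i)) := by
  have h1 : (List.ofFn (multiDirections fun i => J.count i)) =
      (List.ofFn fun j : Fin (∑ i, J.count i) => (finSigmaFinEquiv.symm j).1).map
        fun i => (EuclideanSpace.single i 1 : E) := by
    rw [List.map_ofFn]
    rfl
  rw [h1]
  refine List.Perm.map _ (List.perm_iff_count.2 fun i => ?_)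
  have h2 : ∀ (m : ℕ) (g : Fin m → Fin d), (List.ofFn g).count i =
      (Finset.univ.filter fun j => g j = i).card := by
    intro m g
    rw [List.count_eq_countP, List.countP_eq_length_filter, List.ofFn_eq_map, List.filter_map,
      List.length_map, ← List.toFinset_card_of_nodup ((List.nodup_finRange m).filter _)]
    congr 1
    ext j
    simp
  rw [h2]
  have h3 : (Finset.univ.filter fun j : Fin (∑ i, J.count i) => (finSigmaFinEquiv.symm j).1 = i)
      = (Finset.univ : Finset (Fin (J.count i))).map
        ((Function.Embedding.sigmaMk (β := fun i => Fin (J.count i)) i).trans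
          (finSigmaFinEquiv (n := fun i => J.count i)).toEmbedding) := by
    ext j
    simp only [Finset.mem_filter, Finset.mem_univ, true_and, Finset.mem_map]
    constructor
    · rintro rfl
      exact ⟨(finSigmaFinEquiv.symm j).2, finSigmaFinEquiv.apply_symm_apply j⟩
    · rintro ⟨k, rfl⟩
      exact congrArg Sigma.fst (finSigmaFinEquiv.symm_apply_apply _)
  rw [h3, Finset.card_map, Finset.card_univ, Fintype.card_fin]

theorem sum_count_eq_length (J : List (Fin d)) : ∑ i, J.count i = J.length := by
  have := (ofFn_multiDirections_perm J).length_eq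
  simpa using this.symm

/-- The Hölder bound for the partial derivatives gives one for iterated directional derivatives. -/
theorem abs_dirDeriv_sub_le {U : Set E} (hU : IsOpen U) {Φ : E → ℝ} {r : ℕ}
    (hΦ : ContDiffOn ℝ (r : ℕ∞) Φ U) {y y' : E} (hy : y ∈ U) (hy' : y' ∈ U) {A : ℝ}
    (hA : ∀ α : Fin d → ℕ, ∑ i, α i = r → |partialDeriv α Φ y - partialDeriv α Φ y'| ≤ A)
    (L : List E) (J : List (Fin d)) (hLJ : L.length + J.length = r) :
    |dirDeriv (L ++ J.map fun i => (EuclideanSpace.single i 1 : E)) Φ y -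
      dirDeriv (L ++ J.map fun i => (EuclideanSpace.single i 1 : E)) Φ y'| ≤
      (L.map fun v => ∑ i, |v i|).prod * A := by
  induction L generalizing J with
  | nil =>
    simp only [List.nil_append, List.map_nil, List.prod_nil, one_mul]
    have hp := ofFn_multiDirections_perm J
    have hJ : J.length = r := by simpa using hLJ
    have hΦ' : ContDiffOn ℝ ((J.map fun i => (EuclideanSpace.single i 1 : E)).length : ℕ∞) Φ U := by
      simpa [hJ] using hΦ
    have hΦ'' : ContDiffOn ℝ ((∑ i, J.count i : ℕ) : ℕ∞) Φ U := by
      rwa [sum_count_eq_length, hJ]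
    rw [dirDeriv_perm hU hp hΦ' hy, dirDeriv_perm hU hp hΦ' hy',
      ← iteratedFDeriv_eq_dirDeriv hU hΦ'' _ hy, ← iteratedFDeriv_eq_dirDeriv hU hΦ'' _ hy']
    exact hA _ (by rw [sum_count_eq_length, hJ])
  | cons a L ih =>
    set e : Fin d → E := fun i => EuclideanSpace.single i 1 with he
    have hlen : (L ++ J.map e).length + 1 = r := by simp at hLJ ⊢; omega
    -- The first direction is expanded in coordinates, and each coordinate vector is then moved into
    -- the tail `J`. The induction needs a tail of coordinate directions for this reason.
    have hexp : ∀ x ∈ U, dirDeriv ((a :: L) ++ J.map e) Φ x =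
        ∑ i, a i * dirDeriv (L ++ (i :: J).map e) Φ x := by
      intro x hx
      have ha : a = ∑ i, a i • e i := by
        ext j
        simp [he, Finset.sum_apply, Pi.single_apply]
      have h1 : dirDeriv ((a :: L) ++ J.map e) Φ x =
          ∑ i, a i * dirDeriv (e i :: (L ++ J.map e)) Φ x := by
        simp only [List.cons_append, dirDeriv]
        conv_lhs => rw [ha]
        simp
      rw [h1]
      refine Finset.sum_congr rfl fun i _ => ?_
      congr 1
      refine dirDeriv_perm hU ?_ ?_ hx
      · simpa using List.perm_middle.symm
      · rw [List.length_cons, hlen]; exact hΦ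
    rw [hexp y hy, hexp y' hy', ← Finset.sum_sub_distrib, List.map_cons, List.prod_cons,
      mul_assoc, Finset.sum_mul]
    refine (Finset.abs_sum_le_sum_abs _ _).trans (Finset.sum_le_sum fun i _ => ?_)
    rw [← mul_sub, abs_mul]
    exact mul_le_mul_of_nonneg_left (ih (i :: J) (by simp at hLJ ⊢; omega)) (abs_nonneg _)

/-- Cauchy–Schwarz. One factor √d for each of the r directions is the source of d^{r/2} in
`holderConst`. -/
theorem sum_abs_le_sqrt_mul_norm (v : E) : ∑ i, |v i| ≤ √d * ‖v‖ := by
  rw [EuclideanSpace.norm_eq, ← Real.sqrt_mul (by positivity)]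
  refine Real.le_sqrt_of_sq_le ?_
  have := sq_sum_le_card_mul_sum_sq (s := (Finset.univ : Finset (Fin d))) (f := fun i => |v i|)
  simpa using this

end Holder

/-! ### The double Taylor remainder of `Φ (t u + s v)` -/

section DoubleRemainder

variable {E : Type*} [NormedAddCommGroup E] [NormedSpace ℝ E]

theorem hasDerivAt_dirDeriv_line {U : Set E} (hU : IsOpen U) {f : E → ℝ} (L : List E)
    (hf : ContDiffOn ℝ ((L.length + 1 : ℕ) : ℕ∞) f U) (w u : E) {t : ℝ} (ht : w + t • u ∈ U) :
    HasDerivAt (fun t : ℝ => dirDeriv L f (w + t • u)) (dirDeriv (u :: L) f (w + t • u)) t := by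
  have h1 : DifferentiableAt ℝ (dirDeriv L f) (w + t • u) :=
    ((ContDiffOn.dirDeriv hU L hf).contDiffAt (hU.mem_nhds ht)).differentiableAt (by simp)
  have h2 : HasDerivAt (fun t : ℝ => w + t • u) u t := by
    simpa using ((hasDerivAt_id t).smul_const u).const_add w
  exact h1.hasFDerivAt.comp_hasDerivAt t h2

/-- The Taylor remainder of degree `n`, in both variables, of `(t, s) ↦ Φ (t u + s v)`
at `(1, 1)`. -/
noncomputable def doubleRemainder (n : ℕ) (Φ : E → ℝ) (u v : E) : ℝ :=
  (Φ (u + v) - ∑ l ∈ Finset.range (n + 1), dirDeriv (List.replicate l v) Φ u / l.factorial) -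
    ∑ m ∈ Finset.range (n + 1), (dirDeriv (List.replicate m u) Φ v -
      ∑ l ∈ Finset.range (n + 1),
        dirDeriv (List.replicate l v ++ List.replicate m u) Φ 0 / l.factorial) / m.factorial

/-- On the plane spanned by u and v, the derivatives of (t, s) ↦ Φ(t u + s v) are directional
derivatives along copies of u and v. Differentiating in t puts u in front, so symmetry is used to
restore the order of the list. -/
theorem abs_doubleRemainder_le {U : Set E} (hU : IsOpen U) {Φ : E → ℝ} {n : ℕ}
    (hΦ : ContDiffOn ℝ ((2 * n : ℕ) : ℕ∞) Φ U) {u v : E}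
    (huv : ∀ t ∈ Set.Icc (0 : ℝ) 1, ∀ s ∈ Set.Icc (0 : ℝ) 1, t • u + s • v ∈ U)
    {ν C : ℝ} (hν : 0 < ν)
    (hC : ∀ t ∈ Set.Icc (0 : ℝ) 1, ∀ s ∈ Set.Icc (0 : ℝ) 1,
      |(dirDeriv (List.replicate n v ++ List.replicate n u) Φ (t • u + s • v) -
          dirDeriv (List.replicate n v ++ List.replicate n u) Φ (s • v)) -
        (dirDeriv (List.replicate n v ++ List.replicate n u) Φ (t • u) -
          dirDeriv (List.replicate n v ++ List.replicate n u) Φ 0)| ≤ C * t ^ ν * s ^ ν) :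
    |doubleRemainder n Φ u v| ≤ C / ∏ j ∈ Finset.Icc 1 n, (ν + (j : ℝ)) ^ 2 := by
  have key := abs_double_taylor_remainder_le (C := C) hν n
    (fun m l t s => dirDeriv (List.replicate l v ++ List.replicate m u) Φ (t • u + s • v)) ?_ ?_ ?_
  · simpa [doubleRemainder, dirDeriv] using key
  · intro m hm l hl t ht s hs
    have hlen : ((List.replicate l v ++ List.replicate m u).length + 1 : ℕ) ≤ 2 * n := by
      simp; omega
    have hmem : s • v + t • u ∈ U := by rw [add_comm]; exact huv t ht s hs
    have h := hasDerivAt_dirDeriv_line hU (List.replicate l v ++ List.replicate m u)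
      (hΦ.of_le (by exact_mod_cast hlen)) (s • v) u hmem
    have hp : dirDeriv (u :: (List.replicate l v ++ List.replicate m u)) Φ (s • v + t • u) =
        dirDeriv (List.replicate l v ++ List.replicate (m + 1) u) Φ (s • v + t • u) := by
      refine dirDeriv_perm hU ?_ (hΦ.of_le (by exact_mod_cast hlen)) hmem
      rw [List.replicate_succ]
      exact List.perm_middle.symm
    rw [hp] at h
    simpa only [add_comm] using h
  · intro l hl t ht s hs
    have hlen : ((List.replicate l v ++ List.replicate n u).length + 1 : ℕ) ≤ 2 * n := by
      simp; omega
    have h := hasDerivAt_dirDeriv_line hU (List.replicate l v ++ List.replicate n u)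
      (hΦ.of_le (by exact_mod_cast hlen)) (t • u) v (huv t ht s hs)
    simpa [List.replicate_succ] using h
  · intro t ht s hs
    simpa using hC t ht s hs

/-- The mixed derivatives, of order up to 2n, are taken at the fixed point 0 and only acquire powers
of θ. Continuity is needed just for derivatives in a single direction, of order at most n. -/
theorem continuous_doubleRemainder_smul {Φ : E → ℝ} {n : ℕ} (hΦ : ContDiff ℝ (n : ℕ∞) Φ)
    (u v : E) : Continuous fun θ : ℝ => doubleRemainder n Φ (θ • u) (θ • v) := by
  have hmul : ∀ (θ : ℝ) (w : E) (l : ℕ) (c : ℝ) (g : E → ℝ),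
      dirDeriv (List.replicate l (θ • w)) (c • g) =
        (θ ^ l * c) • dirDeriv (List.replicate l w) g := by
    intro θ w l c g
    induction l with
    | zero => simp [dirDeriv]
    | succ l ih =>
      funext x
      simp only [List.replicate_succ, dirDeriv]
      rw [ih, fderiv_const_smul_field]
      simp
      ring
  have hsm' : ∀ (θ : ℝ) (m : ℕ) (w x : E) (f : E → ℝ), dirDeriv (List.replicate m (θ • w)) f x =
      θ ^ m * dirDeriv (List.replicate m w) f x := fun θ m w x f => by
    simpa using congrFun (hmul θ w m 1 f) x
  have hsm : ∀ (θ : ℝ) (l m : ℕ) (x : E) (f : E → ℝ),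
      dirDeriv (List.replicate l (θ • v) ++ List.replicate m (θ • u)) f x =
        θ ^ l * θ ^ m * dirDeriv (List.replicate l v ++ List.replicate m u) f x := by
    intro θ l m x f
    have h1 : dirDeriv (List.replicate m (θ • u)) f =
        θ ^ m • dirDeriv (List.replicate m u) f := by simpa using hmul θ u m 1 f
    rw [dirDeriv_append, dirDeriv_append, h1, hmul]
    simp
  have hc : ∀ m ≤ n, ∀ w : E, Continuous (dirDeriv (List.replicate m w) Φ) := by
    intro m hm w
    have : ContDiffOn ℝ ((0 : ℕ) : ℕ∞) (dirDeriv (List.replicate m w) Φ) Set.univ :=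
      ContDiffOn.dirDeriv isOpen_univ _ (hΦ.contDiffOn.of_le (by simpa using hm))
    exact continuousOn_univ.1 this.continuousOn
  have h0 : Continuous Φ := hΦ.continuous
  simp only [doubleRemainder, hsm, hsm']
  refine (Continuous.sub (by fun_prop) ?_).sub ?_
  · refine continuous_finsetSum _ fun l hl => ?_
    have := hc l (by simpa [Nat.lt_succ_iff] using hl) v
    fun_prop
  · refine continuous_finsetSum _ fun l hl => ?_
    have := hc l (by simpa [Nat.lt_succ_iff] using hl) u
    fun_prop

end DoubleRemainder

/-! ### The Hölder estimate of the double remainder -/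

section HolderBound

variable {d : ℕ}

local notation "E" => EuclideanSpace ℝ (Fin d)

/-- A quantity below two bounds is below their geometric mean. This distributes the Hölder exponent
evenly between u and v. -/
theorem le_mul_of_le_of_le_of_mul_eq_sq {x K a b c : ℝ} (hx : 0 ≤ x) (hK : 0 ≤ K) (hc : 0 ≤ c)
    (ha : x ≤ K * a) (hb : x ≤ K * b) (hab : a * b = c ^ 2) : x ≤ K * c := by
  refine abs_le_of_sq_le_sq' ?_ (by positivity) |>.2
  calc x ^ 2 = x * x := sq x
    _ ≤ (K * a) * (K * b) := mul_le_mul ha hb hx (hx.trans ha)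
    _ = (K * c) ^ 2 := by rw [mul_pow, ← hab]; ring

theorem abs_dirDeriv_replicate_sub_le {U : Set E} (hU : IsOpen U) {Φ : E → ℝ} {r : ℕ}
    (hΦ : ContDiffOn ℝ (r : ℕ∞) Φ U) {γ H : ℝ} (hH : 0 ≤ H)
    (hA : ∀ α : Fin d → ℕ, ∑ i, α i = r → ∀ y ∈ U, ∀ y' ∈ U,
      |partialDeriv α Φ y - partialDeriv α Φ y'| ≤ H * ‖y - y'‖ ^ γ)
    (L : List E) (hL : L.length = r) {y y' : E} (hy : y ∈ U) (hy' : y' ∈ U) :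
    |dirDeriv L Φ y - dirDeriv L Φ y'| ≤
      (L.map fun w => √d * ‖w‖).prod * (H * ‖y - y'‖ ^ γ) := by
  have h := abs_dirDeriv_sub_le hU hΦ hy hy' (fun α hα => hA α hα y hy y' hy') L [] (by simpa)
  simp only [List.map_nil, List.append_nil] at h
  refine h.trans (mul_le_mul_of_nonneg_right ?_ (by positivity))
  clear h hL
  induction L with
  | nil => simp
  | cons a L ih =>
    simp only [List.map_cons, List.prod_cons]
    refine mul_le_mul (sum_abs_le_sqrt_mul_norm a) ih ?_ (by positivity)
    exact List.prod_nonneg fun x hx => by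
      obtain ⟨w, -, rfl⟩ := List.mem_map.1 hx
      positivity

/-- The mixed derivative with n copies of u and n of v has order r or r - 1. For even r it is itself
Hölder, so its mixed second difference has two bounds with exponent γ, one in u and one in v, and
their mean has exponent γ/2 in each. For odd r one derivative is left over: the mean value
inequality gives exponents 1 and γ, in either order, whose mean is (1 + γ)/2. In both cases n + ν =
μ. -/
theorem abs_doubleRemainder_le_holder {U : Set E} (hU : IsOpen U) {Φ : E → ℝ} {r : ℕ}
    (hΦ : ContDiffOn ℝ (r : ℕ∞) Φ U) {γ H : ℝ} (hγ : 0 < γ) (hH : 0 ≤ H)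
    (hA : ∀ α : Fin d → ℕ, ∑ i, α i = r → ∀ y ∈ U, ∀ y' ∈ U,
      |partialDeriv α Φ y - partialDeriv α Φ y'| ≤ H * ‖y - y'‖ ^ γ) {u v : E}
    (huv : ∀ t ∈ Set.Icc (0 : ℝ) 1, ∀ s ∈ Set.Icc (0 : ℝ) 1, t • u + s • v ∈ U) :
    |doubleRemainder (r / 2) Φ u v| ≤
      holderConst d r γ * H * (‖u‖ ^ (((r : ℝ) + γ) / 2) * ‖v‖ ^ (((r : ℝ) + γ) / 2)) := by
  have h0 : (0 : ℝ) ∈ Set.Icc (0 : ℝ) 1 := by simp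
  have htu : ∀ t ∈ Set.Icc (0 : ℝ) 1, t • u ∈ U := fun t ht => by simpa using huv t ht 0 h0
  have hsv : ∀ t ∈ Set.Icc (0 : ℝ) 1, t • v ∈ U := fun t ht => by simpa using huv 0 h0 t ht
  have h00 : (0 : E) ∈ U := by simpa using htu 0 h0
  set n := r / 2 with hn
  set L : List E := List.replicate n v ++ List.replicate n u with hL
  have hLprod : (L.map fun w => √d * ‖w‖).prod = (d : ℝ) ^ n * (‖v‖ ^ n * ‖u‖ ^ n) := by
    simp only [hL, List.map_append, List.map_replicate, List.prod_append, List.prod_replicate,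
      mul_pow]
    have : (d : ℝ) ^ n = √d ^ n * √d ^ n := by rw [← mul_pow, Real.mul_self_sqrt (by positivity)]
    rw [this]; ring
  rcases Nat.even_or_odd r with hev | hodd
  · have hr : r = 2 * n := by rw [hn]; obtain ⟨m, hm⟩ := hev; omega
    have hbd : ∀ y ∈ U, ∀ y' ∈ U, |dirDeriv L Φ y - dirDeriv L Φ y'| ≤
        (d : ℝ) ^ n * (‖v‖ ^ n * ‖u‖ ^ n) * H * ‖y - y'‖ ^ γ := fun y hy y' hy' => by
      have := abs_dirDeriv_replicate_sub_le hU hΦ hH hA L (by simp [hL]; omega) hy hy'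
      rwa [hLprod, ← mul_assoc] at this
    set A := (d : ℝ) ^ n * (‖v‖ ^ n * ‖u‖ ^ n) * H with hAdef
    have hApos : 0 ≤ A := by positivity
    have key := abs_doubleRemainder_le hU (n := n) (u := u) (v := v)
      (C := 2 * A * (‖u‖ ^ (γ / 2) * ‖v‖ ^ (γ / 2))) (hr ▸ hΦ) huv (half_pos hγ) ?_
    · refine key.trans (le_of_eq ?_)
      have hpow : ∀ x : ℝ, 0 ≤ x → x ^ (((r : ℝ) + γ) / 2) = x ^ n * x ^ (γ / 2) := fun x hx => by
        rw [← Real.rpow_natCast, ← Real.rpow_add_of_nonneg hx (by positivity) (by positivity)]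
        congr 1
        rw [hr]; push_cast; ring
      have hd : (d : ℝ) ^ ((r : ℝ) / 2) = (d : ℝ) ^ n := by
        rw [← Real.rpow_natCast]
        congr 1
        rw [hr]; push_cast; ring
      rw [holderConst, if_pos hev, hd, hpow _ (norm_nonneg _), hpow _ (norm_nonneg _), hAdef]
      ring
    · intro t ht s hs
      have e1 : ∀ p : ℝ, 0 ≤ p → p ^ γ = p ^ (γ / 2) * p ^ (γ / 2) := fun p hp => by
        rw [← Real.rpow_add_of_nonneg hp (by positivity) (by positivity), add_halves]
      have h1 := hbd _ (huv t ht s hs) _ (hsv s hs)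
      have h2 := hbd _ (htu t ht) _ h00
      have h3 := hbd _ (huv t ht s hs) _ (htu t ht)
      have h4 := hbd _ (hsv s hs) _ h00
      simp only [add_sub_cancel_right, add_sub_cancel_left, sub_zero, norm_smul, Real.norm_eq_abs,
        abs_of_nonneg ht.1, abs_of_nonneg hs.1] at h1 h2 h3 h4
      -- The factor 2 comes from bounding the second difference by two first differences, grouped
      -- once as increments by t u and once as increments by s v.
      have hmain := le_mul_of_le_of_le_of_mul_eq_sq (abs_nonneg
          ((dirDeriv L Φ (t • u + s • v) - dirDeriv L Φ (s • v)) -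
            (dirDeriv L Φ (t • u) - dirDeriv L Φ 0)))
        (K := 2 * A) (a := (t * ‖u‖) ^ γ) (b := (s * ‖v‖) ^ γ)
        (c := (t * ‖u‖) ^ (γ / 2) * (s * ‖v‖) ^ (γ / 2)) (by positivity)
        (mul_nonneg (Real.rpow_nonneg (mul_nonneg ht.1 (norm_nonneg _)) _)
          (Real.rpow_nonneg (mul_nonneg hs.1 (norm_nonneg _)) _)) ?_ ?_ ?_
      · rw [Real.mul_rpow ht.1 (norm_nonneg _), Real.mul_rpow hs.1 (norm_nonneg _)] at hmain
        refine hmain.trans (le_of_eq ?_)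
        ring
      · refine (abs_sub _ _).trans ?_
        linarith
      · rw [sub_sub_sub_comm]
        refine (abs_sub _ _).trans ?_
        linarith
      · rw [e1 _ (mul_nonneg ht.1 (norm_nonneg u)), e1 _ (mul_nonneg hs.1 (norm_nonneg v))]
        ring
  · have hr : r = 2 * n + 1 := by rw [hn]; obtain ⟨m, hm⟩ := hodd; omega
    have hbd : ∀ w : E, ∀ y ∈ U, ∀ y' ∈ U, |dirDeriv (w :: L) Φ y - dirDeriv (w :: L) Φ y'| ≤
        √d * ((d : ℝ) ^ n * (‖v‖ ^ n * ‖u‖ ^ n)) * H * (‖w‖ * ‖y - y'‖ ^ γ) :=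
      fun w y hy y' hy' => by
      have := abs_dirDeriv_replicate_sub_le hU hΦ hH hA (w :: L) (by simp [hL]; omega) hy hy'
      rw [List.map_cons, List.prod_cons, hLprod] at this
      refine this.trans (le_of_eq ?_)
      ring
    set A := √d * ((d : ℝ) ^ n * (‖v‖ ^ n * ‖u‖ ^ n)) * H with hAdef
    have hApos : 0 ≤ A := by positivity
    have key := abs_doubleRemainder_le hU (n := n) (u := u) (v := v) (ν := (1 + γ) / 2)
      (C := A * (‖u‖ ^ ((1 + γ) / 2) * ‖v‖ ^ ((1 + γ) / 2)))
      (hΦ.of_le (by exact_mod_cast (by omega : 2 * n ≤ r))) huv (by positivity) ?_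
    · refine key.trans (le_of_eq ?_)
      have hpow : ∀ x : ℝ, 0 ≤ x → x ^ (((r : ℝ) + γ) / 2) = x ^ n * x ^ ((1 + γ) / 2) :=
        fun x hx => by
        rw [← Real.rpow_natCast, ← Real.rpow_add_of_nonneg hx (by positivity) (by positivity)]
        congr 1
        rw [hr]; push_cast; ring
      have hd : (d : ℝ) ^ ((r : ℝ) / 2) = √d * (d : ℝ) ^ n := by
        rw [← Real.rpow_natCast, Real.sqrt_eq_rpow,
          ← Real.rpow_add_of_nonneg (by positivity) (by positivity) (by positivity)]
        congr 1
        rw [hr]; push_cast; ring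
      rw [holderConst, if_neg (Nat.not_even_iff_odd.2 hodd), hd, hpow _ (norm_nonneg _),
        hpow _ (norm_nonneg _), hAdef]
      ring
    · -- a one-sided bound by the mean value inequality, used in both variables
      have mvt : ∀ a b : E, (∀ t ∈ Set.Icc (0 : ℝ) 1, ∀ s ∈ Set.Icc (0 : ℝ) 1,
          t • a + s • b ∈ U) → ∀ t ∈ Set.Icc (0 : ℝ) 1, ∀ s ∈ Set.Icc (0 : ℝ) 1,
          |(dirDeriv L Φ (t • a + s • b) - dirDeriv L Φ (s • b)) -
            (dirDeriv L Φ (t • a) - dirDeriv L Φ 0)| ≤ A * ((t * ‖a‖) * (s * ‖b‖) ^ γ) := by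
        intro a b hab t ht s hs
        have hlen : L.length + 1 = r := by simp [hL]; omega
        have hd1 : ∀ τ ∈ Set.Icc (0 : ℝ) 1, HasDerivAt
            (fun τ : ℝ => dirDeriv L Φ (s • b + τ • a) - dirDeriv L Φ (0 + τ • a))
            (dirDeriv (a :: L) Φ (s • b + τ • a) - dirDeriv (a :: L) Φ (0 + τ • a)) τ :=
          fun τ hτ => (hasDerivAt_dirDeriv_line hU L (by rw [hlen]; exact hΦ) _ _
              (by rw [add_comm]; exact hab τ hτ s hs)).sub
            (hasDerivAt_dirDeriv_line hU L (by rw [hlen]; exact hΦ) _ _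
              (by simpa using hab τ hτ 0 h0))
        have := norm_image_sub_le_of_norm_deriv_le_segment'
          (fun τ hτ => (hd1 τ hτ).hasDerivWithinAt) (C := A * (‖a‖ * (s * ‖b‖) ^ γ))
          (fun τ hτ => by
            have h := hbd a _ (by
                rw [add_comm]; exact hab τ (Set.Ico_subset_Icc_self hτ) s hs : s • b + τ • a ∈ U)
              _ (by simpa using hab τ (Set.Ico_subset_Icc_self hτ) 0 h0 : 0 + τ • a ∈ U)
            simpa [norm_smul, abs_of_nonneg hs.1] using h) t ht
        simp only [Real.norm_eq_abs, zero_add, zero_smul, add_zero, sub_zero] at this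
        rw [sub_sub_sub_comm, add_comm (t • a)]
        rw [sub_sub_sub_comm] at this
        refine le_trans (le_of_eq ?_) (this.trans (le_of_eq ?_))
        · congr 1; ring
        · ring
      intro t ht s hs
      have h1 := mvt u v huv t ht s hs
      have h2 := mvt v u (fun t ht s hs => by rw [add_comm]; exact huv s hs t ht) s hs t ht
      rw [sub_sub_sub_comm, add_comm (s • v)] at h2
      have hmain := le_mul_of_le_of_le_of_mul_eq_sq (abs_nonneg _) hApos
        (c := (t * ‖u‖) ^ ((1 + γ) / 2) * (s * ‖v‖) ^ ((1 + γ) / 2))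
        (mul_nonneg (Real.rpow_nonneg (mul_nonneg ht.1 (norm_nonneg _)) _)
          (Real.rpow_nonneg (mul_nonneg hs.1 (norm_nonneg _)) _)) h1 h2 ?_
      · rw [Real.mul_rpow ht.1 (norm_nonneg _), Real.mul_rpow hs.1 (norm_nonneg _)] at hmain
        refine hmain.trans (le_of_eq ?_)
        ring
      · have e1 : ∀ p : ℝ, 0 ≤ p → (p ^ ((1 + γ) / 2)) ^ 2 = p * p ^ γ := fun p hp => by
          rw [sq, ← Real.rpow_add_of_nonneg hp (by positivity) (by positivity), add_halves,
            Real.rpow_add_of_nonneg hp (by positivity) (by positivity), Real.rpow_one]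
        rw [mul_pow, e1 _ (mul_nonneg ht.1 (norm_nonneg u)), e1 _ (mul_nonneg hs.1 (norm_nonneg v))]
        ring

/-- The values of the Hölder seminorm bound the differences of partial derivatives in the interior
of the ball. -/
theorem abs_partialDeriv_sub_le_holderSeminorm {r : ℕ} {γ R : ℝ} {Φ : E → ℝ}
    (hfin : holderSeminorm r γ (Metric.closedBall 0 R) Φ < ∞) (hγ : 0 < γ) (α : Fin d → ℕ)
    (hα : ∑ i, α i = r) {y y' : E} (hy : y ∈ Metric.ball 0 R) (hy' : y' ∈ Metric.ball 0 R) :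
    |partialDeriv α Φ y - partialDeriv α Φ y'| ≤
      (holderSeminorm r γ (Metric.closedBall 0 R) Φ).toReal * ‖y - y'‖ ^ γ := by
  have hw : ∀ y ∈ Metric.ball (0 : E) R,
      partialDerivWithin α (Metric.closedBall 0 R) Φ y = partialDeriv α Φ y := by
    intro y hy
    rw [partialDerivWithin, partialDeriv]
    have hn : Metric.closedBall (0 : E) R ∈ 𝓝 y :=
      mem_of_superset (Metric.isOpen_ball.mem_nhds hy) Metric.ball_subset_closedBall
    rw [← iteratedFDerivWithin_univ, ← Set.univ_inter (Metric.closedBall (0 : E) R),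
      iteratedFDerivWithin_inter hn]
  rcases eq_or_ne y y' with rfl | hne
  · simp [hγ.ne']
  have h1 : ENNReal.ofReal (|partialDeriv α Φ y - partialDeriv α Φ y'| / ‖y - y'‖ ^ γ) ≤
      holderSeminorm r γ (Metric.closedBall 0 R) Φ := by
    rw [← hw y hy, ← hw y' hy', holderSeminorm]
    exact le_iSup₂_of_le α hα (le_iSup₂_of_le y (Metric.ball_subset_closedBall hy)
      (le_iSup₂_of_le y' (Metric.ball_subset_closedBall hy') (le_iSup_of_le hne le_rfl)))
  have h2 := (ENNReal.ofReal_le_iff_le_toReal hfin.ne).1 h1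
  have hpos : 0 < ‖y - y'‖ ^ γ := Real.rpow_pos_of_pos (norm_pos_iff.2 (sub_ne_zero.2 hne)) _
  rwa [div_le_iff₀ hpos] at h2

theorem holderConst_pos {r : ℕ} {γ : ℝ} (hγ : 0 < γ) (hd : 0 < d) : 0 < holderConst d r γ := by
  have hd' : (0 : ℝ) < d := by exact_mod_cast hd
  unfold holderConst
  split_ifs
  · have : 0 < ∏ j ∈ Finset.Icc 1 (r / 2), (γ / 2 + (j : ℝ)) ^ 2 :=
      Finset.prod_pos fun j _ => by positivity
    positivity
  · have : 0 < ∏ j ∈ Finset.Icc 1 (r / 2), ((1 + γ) / 2 + (j : ℝ)) ^ 2 :=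
      Finset.prod_pos fun j _ => by positivity
    positivity

/-- The bound for the double remainder on the closed ball. -/
theorem abs_doubleRemainder_le_holderSeminorm {Φ : E → ℝ} {r : ℕ} {γ R : ℝ} (hγ : 0 < γ)
    (hR : 0 < R) (hΦ : MemHolderClass r γ (Metric.closedBall 0 R) Φ)
    (hglob : ContDiff ℝ ((r / 2 : ℕ) : ℕ∞) Φ) {u v : E}
    (huv : ∀ t ∈ Set.Icc (0 : ℝ) 1, ∀ s ∈ Set.Icc (0 : ℝ) 1, ‖t • u + s • v‖ ≤ R) :
    |doubleRemainder (r / 2) Φ u v| ≤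
      holderConst d r γ * (holderSeminorm r γ (Metric.closedBall 0 R) Φ).toReal *
        (‖u‖ ^ (((r : ℝ) + γ) / 2) * ‖v‖ ^ (((r : ℝ) + γ) / 2)) := by
  have hμ : 0 < ((r : ℝ) + γ) / 2 := by positivity
  -- Ordinary and one-sided derivatives are compared only in the open ball. So the estimate is
  -- applied to θ u and θ v with 0 < θ < 1, and then θ tends to 1.
  have hcont := continuous_doubleRemainder_smul hglob u v
  have hlim : Tendsto (fun θ : ℝ => |doubleRemainder (r / 2) Φ (θ • u) (θ • v)|) (𝓝[<] 1)
      (𝓝 |doubleRemainder (r / 2) Φ u v|) := by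
    have := (hcont.abs.tendsto 1).mono_left (nhdsWithin_le_nhds (s := Set.Iio (1 : ℝ)))
    simpa using this
  have hlim2 : Tendsto (fun θ : ℝ => holderConst d r γ *
      (holderSeminorm r γ (Metric.closedBall 0 R) Φ).toReal *
        (‖θ • u‖ ^ (((r : ℝ) + γ) / 2) * ‖θ • v‖ ^ (((r : ℝ) + γ) / 2))) (𝓝[<] 1)
      (𝓝 (holderConst d r γ * (holderSeminorm r γ (Metric.closedBall 0 R) Φ).toReal *
        (‖u‖ ^ (((r : ℝ) + γ) / 2) * ‖v‖ ^ (((r : ℝ) + γ) / 2)))) := by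
    have hc : Continuous (fun θ : ℝ => holderConst d r γ *
      (holderSeminorm r γ (Metric.closedBall 0 R) Φ).toReal *
        (‖θ • u‖ ^ (((r : ℝ) + γ) / 2) * ‖θ • v‖ ^ (((r : ℝ) + γ) / 2))) := by
      refine continuous_const.mul (Continuous.mul ?_ ?_)
      · exact Continuous.rpow_const (by fun_prop) fun _ => Or.inr hμ.le
      · exact Continuous.rpow_const (by fun_prop) fun _ => Or.inr hμ.le
    have := (hc.tendsto 1).mono_left (nhdsWithin_le_nhds (s := Set.Iio (1 : ℝ)))
    simpa using this
  refine le_of_tendsto_of_tendsto hlim hlim2 ?_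
  have hIoo : Set.Ioo (0 : ℝ) 1 ∈ 𝓝[<] (1 : ℝ) := Ioo_mem_nhdsLT zero_lt_one
  filter_upwards [hIoo] with θ hθ
  refine abs_doubleRemainder_le_holder Metric.isOpen_ball
    ((hΦ.1.mono Metric.ball_subset_closedBall).of_le (by simp)) hγ ENNReal.toReal_nonneg
    (fun α hα y hy y' hy' => abs_partialDeriv_sub_le_holderSeminorm hΦ.2 hγ α hα hy hy') ?_
  intro t ht s hs
  rw [mem_ball_zero_iff, smul_comm t θ, smul_comm s θ, ← smul_add, norm_smul, Real.norm_eq_abs,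
    abs_of_pos hθ.1]
  nlinarith [huv t ht s hs, hθ.1, hθ.2]

end HolderBound

/-! ### Smoothness of feature maps -/

section FeatureMap

variable {E H : Type*} [NormedAddCommGroup E] [NormedSpace ℝ E] [NormedAddCommGroup H]
  [InnerProductSpace ℝ H]

local notation "⟪" x ", " y "⟫" => inner ℝ x y

/-- The increments of `F` have almost bilinear inner products if `⟨F x, F y⟩` is `C²`. -/
theorem exists_bilin_inner_increments {F : E → H} {x : E}
    (hκ : ContDiffAt ℝ 2 (fun p : E × E => ⟪F p.1, F p.2⟫) (x, x)) :
    ∃ b : E →L[ℝ] E →L[ℝ] ℝ, ∀ ε > 0, ∃ δ > 0, ∀ u v : E, ‖u‖ < δ → ‖v‖ < δ →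
      |⟪F (x + u) - F x, F (x + v) - F x⟫ - b u v| ≤ ε * ‖u‖ * ‖v‖ := by
  set κ : E × E → ℝ := fun p => ⟪F p.1, F p.2⟫ with hκdef
  -- D is the partial derivative of the kernel in its first argument. It is C¹, hence strictly
  -- differentiable, and the mixed second derivative extracted from it is the form b.
  obtain ⟨D, hDdef⟩ : ∃ D : E × E → E →L[ℝ] ℝ,
      D = fun p => (fderiv ℝ κ p).comp (ContinuousLinearMap.inl ℝ E E) := ⟨_, rfl⟩
  have hD : ContDiffAt ℝ 1 D (x, x) := by
    rw [hDdef]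
    exact (hκ.fderiv_right (m := 1) (by norm_num)).clm_comp contDiffAt_const
  have hstrict := hD.hasStrictFDerivAt one_ne_zero
  obtain ⟨D', hD'def⟩ : ∃ D', D' = fderiv ℝ D (x, x) := ⟨_, rfl⟩
  rw [← hD'def] at hstrict
  refine ⟨((D'.comp (ContinuousLinearMap.inr ℝ E E))).flip, fun ε hε => ?_⟩
  have hdiff : ∀ᶠ p in 𝓝 (x, x), DifferentiableAt ℝ κ p :=
    (hκ.eventually (by simp)).mono fun p hp => hp.differentiableAt (by simp)
  have hlo : ∀ᶠ pq : (E × E) × (E × E) in 𝓝 ((x, x), (x, x)),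
      ‖D pq.1 - D pq.2 - D' (pq.1 - pq.2)‖ ≤ ε * ‖pq.1 - pq.2‖ := hstrict.isLittleO.def hε
  obtain ⟨V, hV, hVlo⟩ := (Filter.HasBasis.eventually_iff
    (nhds_prod_eq (x := (x, x)) (y := (x, x)) ▸ (𝓝 (x, x)).basis_sets.prod_self)).1 hlo
  obtain ⟨δ, hδ, hball⟩ := Metric.mem_nhds_iff.1 (Filter.inter_mem hV hdiff)
  have hmem : ∀ u v : E, ‖u‖ < δ → ‖v‖ < δ → (x + u, x + v) ∈ Metric.ball (x, x) δ := by
    intro u v hu hv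
    rw [← ball_prod_same]
    simp [hu, hv]
  refine ⟨δ, hδ, fun u v hu hv => ?_⟩
  -- Strict differentiability bounds the derivative of this function by ε ‖v‖, so the mean value
  -- inequality on [0, u] yields the bound with both factors ‖u‖ and ‖v‖.
  set g : E → ℝ := fun w => κ (x + w, x + v) - κ (x + w, x) - D' (0, v) w with hg
  have h0 : ‖(0 : E)‖ < δ := by simpa using hδ
  have hgd : ∀ w ∈ Metric.ball (0 : E) δ, HasFDerivWithinAt g
      (D (x + w, x + v) - D (x + w, x) - D' (0, v)) (Metric.ball 0 δ) w := by
    intro w hw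
    have hw' : ‖w‖ < δ := by simpa using hw
    have hk : ∀ v : E, ‖v‖ < δ → HasFDerivAt (fun w => κ (x + w, x + v)) (D (x + w, x + v)) w := by
      intro v hv
      have h1 : DifferentiableAt ℝ κ (x + w, x + v) := (hball (hmem w v hw' hv)).2
      have h2 : HasFDerivAt (fun w : E => (x + w, x + v)) (ContinuousLinearMap.inl ℝ E E) w :=
        ((hasFDerivAt_id w).const_add x).prodMk (hasFDerivAt_const _ _)
      rw [hDdef]
      exact h1.hasFDerivAt.comp w h2
    have hk0 := hk 0 h0
    rw [add_zero] at hk0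
    exact (((hk v hv).sub hk0).sub (D' (0, v)).hasFDerivAt).hasFDerivWithinAt
  have hbound : ∀ w ∈ Metric.ball (0 : E) δ,
      ‖D (x + w, x + v) - D (x + w, x) - D' (0, v)‖ ≤ ε * ‖v‖ := by
    intro w hw
    have hw' : ‖w‖ < δ := by simpa using hw
    have h1 := (hball (hmem w v hw' hv)).1
    have h2 := (hball (hmem w 0 hw' h0)).1
    rw [add_zero] at h2
    have := hVlo (Set.mk_mem_prod h1 h2)
    simpa using this
  have hmvt := (convex_ball (0 : E) δ).norm_image_sub_le_of_norm_hasFDerivWithin_le hgd hbound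
    (by simpa using hδ : (0 : E) ∈ Metric.ball 0 δ) (by simpa using hu : u ∈ Metric.ball 0 δ)
  rw [Real.norm_eq_abs, sub_zero] at hmvt
  have hEq : g u - g 0 = ⟪F (x + u) - F x, F (x + v) - F x⟫ - D' (0, v) u := by
    simp only [hg, hκdef, inner_sub_left, inner_sub_right, add_zero, map_zero]
    ring
  rw [hEq] at hmvt
  calc _ ≤ ε * ‖v‖ * ‖u‖ := by simpa using hmvt
    _ = _ := by ring

variable [CompleteSpace H]

/-- The inner products of the difference quotients `q k u` converge to b, so the quotients are
Cauchy and have a limit L u with ⟨L u, L v⟩ = b(u, v). This Gram identity forces L to be linear and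
bounded. Expanding ‖F(x + v) - F x - L v‖² then leaves only errors of size o(‖v‖²). -/
theorem differentiableAt_of_contDiffAt_inner {F : E → H} {x : E}
    (hκ : ContDiffAt ℝ 2 (fun p : E × E => ⟪F p.1, F p.2⟫) (x, x)) :
    DifferentiableAt ℝ F x := by
  obtain ⟨b, hb⟩ := exists_bilin_inner_increments hκ
  set Δ : E → H := fun u => F (x + u) - F x with hΔ
  set q : ℕ → E → H := fun k u => ((k : ℝ) + 1) • Δ (((k : ℝ) + 1)⁻¹ • u) with hq
  have hsmall : ∀ (u : E) (δ : ℝ), 0 < δ → ∀ᶠ k : ℕ in atTop, ‖((k : ℝ) + 1)⁻¹ • u‖ < δ := by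
    intro u δ hδ
    have h1 : Tendsto (fun k : ℕ => ((k : ℝ) + 1)⁻¹ • u) atTop (𝓝 ((0 : ℝ) • u)) :=
      (by simpa [one_div] using tendsto_one_div_add_atTop_nhds_zero_nat (𝕜 := ℝ) :
        Tendsto (fun k : ℕ => ((k : ℝ) + 1)⁻¹) atTop (𝓝 0)).smul_const u
    rw [zero_smul] at h1
    have := h1.norm.eventually (gt_mem_nhds (by simpa using hδ))
    simpa using this
  have hqΔ : ∀ ε > 0, ∃ δ > 0, ∀ u v : E, ‖v‖ < δ → ∀ᶠ k in atTop,
      |⟪q k u, Δ v⟫ - b u v| ≤ ε * ‖u‖ * ‖v‖ := by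
    intro ε hε
    obtain ⟨δ, hδ, h⟩ := hb ε hε
    refine ⟨δ, hδ, fun u v hv => ?_⟩
    filter_upwards [hsmall u δ hδ] with k hk
    have hk1 : (0 : ℝ) < (k : ℝ) + 1 := by positivity
    have h1 := h _ v hk hv
    have h2 : ⟪q k u, Δ v⟫ - b u v = ((k : ℝ) + 1) *
        (⟪Δ (((k : ℝ) + 1)⁻¹ • u), Δ v⟫ - b (((k : ℝ) + 1)⁻¹ • u) v) := by
      simp only [hq, inner_smul_left, map_smul, smul_apply, smul_eq_mul,
        RCLike.conj_to_real]
      field_simp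
    rw [h2, abs_mul, abs_of_pos hk1]
    refine (mul_le_mul_of_nonneg_left h1 hk1.le).trans (le_of_eq ?_)
    rw [norm_smul, Real.norm_eq_abs, abs_of_pos (inv_pos.2 hk1)]
    field_simp
  have hqq : ∀ (u v : E), ∀ ε > 0, ∃ K, ∀ k ≥ K, ∀ l ≥ K, |⟪q k u, q l v⟫ - b u v| ≤ ε := by
    intro u v ε hε
    obtain ⟨η, hη, hη'⟩ : ∃ η > 0, η * ‖u‖ * ‖v‖ ≤ ε := by
      refine ⟨ε / (‖u‖ * ‖v‖ + 1), by positivity, ?_⟩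
      rw [mul_assoc, div_mul_eq_mul_div, div_le_iff₀ (by positivity)]
      nlinarith [mul_nonneg (norm_nonneg u) (norm_nonneg v)]
    obtain ⟨δ, hδ, h⟩ := hb η hη
    obtain ⟨K, hK⟩ := eventually_atTop.1 ((hsmall u δ hδ).and (hsmall v δ hδ))
    refine ⟨K, fun k hk l hl => ?_⟩
    have hk1 : (0 : ℝ) < (k : ℝ) + 1 := by positivity
    have hl1 : (0 : ℝ) < (l : ℝ) + 1 := by positivity
    have h1 := h _ _ (hK k hk).1 (hK l hl).2
    have h2 : ⟪q k u, q l v⟫ - b u v = (((k : ℝ) + 1) * ((l : ℝ) + 1)) *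
        (⟪Δ (((k : ℝ) + 1)⁻¹ • u), Δ (((l : ℝ) + 1)⁻¹ • v)⟫ -
          b (((k : ℝ) + 1)⁻¹ • u) (((l : ℝ) + 1)⁻¹ • v)) := by
      simp only [hq, inner_smul_left, inner_smul_right, map_smul, smul_apply,
        smul_eq_mul, RCLike.conj_to_real]
      field_simp
    rw [h2, abs_mul, abs_of_pos (mul_pos hk1 hl1)]
    refine ((mul_le_mul_of_nonneg_left h1 (mul_pos hk1 hl1).le).trans (le_of_eq ?_)).trans hη'
    rw [norm_smul, norm_smul, Real.norm_eq_abs, Real.norm_eq_abs, abs_of_pos (inv_pos.2 hk1),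
      abs_of_pos (inv_pos.2 hl1)]
    field_simp
  have hcauchy : ∀ u, ∃ y, Tendsto (fun k => q k u) atTop (𝓝 y) := by
    intro u
    refine cauchySeq_tendsto_of_complete (Metric.cauchySeq_iff.2 fun ε hε => ?_)
    obtain ⟨K, hK⟩ := hqq u u (ε ^ 2 / 8) (by positivity)
    refine ⟨K, fun k hk l hl => ?_⟩
    rw [dist_eq_norm]
    refine lt_of_pow_lt_pow_left₀ 2 hε.le ?_
    have e : ‖q k u - q l u‖ ^ 2 = (⟪q k u, q k u⟫ - b u u) - 2 * (⟪q k u, q l u⟫ - b u u) +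
        (⟪q l u, q l u⟫ - b u u) := by
      rw [norm_sub_sq_real, real_inner_self_eq_norm_sq, real_inner_self_eq_norm_sq]
      ring
    rw [e]
    have h1 := abs_le.1 (hK k hk k hk)
    have h2 := abs_le.1 (hK k hk l hl)
    have h3 := abs_le.1 (hK l hl l hl)
    nlinarith
  choose L hL using hcauchy
  have hLL : ∀ u v, ⟪L u, L v⟫ = b u v := by
    intro u v
    have h1 : Tendsto (fun k => ⟪q k u, q k v⟫) atTop (𝓝 ⟪L u, L v⟫) := (hL u).inner (hL v)
    refine tendsto_nhds_unique h1 (Metric.tendsto_atTop.2 fun ε hε => ?_)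
    obtain ⟨K, hK⟩ := hqq u v (ε / 2) (by positivity)
    exact ⟨K, fun k hk => lt_of_le_of_lt (hK k hk k hk) (by linarith)⟩
  have hLΔ : ∀ ε > 0, ∃ δ > 0, ∀ u v : E, ‖v‖ < δ → |⟪L u, Δ v⟫ - b u v| ≤ ε * ‖u‖ * ‖v‖ := by
    intro ε hε
    obtain ⟨δ, hδ, h⟩ := hqΔ ε hε
    refine ⟨δ, hδ, fun u v hv => ?_⟩
    have h1 : Tendsto (fun k => |⟪q k u, Δ v⟫ - b u v|) atTop (𝓝 |⟪L u, Δ v⟫ - b u v|) :=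
      (((hL u).inner tendsto_const_nhds).sub_const _).abs
    exact le_of_tendsto h1 (h u v hv)
  have hzero : ∀ y : H, ⟪y, y⟫ = 0 → y = 0 := fun y => inner_self_eq_zero.1
  -- The squared norm of each linearity defect is an expression in b alone, which vanishes by
  -- bilinearity.
  let T : E →ₗ[ℝ] H :=
    { toFun := L
      map_add' := fun u v => by
        rw [← sub_eq_zero]
        refine hzero _ ?_
        simp only [inner_sub_left, inner_sub_right, inner_add_left, inner_add_right, hLL, map_add,
          add_apply]
        ring
      map_smul' := fun c u => by
        rw [← sub_eq_zero]
        refine hzero _ ?_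
        simp only [inner_sub_left, inner_sub_right, RingHom.id_apply, inner_smul_left,
          inner_smul_right, hLL, map_smul, smul_apply, smul_eq_mul,
          RCLike.conj_to_real]
        ring }
  have hTb : ∀ u, ‖T u‖ ≤ √‖b‖ * ‖u‖ := by
    intro u
    have h1 : ‖T u‖ ^ 2 ≤ ‖b‖ * ‖u‖ ^ 2 := by
      have h2 : ‖T u‖ ^ 2 = b u u := by
        rw [← real_inner_self_eq_norm_sq]; exact hLL u u
      rw [h2]
      calc b u u ≤ ‖b u u‖ := le_abs_self _
        _ ≤ ‖b‖ * ‖u‖ * ‖u‖ := b.le_opNorm₂ u u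
        _ = _ := by ring
    have h3 := Real.le_sqrt_of_sq_le h1
    rwa [Real.sqrt_mul (norm_nonneg b), Real.sqrt_sq (norm_nonneg u)] at h3
  refine ⟨T.mkContinuous _ hTb, ?_⟩
  rw [hasFDerivAt_iff_isLittleO_nhds_zero]
  refine Asymptotics.isLittleO_iff.2 fun ε hε => ?_
  -- The two errors enter with coefficients 1 and 2, so ε²/4 for each gives at most (3/4) ε² ‖v‖².
  obtain ⟨δ₁, hδ₁, h₁⟩ := hb (ε ^ 2 / 4) (by positivity)
  obtain ⟨δ₂, hδ₂, h₂⟩ := hLΔ (ε ^ 2 / 4) (by positivity)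
  filter_upwards [Metric.ball_mem_nhds (0 : E) (lt_min hδ₁ hδ₂)] with v hv
  have hv' : ‖v‖ < min δ₁ δ₂ := by simpa using hv
  have hv1 := lt_of_lt_of_le hv' (min_le_left _ _)
  have hv2 := lt_of_lt_of_le hv' (min_le_right _ _)
  change ‖F (x + v) - F x - L v‖ ≤ ε * ‖v‖
  refine abs_le_of_sq_le_sq' ?_ (by positivity) |>.2
  have e : ‖F (x + v) - F x - L v‖ ^ 2 = (⟪Δ v, Δ v⟫ - b v v) - 2 * (⟪L v, Δ v⟫ - b v v) := by
    rw [norm_sub_sq_real, real_inner_self_eq_norm_sq, ← hLL v v, real_inner_self_eq_norm_sq,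
      real_inner_comm]
    ring
  rw [e]
  have h3 := abs_le.1 (h₁ v v hv1 hv1)
  have h4 := abs_le.1 (h₂ v v hv2)
  nlinarith [mul_nonneg (sq_nonneg ε) (sq_nonneg ‖v‖)]

/-- If `⟨F x, F y⟩` is `C^{2n}` on `U × U`, then `F` is `C^n` on `U`. -/
theorem contDiffOn_of_contDiffOn_inner [FiniteDimensional ℝ E] {U : Set E} (hU : IsOpen U) (n : ℕ)
    {F : E → H}
    (hκ : ContDiffOn ℝ ((2 * n : ℕ) : ℕ∞) (fun p : E × E => ⟪F p.1, F p.2⟫) (U ×ˢ U)) :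
    ContDiffOn ℝ (n : ℕ∞) F U := by
  have hUU : IsOpen (U ×ˢ U) := hU.prod hU
  induction n generalizing F with
  | zero =>
    simp only [Nat.mul_zero, CharP.cast_eq_zero, WithTop.coe_zero, contDiffOn_zero] at hκ ⊢
    intro x hx
    refine ContinuousAt.continuousWithinAt ?_
    have hxx : ContinuousAt (fun p : E × E => ⟪F p.1, F p.2⟫) (x, x) :=
      hκ.continuousAt (hUU.mem_nhds ⟨hx, hx⟩)
    -- This expression is ‖F y - F x‖², so continuity of the kernel at the diagonal gives continuity
    -- of F.
    have h1 : Tendsto (fun y => ⟪F y, F y⟫ - 2 * ⟪F y, F x⟫ + ⟪F x, F x⟫) (𝓝 x)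
        (𝓝 (⟪F x, F x⟫ - 2 * ⟪F x, F x⟫ + ⟪F x, F x⟫)) := by
      have ha : Tendsto (fun y => ⟪F y, F y⟫) (𝓝 x) (𝓝 ⟪F x, F x⟫) :=
        ContinuousAt.comp (f := fun y : E => (y, y)) hxx (by fun_prop)
      have hb : Tendsto (fun y => ⟪F y, F x⟫) (𝓝 x) (𝓝 ⟪F x, F x⟫) :=
        ContinuousAt.comp (f := fun y : E => (y, x)) hxx (by fun_prop)
      exact (ha.sub (hb.const_mul 2)).add_const _
    have h2 : Tendsto (fun y => ‖F y - F x‖ ^ 2) (𝓝 x) (𝓝 0) := by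
      convert h1 using 2
      · rw [norm_sub_sq_real, real_inner_self_eq_norm_sq, real_inner_self_eq_norm_sq]
      · ring
    rw [ContinuousAt, tendsto_iff_norm_sub_tendsto_zero]
    have h3 := h2.sqrt
    simpa using h3
  | succ n ih =>
    have hdiff : ∀ x ∈ U, DifferentiableAt ℝ F x := fun x hx =>
      differentiableAt_of_contDiffAt_inner ((hκ.of_le (by
        
        refine le_trans (b := (((2 : ℕ) : ℕ∞) : WithTop ℕ∞)) (by simp) ?_
        exact_mod_cast (by omega : 2 ≤ 2 * (n + 1)))).contDiffAt (hUU.mem_nhds ⟨hx, hx⟩))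
    have hgoal : ContDiffOn ℝ ((n : WithTop ℕ∞) + 1) F U := by
      rw [contDiffOn_succ_iff_fderiv_of_isOpen hU]
      refine ⟨fun x hx => (hdiff x hx).differentiableWithinAt, by simp, ?_⟩
      rw [contDiffOn_clm_apply]
      intro v
      -- The directional derivative of F along v is again a feature map, with kernel the derivative
      -- of κ along v in each argument; this costs two derivatives of κ for one of F.
      refine ih ?_
      set κ : E × E → ℝ := fun p => ⟪F p.1, F p.2⟫ with hκdef
      have hκ1 : ∀ p ∈ U ×ˢ U, fderiv ℝ κ p (v, 0) = ⟪fderiv ℝ F p.1 v, F p.2⟫ := by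
        intro p hp
        have h1 : HasFDerivAt (fun p : E × E => F p.1) ((fderiv ℝ F p.1).comp
            (ContinuousLinearMap.fst ℝ E E)) p :=
          (hdiff _ hp.1).hasFDerivAt.comp p hasFDerivAt_fst
        have h2 : HasFDerivAt (fun p : E × E => F p.2) ((fderiv ℝ F p.2).comp
            (ContinuousLinearMap.snd ℝ E E)) p :=
          (hdiff _ hp.2).hasFDerivAt.comp p hasFDerivAt_snd
        rw [(h1.inner ℝ h2).fderiv]
        simp
      set G : E × E → ℝ := fun p => fderiv ℝ κ p (v, 0) with hG
      have hGc : ContDiffOn ℝ ((2 * n + 1 : ℕ) : ℕ∞) G (U ×ˢ U) :=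
        (hκ.fderiv_of_isOpen (m := ((2 * n + 1 : ℕ) : ℕ∞)) hUU (by norm_cast)).clm_apply
          contDiffOn_const
      have hGc' : ContDiffOn ℝ ((2 * n : ℕ) : ℕ∞) (fun p => fderiv ℝ G p (0, v)) (U ×ˢ U) :=
        (hGc.fderiv_of_isOpen (m := ((2 * n : ℕ) : ℕ∞)) hUU (by norm_cast)).clm_apply
          contDiffOn_const
      refine hGc'.congr fun p hp => ?_
      have hGd : DifferentiableAt ℝ G p :=
        (hGc.contDiffAt (hUU.mem_nhds hp)).differentiableAt (by simp)
      have h3 : HasFDerivAt (fun y : E => G (p.1, y))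
          ((fderiv ℝ G p).comp (ContinuousLinearMap.inr ℝ E E)) p.2 :=
        HasFDerivAt.comp p.2 (f := fun y : E => (p.1, y)) (g := G) hGd.hasFDerivAt
          (hasFDerivAt_prodMk_right p.1 p.2)
      have h4 : HasFDerivAt (fun y : E => ⟪fderiv ℝ F p.1 v, F y⟫)
          ((innerSL ℝ (fderiv ℝ F p.1 v)).comp (fderiv ℝ F p.2)) p.2 :=
        (innerSL ℝ (fderiv ℝ F p.1 v)).hasFDerivAt.comp p.2 (hdiff _ hp.2).hasFDerivAt
      have h5 : (fun y : E => G (p.1, y)) =ᶠ[𝓝 p.2] fun y => ⟪fderiv ℝ F p.1 v, F y⟫ := by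
        filter_upwards [hU.mem_nhds hp.2] with y hy
        exact hκ1 (p.1, y) ⟨hp.1, hy⟩
      have h6 := (h4.congr_of_eventuallyEq h5).unique h3
      have h7 := congrArg (fun T : E →L[ℝ] ℝ => T v) h6
      simpa using h7
    exact_mod_cast hgoal

end FeatureMap

/-! ### Feature maps of conditionally positive definite kernels -/

theorem exists_hilbert_space_of_posDef {V : Type} [AddCommGroup V] [Module ℝ V]
    (B : V →ₗ[ℝ] V →ₗ[ℝ] ℝ) (hsymm : ∀ v w, B v w = B w v) (hpos : ∀ v, v ≠ 0 → 0 < B v v) :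
    ∃ (H : Type) (_ : NormedAddCommGroup H) (_ : InnerProductSpace ℝ H) (_ : CompleteSpace H)
      (J : V →ₗ[ℝ] H), ∀ v w, inner ℝ (J v) (J w) = B v w := by
  let core : InnerProductSpace.Core ℝ V :=
    { inner := fun v w => B v w
      conj_inner_symm := fun v w => hsymm w v
      re_inner_nonneg := fun v => by
        rcases eq_or_ne v 0 with rfl | h
        · simp
        · exact (hpos v h).le
      add_left := fun u v w => by simp
      smul_left := fun v w c => by simp
      definite := fun v h => by
        by_contra hv
        exact (hpos v hv).ne' h }
  let _ : NormedAddCommGroup V := core.toNormedAddCommGroup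
  let _ : InnerProductSpace ℝ V := InnerProductSpace.ofCore core.toCore
  refine ⟨UniformSpace.Completion V, inferInstance, inferInstance, inferInstance,
    (UniformSpace.Completion.toComplₗᵢ (𝕜 := ℝ) (E := V)).toLinearMap, fun v w => ?_⟩
  exact UniformSpace.Completion.inner_coe v w

section Kernel

variable {d : ℕ}

local notation "E" => EuclideanSpace ℝ (Fin d)

/-- The bilinear form `∑ c(x) c'(y) K(x,y)`. -/
noncomputable def kernelForm (K : E → E → ℝ) : (E →₀ ℝ) →ₗ[ℝ] (E →₀ ℝ) →ₗ[ℝ] ℝ :=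
  Finsupp.linearCombination ℝ fun x => Finsupp.linearCombination ℝ fun y => K x y

theorem kernelForm_self (K : E → E → ℝ) (c : E →₀ ℝ) : kernelForm K c c = kernelEnergy K c := by
  simp only [kernelForm, kernelEnergy, Finsupp.linearCombination_apply, Finsupp.sum,
    LinearMap.sum_apply, LinearMap.smul_apply, Finset.mul_sum, smul_eq_mul, mul_assoc]

theorem kernelForm_single_right (K : E → E → ℝ) (c : E →₀ ℝ) (y : E) :
    kernelForm K c (Finsupp.single y 1) = Finsupp.linearCombination ℝ (fun x => K x y) c := by
  simp [kernelForm, Finsupp.linearCombination_apply, Finsupp.sum, LinearMap.sum_apply]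

theorem kernelForm_single_left (K : E → E → ℝ) (c : E →₀ ℝ) (x : E) :
    kernelForm K (Finsupp.single x 1) c = Finsupp.linearCombination ℝ (fun y => K x y) c := by
  simp [kernelForm]

theorem kernelForm_symm {K : E → E → ℝ} (hK : ∀ x y, K x y = K y x) (c c' : E →₀ ℝ) :
    kernelForm K c c' = kernelForm K c' c := by
  simp only [kernelForm, Finsupp.linearCombination_apply, Finsupp.sum,
    LinearMap.sum_apply, LinearMap.smul_apply, Finset.mul_sum, smul_eq_mul]
  rw [Finset.sum_comm]
  refine Finset.sum_congr rfl fun y _ => Finset.sum_congr rfl fun x _ => ?_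
  rw [hK]; ring

theorem kernelForm_eq_linearCombination (K : E → E → ℝ) (c c' : E →₀ ℝ) :
    kernelForm K c c' = Finsupp.linearCombination ℝ (kernelComb K c') c := by
  simp only [kernelForm, kernelComb, Finsupp.linearCombination_apply, Finsupp.sum,
    LinearMap.sum_apply, LinearMap.smul_apply, smul_eq_mul]

theorem annihilatesPoly_iff {s : ℕ} {c : E →₀ ℝ} : AnnihilatesPoly s c ↔
    ∀ p ∈ polySpace d s, Finsupp.linearCombination ℝ (polyFun p) c = 0 := Iff.rfl

theorem polyFun_add (p q : MvPolynomial (Fin d) ℝ) : polyFun (p + q) = polyFun p + polyFun q := by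
  funext x; simp [polyFun]

theorem polyFun_smul (a : ℝ) (q : MvPolynomial (Fin d) ℝ) : polyFun (a • q) = a • polyFun q := by
  funext x; simp [polyFun, MvPolynomial.smul_eval]

/-- `polyFun` as a linear map. -/
noncomputable def polyFunₗ (d : ℕ) : MvPolynomial (Fin d) ℝ →ₗ[ℝ] (EuclideanSpace ℝ (Fin d) → ℝ) where
  toFun := polyFun
  map_add' := polyFun_add
  map_smul' := polyFun_smul

theorem polyFunₗ_apply (p : MvPolynomial (Fin d) ℝ) : polyFunₗ d p = polyFun p := rfl

/-- The functionals that vanish on `Π^d_s`. -/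
def annihilator (d s : ℕ) : Submodule ℝ (EuclideanSpace ℝ (Fin d) →₀ ℝ) where
  carrier := {c | AnnihilatesPoly s c}
  add_mem' := fun {a b} ha hb => annihilatesPoly_iff.2 fun p hp => by
    rw [map_add, annihilatesPoly_iff.1 ha p hp, annihilatesPoly_iff.1 hb p hp, add_zero]
  zero_mem' := annihilatesPoly_iff.2 fun p hp => by simp
  smul_mem' := fun a c hc => annihilatesPoly_iff.2 fun p hp => by
    rw [map_smul, annihilatesPoly_iff.1 hc p hp, smul_zero]

theorem mem_annihilator {s : ℕ} {c : E →₀ ℝ} : c ∈ annihilator d s ↔ AnnihilatesPoly s c := Iff.rfl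

/-- The Euclidean ball contains a cube, a product of infinite sets, and a polynomial vanishing on
such a product is zero. -/
theorem eq_zero_of_polyFun_eq_zero_on_ball {q : MvPolynomial (Fin d) ℝ} {z : E} {ε : ℝ}
    (hε : 0 < ε) (h : ∀ x ∈ Metric.ball z ε, polyFun q x = 0) : q = 0 := by
  have hopen : IsOpen ((fun y : Fin d → ℝ => (WithLp.toLp 2 y : E)) ⁻¹' Metric.ball z ε) :=
    Metric.isOpen_ball.preimage (PiLp.continuous_toLp 2 _)
  obtain ⟨δ, hδ, hball⟩ := Metric.isOpen_iff.1 hopen (fun i => z i)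
    (by simpa using hε)
  refine MvPolynomial.funext_set (fun i => Metric.ball (z i) δ) (fun i => ?_) fun y hy => ?_
  · rw [Real.ball_eq_Ioo]
    exact Set.Ioo_infinite (by linarith)
  · rw [map_zero]
    have : y ∈ Metric.ball (fun i => z i) δ := by
      rw [ball_pi _ hδ]; exact hy
    exact h _ (hball this)

/-- Functionals supported near `z` that are dual to a basis of `Π^d_s`. -/
theorem exists_dual_functionals {s M : ℕ} (p : Module.Basis (Fin M) ℝ (polySpace d s)) (z : E)
    {ε : ℝ} (hε : 0 < ε) :
    ∃ c : Fin M → (E →₀ ℝ), (∀ l, ∀ ξ ∈ (c l).support, ξ ∈ Metric.ball z ε) ∧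
      ∀ l m, Finsupp.linearCombination ℝ (polyFun (p m : MvPolynomial (Fin d) ℝ)) (c l) =
        if l = m then 1 else 0 := by
  have hfin : Module.Finite ℝ (polySpace d s) := Module.Finite.of_basis p
  let ev : E → Module.Dual ℝ (polySpace d s) := fun ξ =>
    (LinearMap.proj ξ).comp ((polyFunₗ d).comp (polySpace d s).subtype)
  -- Point evaluations in the ball separate polynomials, so in finite dimension they span the dual;
  -- the coordinate functionals are therefore combinations of them.
  have hspan : Submodule.span ℝ (ev '' Metric.ball z ε) = ⊤ := by
    by_contra hne
    obtain ⟨φ, hφ, hle⟩ := Submodule.exists_le_ker_of_lt_top _ (lt_top_iff_ne_top.2 hne)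
    obtain ⟨q, rfl⟩ := (Module.evalEquiv ℝ (polySpace d s)).surjective φ
    refine hφ ?_
    have hq : (q : MvPolynomial (Fin d) ℝ) = 0 :=
      eq_zero_of_polyFun_eq_zero_on_ball hε fun x hx =>
        hle (Submodule.subset_span (Set.mem_image_of_mem ev hx))
    have : q = 0 := Subtype.ext hq
    rw [this, map_zero]
  have hex : ∀ l, ∃ c ∈ Finsupp.supported ℝ ℝ (Metric.ball z ε),
      Finsupp.linearCombination ℝ ev c = p.coord l := fun l => by
    have := (Finsupp.mem_span_image_iff_linearCombination ℝ (v := ev)).1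
      (hspan ▸ Submodule.mem_top : p.coord l ∈ Submodule.span ℝ (ev '' Metric.ball z ε))
    exact this
  choose c hc hcl using hex
  refine ⟨c, fun l ξ hξ => (Finsupp.mem_supported ℝ (c l)).1 (hc l) hξ, fun l m => ?_⟩
  have h1 := congrArg (fun φ : Module.Dual ℝ (polySpace d s) => φ (p m)) (hcl l)
  simp only [Module.Basis.coord_apply, Module.Basis.repr_self, Finsupp.single_apply] at h1
  simp only [eq_comm (a := l)]
  rw [← h1]
  simp only [Finsupp.linearCombination_apply, Finsupp.sum, LinearMap.sum_apply,
    LinearMap.smul_apply]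
  rfl

/-- The native space of a conditionally positive definite kernel in terms of a feature map. -/
theorem IsCondPosDef.exists_feature_map {s M : ℕ} {K : E → E → ℝ} (hK : IsCondPosDef s K)
    (p : Module.Basis (Fin M) ℝ (polySpace d s)) (z : E) {ε : ℝ} (hε : 0 < ε) :
    ∃ (H : Type) (_ : NormedAddCommGroup H) (_ : InnerProductSpace ℝ H) (_ : CompleteSpace H)
      (F : E → H) (c : Fin M → (E →₀ ℝ)) (b : Fin M → Fin M → ℝ),
      (∀ l, ∀ ξ ∈ (c l).support, ξ ∈ Metric.ball z ε) ∧
      (∀ x y, inner ℝ (F x) (F y) = K x y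
        - ∑ l, polyFun (p l : MvPolynomial (Fin d) ℝ) x * kernelComb K (c l) y
        - ∑ l, polyFun (p l : MvPolynomial (Fin d) ℝ) y * kernelComb K (c l) x
        + ∑ l, ∑ m, polyFun (p l : MvPolynomial (Fin d) ℝ) x *
            polyFun (p m : MvPolynomial (Fin d) ℝ) y * b l m) ∧
      (∀ f t, HasNativeSeminorm K s f t → ∃ g : H, ‖g‖ = t ∧ ∃ e : Fin M → ℝ,
        ∀ x, f x = inner ℝ (F x) g + ∑ l, e l * polyFun (p l : MvPolynomial (Fin d) ℝ) x) ∧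
      (∀ (N : ℕ) (x : Fin N → E), Function.Injective x → ∀ u : Fin N → ℝ,
        (∀ l, ∑ j, u j * polyFun (p l : MvPolynomial (Fin d) ℝ) (x j) = 0) →
        ∑ j, u j • F (x j) = 0 → u = 0) := by
  obtain ⟨c, hsupp, hdual⟩ := exists_dual_functionals p z hε
  set P : Fin M → E → ℝ := fun l => polyFun (p l : MvPolynomial (Fin d) ℝ) with hP
  have hrep : ∀ q ∈ polySpace d s, ∃ a : Fin M → ℝ, polyFun q = ∑ m, a m • P m := by
    intro q hq
    refine ⟨fun m => p.repr ⟨q, hq⟩ m, ?_⟩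
    have h1 := congrArg (fun q : polySpace d s => polyFunₗ d (q : MvPolynomial (Fin d) ℝ))
      (p.sum_repr ⟨q, hq⟩)
    simp only [Submodule.coe_sum, Submodule.coe_smul, map_sum, map_smul] at h1
    exact h1.symm
  have hlc : ∀ (a : Fin M → ℝ) (c' : E →₀ ℝ), Finsupp.linearCombination ℝ (∑ m, a m • P m) c' =
      ∑ m, a m * Finsupp.linearCombination ℝ (P m) c' := by
    intro a c'
    simp only [Finsupp.linearCombination_apply, Finsupp.sum, Finset.sum_apply, Pi.smul_apply,
      smul_eq_mul, Finset.mul_sum]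
    rw [Finset.sum_comm]
    exact Finset.sum_congr rfl fun m _ => Finset.sum_congr rfl fun x _ => by ring
  have hann : ∀ c' : E →₀ ℝ, (∀ l, Finsupp.linearCombination ℝ (P l) c' = 0) →
      c' ∈ annihilator d s := by
    intro c' h
    refine annihilatesPoly_iff.2 fun q hq => ?_
    obtain ⟨a, ha⟩ := hrep q hq
    rw [ha, hlc]
    simp [h]
  -- Point evaluation minus its generalised interpolation by polynomials: the subtraction makes it
  -- annihilate Π^d_s, where the kernel defines an inner product.
  let Λ : E → (E →₀ ℝ) := fun x => Finsupp.single x 1 - ∑ l, P l x • c l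
  have hΛ : ∀ x, Λ x ∈ annihilator d s := fun x => by
    refine hann _ fun m => ?_
    simp only [Λ, map_sub, map_sum, map_smul, Finsupp.linearCombination_single, smul_eq_mul]
    have : ∀ l, Finsupp.linearCombination ℝ (P m) (c l) = if l = m then 1 else 0 :=
      fun l => hdual l m
    simp [this]
  let B : annihilator d s →ₗ[ℝ] annihilator d s →ₗ[ℝ] ℝ :=
    (kernelForm K).compl₁₂ (annihilator d s).subtype (annihilator d s).subtype
  have hB : ∀ v w : annihilator d s, B v w = kernelForm K v w := fun _ _ => rfl
  obtain ⟨H, i1, i2, i3, J, hJ⟩ := exists_hilbert_space_of_posDef (V := annihilator d s) B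
    (fun v w => by rw [hB, hB, kernelForm_symm hK.symm])
    (fun v hv => by
      rw [hB, kernelForm_self]
      exact hK.pos v (by simpa using hv) v.2)
  have hJn : ∀ v : annihilator d s, ‖J v‖ = √(kernelEnergy K v) := fun v => by
    rw [← kernelForm_self, ← hB, ← hJ, real_inner_self_eq_norm_sq, Real.sqrt_sq (norm_nonneg _)]
  have hcomb : ∀ (l : Fin M) (y : E), Finsupp.linearCombination ℝ (fun ξ => K ξ y) (c l) =
      kernelComb K (c l) y := by
    intro l y
    simp only [Finsupp.linearCombination_apply, kernelComb, smul_eq_mul, hK.symm y]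
  refine ⟨H, i1, i2, i3, fun x => J ⟨Λ x, hΛ x⟩, c, fun l m => kernelForm K (c l) (c m), hsupp,
    ?_, ?_, ?_⟩
  · intro x y
    rw [hJ, hB]
    simp only [Λ, map_sub, map_sum, map_smul, LinearMap.sub_apply, LinearMap.sum_apply,
      LinearMap.smul_apply, smul_eq_mul, kernelForm_single_right, kernelForm_single_left,
      Finsupp.linearCombination_single, one_mul, hcomb]
    have h1 : ∀ l, Finsupp.linearCombination ℝ (fun y => K x y) (c l) = kernelComb K (c l) x :=
      fun l => rfl
    simp only [h1]
    rw [show (∑ l, ∑ m, P l x * P m y * kernelForm K (c l) (c m)) =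
      ∑ m, ∑ l, P m y * (P l x * kernelForm K (c l) (c m)) by
        rw [Finset.sum_comm]
        exact Finset.sum_congr rfl fun m _ => Finset.sum_congr rfl fun x _ => by ring]
    simp only [mul_sub, Finset.sum_sub_distrib, Finset.mul_sum]
    ring
  · rintro f t ⟨cn, pn, hcn, hpn, hcauchy, hlim, hnorm⟩
    let v : ℕ → annihilator d s := fun n => ⟨cn n, hcn n⟩
    have hv : CauchySeq fun n => J (v n) := by
      refine Metric.cauchySeq_iff.2 fun ε hε => ?_
      obtain ⟨n₀, h⟩ := hcauchy ε hε
      refine ⟨n₀, fun m hm n hn => ?_⟩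
      rw [dist_eq_norm, ← map_sub, hJn]
      exact h m hm n hn
    obtain ⟨g, hg⟩ := cauchySeq_tendsto_of_complete hv
    -- The polynomial part of f is read off by the dual functionals. No convergence of the
    -- polynomials `pn n` is needed, because pairing with Λ x removes them.
    refine ⟨g, ?_, fun l => Finsupp.linearCombination ℝ f (c l), fun x => ?_⟩
    · refine tendsto_nhds_unique hg.norm ?_
      simpa only [hJn] using hnorm
    · have hlimc : ∀ c' : E →₀ ℝ, Tendsto (fun n => Finsupp.linearCombination ℝ
          (fun x => kernelComb K (cn n) x + polyFun (pn n) x) c') atTop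
          (𝓝 (Finsupp.linearCombination ℝ f c')) := by
        intro c'
        simp only [Finsupp.linearCombination_apply, Finsupp.sum]
        exact tendsto_finsetSum _ fun y _ => (hlim y).const_smul _
      have h1 : Tendsto (fun n => inner ℝ (J ⟨Λ x, hΛ x⟩) (J (v n))) atTop
          (𝓝 (inner ℝ (J ⟨Λ x, hΛ x⟩) g)) := tendsto_const_nhds.inner hg
      have h2 : ∀ n, inner ℝ (J ⟨Λ x, hΛ x⟩) (J (v n)) = Finsupp.linearCombination ℝ
          (fun x => kernelComb K (cn n) x + polyFun (pn n) x) (Λ x) := by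
        intro n
        rw [hJ, hB, kernelForm_eq_linearCombination]
        have h3 : Finsupp.linearCombination ℝ (polyFun (pn n)) (Λ x) = 0 :=
          annihilatesPoly_iff.1 (hΛ x) _ (hpn n)
        have h4 : Finsupp.linearCombination ℝ
            (fun x => kernelComb K (cn n) x + polyFun (pn n) x) (Λ x) =
            Finsupp.linearCombination ℝ (kernelComb K (cn n)) (Λ x) +
              Finsupp.linearCombination ℝ (polyFun (pn n)) (Λ x) := by
          simp only [Finsupp.linearCombination_apply, Finsupp.sum, smul_eq_mul, mul_add,
            Finset.sum_add_distrib]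
        rw [h4, h3, add_zero]
      simp only [h2] at h1
      have h5 := tendsto_nhds_unique h1 (hlimc (Λ x))
      rw [h5]
      simp only [Λ, map_sub, map_sum, map_smul, Finsupp.linearCombination_single, smul_eq_mul,
        one_mul]
      simp only [hP, mul_comm (polyFun _ x), sub_add_cancel]
  · intro N x hx u hu h0
    -- The polynomial corrections cancel because u annihilates the basis, so strict positivity
    -- applies to the plain combination of distinct point evaluations.
    have h1 : ∑ j, u j • Λ (x j) = ∑ j, Finsupp.single (x j) (u j) := by
      simp only [Λ, smul_sub, Finset.sum_sub_distrib, Finset.smul_sum, Finsupp.smul_single,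
        smul_eq_mul, mul_one]
      rw [sub_eq_self, Finset.sum_comm]
      refine Finset.sum_eq_zero fun l _ => ?_
      simp only [smul_smul]
      rw [← Finset.sum_smul]
      have := hu l
      rw [show ∑ j, u j * P l (x j) = 0 from this, zero_smul]
    have h2 : J (∑ j, u j • (⟨Λ (x j), hΛ (x j)⟩ : annihilator d s)) = 0 := by
      simpa only [map_sum, map_smul] using h0
    have h3 : kernelForm K (∑ j, u j • Λ (x j)) (∑ j, u j • Λ (x j)) = 0 := by
      have h4 := hJ (∑ j, u j • (⟨Λ (x j), hΛ (x j)⟩ : annihilator d s))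
        (∑ j, u j • (⟨Λ (x j), hΛ (x j)⟩ : annihilator d s))
      rw [h2, inner_zero_left, hB] at h4
      simpa using h4.symm
    have h4 : ∑ j, u j • Λ (x j) = 0 := by
      by_contra hne
      have h5 := hK.pos _ hne (mem_annihilator.1
        (Submodule.sum_mem _ fun j _ => Submodule.smul_mem _ _ (hΛ (x j))))
      rw [← kernelForm_self, h3] at h5
      exact lt_irrefl _ h5
    rw [h1] at h4
    funext i
    have h6 := congrArg (fun c : E →₀ ℝ => c (x i)) h4
    simpa [Finsupp.finsetSum_apply, Finsupp.single_apply, hx.eq_iff] using h6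

end Kernel

section Functional

variable {d : ℕ}

local notation "E" => EuclideanSpace ℝ (Fin d)

/-! ### The differential operator as a linear functional -/

theorem sum_le_of_mem_multiIndicesLE {k : ℕ} {α : Fin d → ℕ} (h : α ∈ multiIndicesLE d k) :
    ∑ i, α i ≤ k := (Finset.mem_filter.1 h).2

theorem diffOp_add {k : ℕ} {a : (Fin d → ℕ) → E → ℝ} {f g : E → ℝ} {z : E}
    (hf : ContDiffAt ℝ k f z) (hg : ContDiffAt ℝ k g z) :
    diffOp k a (fun x => f x + g x) z = diffOp k a f z + diffOp k a g z := by
  rw [diffOp, diffOp, diffOp, ← Finset.sum_add_distrib]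
  refine Finset.sum_congr rfl fun α hα => ?_
  have hα' : ((∑ i, α i : ℕ) : WithTop ℕ∞) ≤ k := by
    exact_mod_cast sum_le_of_mem_multiIndicesLE hα
  rw [partialDeriv, fun_iteratedFDeriv_add_apply (hf.of_le hα') (hg.of_le hα')]
  simp only [add_apply, partialDeriv]
  ring

theorem diffOp_const_mul {k : ℕ} {a : (Fin d → ℕ) → E → ℝ} {f : E → ℝ} {z : E}
    (hf : ContDiffAt ℝ k f z) (c : ℝ) :
    diffOp k a (fun x => c * f x) z = c * diffOp k a f z := by
  rw [diffOp, diffOp, Finset.mul_sum]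
  refine Finset.sum_congr rfl fun α hα => ?_
  have hα' : ((∑ i, α i : ℕ) : WithTop ℕ∞) ≤ k := by
    exact_mod_cast sum_le_of_mem_multiIndicesLE hα
  have := iteratedFDeriv_const_smul_apply' (a := c) (hf.of_le hα')
  simp only [smul_eq_mul] at this
  rw [partialDeriv, this]
  simp only [smul_apply, partialDeriv, smul_eq_mul]
  ring

theorem diffOp_sum {k : ℕ} {a : (Fin d → ℕ) → E → ℝ} {ι : Type*} (u : Finset ι) {f : ι → E → ℝ}
    {z : E} (hf : ∀ i ∈ u, ContDiffAt ℝ k (f i) z) :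
    diffOp k a (fun x => ∑ i ∈ u, f i x) z = ∑ i ∈ u, diffOp k a (f i) z := by
  simp only [diffOp]
  rw [Finset.sum_comm]
  refine Finset.sum_congr rfl fun α hα => ?_
  have hα' : ((∑ i, α i : ℕ) : WithTop ℕ∞) ≤ k := by
    exact_mod_cast sum_le_of_mem_multiIndicesLE hα
  rw [partialDeriv, iteratedFDeriv_fun_sum_apply fun i hi => (hf i hi).of_le hα',
    sum_apply, Finset.mul_sum]
  rfl

/-- The error functional `f ↦ D f (z) - ∑ⱼ wⱼ f(xⱼ)` of a formula. -/
noncomputable def formulaError {N : ℕ} (k : ℕ) (a : (Fin d → ℕ) → E → ℝ) (z : E) (x : Fin N → E)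
    (w : Fin N → ℝ) (f : E → ℝ) : ℝ :=
  diffOp k a f z - ∑ j, w j * f (x j)

theorem formulaError_add {N k : ℕ} {a : (Fin d → ℕ) → E → ℝ} {z : E} {x : Fin N → E} {w : Fin N → ℝ}
    {f g : E → ℝ} (hf : ContDiffAt ℝ k f z) (hg : ContDiffAt ℝ k g z) :
    formulaError k a z x w (fun y => f y + g y) =
      formulaError k a z x w f + formulaError k a z x w g := by
  simp only [formulaError, diffOp_add hf hg, mul_add, Finset.sum_add_distrib]
  ring

theorem formulaError_const_mul {N k : ℕ} {a : (Fin d → ℕ) → E → ℝ} {z : E} {x : Fin N → E} {w : Fin N → ℝ}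
    {f : E → ℝ} (hf : ContDiffAt ℝ k f z) (c : ℝ) :
    formulaError k a z x w (fun y => c * f y) = c * formulaError k a z x w f := by
  simp only [formulaError, diffOp_const_mul hf, mul_sub, Finset.mul_sum]
  congr 1
  exact Finset.sum_congr rfl fun j _ => by ring

theorem formulaError_sum {N k : ℕ} {a : (Fin d → ℕ) → E → ℝ} {z : E} {x : Fin N → E} {w : Fin N → ℝ}
    {ι : Type*} (u : Finset ι) {f : ι → E → ℝ}
    (hf : ∀ i ∈ u, ContDiffAt ℝ k (f i) z) :
    formulaError k a z x w (fun y => ∑ i ∈ u, f i y) = ∑ i ∈ u, formulaError k a z x w (f i) := by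
  simp only [formulaError, diffOp_sum u hf, Finset.mul_sum, Finset.sum_sub_distrib]
  rw [Finset.sum_comm (s := Finset.univ)]

/-- The representer of the error functional in a feature space. -/
noncomputable def errorRepresenter {N : ℕ} {H : Type*} [NormedAddCommGroup H] [NormedSpace ℝ H] (k : ℕ)
    (a : (Fin d → ℕ) → E → ℝ) (z : E) (x : Fin N → E) (w : Fin N → ℝ) (F : E → H) : H :=
  ∑ α ∈ multiIndicesLE d k, a α z • iteratedFDeriv ℝ (∑ i, α i) F z (multiDirections α) -
    ∑ j, w j • F (x j)

theorem formulaError_inner {N k : ℕ} {a : (Fin d → ℕ) → E → ℝ} {z : E} {x : Fin N → E} {w : Fin N → ℝ}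
    {H : Type*} [NormedAddCommGroup H] [InnerProductSpace ℝ H]
    {F : E → H} (hF : ContDiffAt ℝ k F z) (g : H) :
    formulaError k a z x w (fun y => inner ℝ (F y) g) =
      inner ℝ (errorRepresenter k a z x w F) g := by
  rw [formulaError, errorRepresenter, inner_sub_left, sum_inner, sum_inner, diffOp]
  congr 1
  · refine Finset.sum_congr rfl fun α hα => ?_
    have hα' : ((∑ i, α i : ℕ) : WithTop ℕ∞) ≤ k := by
      exact_mod_cast sum_le_of_mem_multiIndicesLE hα
    have h1 := (innerSL ℝ g).iteratedFDeriv_comp_left hF hα'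
    have h2 : (fun y => inner ℝ (F y) g) = (innerSL ℝ g) ∘ F := by
      funext y
      simp [real_inner_comm]
    rw [partialDeriv, h2, h1, inner_smul_left]
    simp [real_inner_comm]
  · exact Finset.sum_congr rfl fun j _ => by simp [inner_smul_left]

/-! ### Polynomials -/

theorem contDiff_polyFun (p : MvPolynomial (Fin d) ℝ) {n : WithTop ℕ∞} :
    ContDiff ℝ n (polyFun p) := by
  induction p using MvPolynomial.induction_on with
  | C c =>
    have : polyFun (MvPolynomial.C c : MvPolynomial (Fin d) ℝ) = fun _ => c := by
      funext x; simp [polyFun]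
    rw [this]; exact contDiff_const
  | add p q hp hq =>
    rw [polyFun_add]; exact hp.add hq
  | mul_X p i hp =>
    have : polyFun (p * MvPolynomial.X i) = fun x => polyFun p x * x i := by
      funext x; simp [polyFun]
    rw [this]
    exact hp.mul (by fun_prop)

theorem polySpace_mono {s t : ℕ} (h : s ≤ t) : polySpace d s ≤ polySpace d t :=
  MvPolynomial.restrictSupport_mono ℝ fun _ hn => lt_of_lt_of_le hn h

open scoped Pointwise in
theorem mul_mem_polySpace {m n : ℕ} {p q : MvPolynomial (Fin d) ℝ}
    (hp : p ∈ polySpace d (m + 1)) (hq : q ∈ polySpace d (n + 1)) :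
    p * q ∈ polySpace d (m + n + 1) := by
  have h1 : p * q ∈ MvPolynomial.restrictSupport ℝ
      ({k : Fin d →₀ ℕ | k.degree < m + 1} + {k : Fin d →₀ ℕ | k.degree < n + 1}) := by
    rw [MvPolynomial.restrictSupport_add]
    exact Submodule.mul_mem_mul hp hq
  refine MvPolynomial.restrictSupport_mono ℝ ?_ h1
  rintro _ ⟨k, hk, l, hl, rfl⟩
  simp only [Set.mem_ofPred_eq, map_add] at hk hl ⊢
  omega

theorem C_mem_polySpace (c : ℝ) (n : ℕ) : MvPolynomial.C c ∈ polySpace d (n + 1) := by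
  refine (MvPolynomial.monomial_mem_restrictSupport ℝ).2 (Or.inl ?_)
  simp

theorem X_mem_polySpace (i : Fin d) : MvPolynomial.X i ∈ polySpace d 2 := by
  refine (MvPolynomial.monomial_mem_restrictSupport ℝ).2 (Or.inl ?_)
  simp

theorem X_sub_C_mem_polySpace (i : Fin d) (c : ℝ) :
    MvPolynomial.X i - MvPolynomial.C c ∈ polySpace d 2 :=
  Submodule.sub_mem _ (X_mem_polySpace i) (C_mem_polySpace c 1)

theorem exists_polyFun_eq_multilinear (z : E) {m : ℕ} (A : E [×m]→L[ℝ] ℝ) :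
    ∃ q ∈ polySpace d (m + 1), ∀ x, polyFun q x = A fun _ => x - z := by
  induction m with
  | zero =>
    refine ⟨MvPolynomial.C (A 0), C_mem_polySpace _ 0, fun x => ?_⟩
    rw [polyFun, MvPolynomial.eval_C]
    congr 1
    exact Subsingleton.elim _ _
  | succ m ih =>
    choose q hq hqA using fun i : Fin d => ih (A.curryLeft (EuclideanSpace.single i 1))
    refine ⟨∑ i, (q i * (MvPolynomial.X i - MvPolynomial.C (z i))), Submodule.sum_mem _ fun i _ =>
      mul_mem_polySpace (hq i) (X_sub_C_mem_polySpace i _), fun x => ?_⟩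
    have h1 : x - z = ∑ i, (x i - z i) • (EuclideanSpace.single i 1 : E) := by
      ext j
      simp [Finset.sum_apply, Pi.single_apply]
    have h2 : (A fun _ => x - z) = A.curryLeft (x - z) fun _ => x - z := by
      rw [ContinuousMultilinearMap.curryLeft_apply]
      congr 1
      funext i
      refine Fin.cases rfl (fun j => rfl) i
    rw [h2]
    have h3 : A.curryLeft (x - z) =
        ∑ i, (x i - z i) • A.curryLeft (EuclideanSpace.single i 1 : E) := by
      conv_lhs => rw [h1]
      rw [map_sum]
      exact Finset.sum_congr rfl fun i _ => map_smul _ _ _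
    rw [h3, sum_apply]
    simp only [smul_apply, smul_eq_mul, ← hqA]
    simp [polyFun, mul_comm]

/-- The Taylor polynomial of degree `n` has the derivatives of order at most `n` of the function. -/
theorem exists_taylor_polynomial {n : ℕ} {φ : E → ℝ} {z : E} (hφ : ContDiffAt ℝ n φ z) :
    ∃ q ∈ polySpace d (n + 1),
      (∀ x, polyFun q x = ∑ m ∈ Finset.range (n + 1),
        iteratedFDeriv ℝ m φ z (fun _ => x - z) / m.factorial) ∧
      ∀ m ≤ n, ∀ v : Fin m → E, iteratedFDeriv ℝ m (polyFun q) z v = iteratedFDeriv ℝ m φ z v := by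
  choose q hq hqA using fun m : ℕ => exists_polyFun_eq_multilinear z (iteratedFDeriv ℝ m φ z)
  set Q : MvPolynomial (Fin d) ℝ := ∑ m ∈ Finset.range (n + 1), ((m.factorial : ℝ)⁻¹) • q m
  have hQ : ∀ x, polyFun Q x = ∑ m ∈ Finset.range (n + 1),
      iteratedFDeriv ℝ m φ z (fun _ => x - z) / m.factorial := by
    intro x
    have h1 : polyFun Q = ∑ m ∈ Finset.range (n + 1), ((m.factorial : ℝ)⁻¹) • polyFun (q m) := by
      simp only [← polyFunₗ_apply, Q, map_sum, map_smul]
    rw [h1, Finset.sum_apply]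
    refine Finset.sum_congr rfl fun m _ => ?_
    rw [Pi.smul_apply, hqA, smul_eq_mul, inv_mul_eq_div]
  refine ⟨Q, Submodule.sum_mem _ fun m hm => Submodule.smul_mem _ _
    (polySpace_mono (by simp at hm; omega) (hq m)), hQ, fun m hm v => ?_⟩
  obtain ⟨U, hU, hφU⟩ : ∃ U ∈ 𝓝 z, ContDiffOn ℝ n φ U := hφ.contDiffOn le_rfl (by simp)
  obtain ⟨V, hVU, hV, hzV⟩ := mem_nhds_iff.1 hU
  let P : FormalMultilinearSeries ℝ E ℝ := fun m =>
    if m ≤ n then (m.factorial : ℝ)⁻¹ • iteratedFDeriv ℝ m φ z else 0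
  have hP : HasFiniteFPowerSeriesOnBall (polyFun Q) P z (n + 1) ⊤ := by
    refine HasFiniteFPowerSeriesOnBall.mk' (fun m hm => if_neg (by omega)) (by simp) ?_
    intro y _
    rw [hQ]
    refine Finset.sum_congr rfl fun m hm => ?_
    have : m ≤ n := by simp at hm; omega
    simp only [P, if_pos this, smul_apply, smul_eq_mul,
      add_sub_cancel_left, inv_mul_eq_div]
  -- The derivatives of a power series are sums over permutations of its coefficients; here the
  -- coefficients are symmetric, so the m! equal terms cancel the factor 1/m!.
  rw [hP.toHasFPowerSeriesOnBall.iteratedFDeriv_eq_sum_of_completeSpace]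
  simp only [P, if_pos hm, smul_apply, smul_eq_mul]
  have hsym : ∀ σ : Equiv.Perm (Fin m), iteratedFDeriv ℝ m φ z (fun i => v (σ i)) =
      iteratedFDeriv ℝ m φ z v := fun σ =>
    iteratedFDeriv_comp_perm_of_contDiffOn hV
      ((hφU.mono hVU).of_le (by exact_mod_cast hm)) v σ hzV
  simp only [hsym, Finset.sum_const, Finset.card_univ, Fintype.card_perm, Fintype.card_fin,
    nsmul_eq_mul]
  field_simp

/-- The remainder of the Taylor expansion of degree `n` at `z`. -/
noncomputable def taylorRemainder (n : ℕ) (z : E) (φ : E → ℝ) (x : E) : ℝ :=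
  φ x - ∑ m ∈ Finset.range (n + 1), iteratedFDeriv ℝ m φ z (fun _ => x - z) / m.factorial

/-- A formula that is exact for polynomials of degree at most `n` has an error that is a
combination of Taylor remainders. -/
theorem formulaError_eq_sum_taylorRemainder {N k n : ℕ} {a : (Fin d → ℕ) → E → ℝ} {z : E}
    {x : Fin N → E} {w : Fin N → ℝ} (hkn : k ≤ n)
    (hw : ∀ q ∈ polySpace d (n + 1), formulaError k a z x w (polyFun q) = 0) {φ : E → ℝ}
    (hφ : ContDiffAt ℝ n φ z) :
    formulaError k a z x w φ = -∑ j, w j * taylorRemainder n z φ (x j) := by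
  obtain ⟨q, hq, hqx, hqd⟩ := exists_taylor_polynomial hφ
  have h1 := hw q hq
  have h2 : diffOp k a (polyFun q) z = diffOp k a φ z := by
    refine Finset.sum_congr rfl fun α hα => ?_
    rw [partialDeriv, hqd _ ((sum_le_of_mem_multiIndicesLE hα).trans hkn), partialDeriv]
  rw [formulaError, h2] at h1
  simp only [taylorRemainder, ← hqx, mul_sub, Finset.sum_sub_distrib, formulaError]
  linarith

/-- An affine substitution for each variable does not raise the total degree. -/
theorem exists_polyFun_comp_scale (z : E) (h : ℝ) {s : ℕ} {q : MvPolynomial (Fin d) ℝ}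
    (hq : q ∈ polySpace d s) :
    ∃ q' ∈ polySpace d s, ∀ x, polyFun q' x = polyFun q (z + h • (x - z)) := by
  let lin : Fin d → MvPolynomial (Fin d) ℝ := fun i =>
    MvPolynomial.C (z i) + h • (MvPolynomial.X i - MvPolynomial.C (z i))
  have hlin : ∀ i, lin i ∈ polySpace d (1 + 1) := fun i =>
    Submodule.add_mem _ (C_mem_polySpace _ 1) (Submodule.smul_mem _ _ (X_sub_C_mem_polySpace i _))
  have heval : ∀ (r : MvPolynomial (Fin d) ℝ) (x : E), polyFun (MvPolynomial.aeval lin r) x =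
      polyFun r (z + h • (x - z)) := by
    intro r x
    induction r using MvPolynomial.induction_on with
    | C c => simp [polyFun]
    | add p q hp hq => rw [map_add, polyFun_add, polyFun_add, Pi.add_apply, Pi.add_apply, hp, hq]
    | mul_X p i hp =>
      simp only [polyFun, map_mul, MvPolynomial.aeval_X, MvPolynomial.eval_X] at hp ⊢
      rw [hp]
      simp [lin, MvPolynomial.smul_eval]
  have hpow : ∀ (i : Fin d) (m : ℕ), lin i ^ m ∈ polySpace d (m + 1) := by
    intro i m
    induction m with
    | zero => simpa using C_mem_polySpace 1 0
    | succ m ih => rw [pow_succ]; exact mul_mem_polySpace ih (hlin i)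
  have hprod : ∀ (t : Finset (Fin d)) (n : Fin d →₀ ℕ),
      ∏ i ∈ t, lin i ^ n i ∈ polySpace d (∑ i ∈ t, n i + 1) := by
    intro t n
    induction t using Finset.induction_on with
    | empty => simpa using C_mem_polySpace 1 0
    | insert i t hi ih =>
      rw [Finset.prod_insert hi, Finset.sum_insert hi]
      exact mul_mem_polySpace (hpow i _) ih
  refine ⟨MvPolynomial.aeval lin q, ?_, heval q⟩
  rw [polySpace, MvPolynomial.restrictSupport_eq_span] at hq
  induction hq using Submodule.span_induction with
  | mem r hr =>
    obtain ⟨n, hn, rfl⟩ := hr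
    rw [MvPolynomial.aeval_monomial, map_one, one_mul, Finsupp.prod]
    refine polySpace_mono ?_ (hprod n.support n)
    exact hn
  | zero => simp
  | add r r' _ _ h1 h2 => rw [map_add]; exact Submodule.add_mem _ h1 h2
  | smul c r _ h1 => rw [map_smul]; exact Submodule.smul_mem _ _ h1

theorem partialDeriv_comp_scale {f : E → ℝ} (α : Fin d → ℕ)
    (hf : ContDiff ℝ (∑ i, α i : ℕ) f) (z : E) (h : ℝ) :
    partialDeriv α (fun x => f (z + h • (x - z))) z = h ^ (∑ i, α i) * partialDeriv α f z := by
  have h1 : (fun x => f (z + h • (x - z))) =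
      (fun y => f ((z - h • z) + y)) ∘ (h • ContinuousLinearMap.id ℝ E) := by
    funext x
    simp only [Function.comp_apply, smul_apply, ContinuousLinearMap.id_apply]
    congr 1
    rw [smul_sub]; abel
  have h2 : ContDiff ℝ (∑ i, α i : ℕ) (fun y => f ((z - h • z) + y)) :=
    hf.comp (contDiff_const.add contDiff_id)
  rw [partialDeriv, h1, ContinuousLinearMap.iteratedFDeriv_comp_right _ h2 z le_rfl,
    iteratedFDeriv_comp_add_left]
  simp only [ContinuousMultilinearMap.compContinuousLinearMap_apply,
    smul_apply, ContinuousLinearMap.id_apply, sub_add_cancel]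
  rw [ContinuousMultilinearMap.map_smul_univ]
  simp [partialDeriv]

theorem diffOp_homogeneousPart_comp_scale {k j : ℕ} {a : (Fin d → ℕ) → E → ℝ} {f : E → ℝ}
    (hf : ContDiff ℝ k f) (z : E) (h : ℝ) :
    diffOp k (homogeneousPart a j) (fun x => f (z + h • (x - z))) z =
      h ^ j * diffOp k (homogeneousPart a j) f z := by
  rw [diffOp, diffOp, Finset.mul_sum]
  refine Finset.sum_congr rfl fun α hα => ?_
  by_cases hj : ∑ i, α i = j
  · rw [partialDeriv_comp_scale α (hf.of_le (by
      exact_mod_cast sum_le_of_mem_multiIndicesLE hα)), hj]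
    ring
  · simp [homogeneousPart, hj]

theorem diffOp_eq_sum_homogeneousPart (k : ℕ) (a : (Fin d → ℕ) → E → ℝ) (f : E → ℝ) (z : E) :
    diffOp k a f z = ∑ j ∈ Finset.range (k + 1), diffOp k (homogeneousPart a j) f z := by
  simp only [diffOp]
  rw [Finset.sum_comm]
  refine Finset.sum_congr rfl fun α hα => ?_
  have := sum_le_of_mem_multiIndicesLE hα
  rw [← Finset.sum_mul]
  congr 1
  simp [homogeneousPart, this]

/-! ### Duality -/

/-- Linear programming duality for the growth function. -/
theorem exists_weights_of_le {V : Type*} [AddCommGroup V] [Module ℝ V] {N : ℕ}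
    (L : V →ₗ[ℝ] ℝ) (ℓ : Fin N → V →ₗ[ℝ] ℝ) {δ : Fin N → ℝ} (hδ : ∀ j, 0 ≤ δ j) {ρ : ℝ}
    (hρ : 0 ≤ ρ) (h : ∀ v, (∀ j, |ℓ j v| ≤ δ j) → L v ≤ ρ) :
    ∃ w : Fin N → ℝ, (∀ v, L v = ∑ j, w j * ℓ j v) ∧ ∑ j, |w j| * δ j ≤ ρ := by
  -- Homogeneity. For m = 0 every multiple of v is admissible, so a positive value of L v would make
  -- L unbounded.
  have hscale : ∀ v (m : ℝ), 0 ≤ m → (∀ j, |ℓ j v| ≤ m * δ j) → L v ≤ ρ * m := by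
    intro v m hm hv
    rcases hm.eq_or_lt with rfl | hm
    · rw [mul_zero]
      by_contra! hL
      have h1 := h (((ρ + 1) / L v) • v) fun j => by
        have : ℓ j v = 0 := abs_nonpos_iff.1 (by simpa using hv j)
        simpa [this] using hδ j
      rw [map_smul, smul_eq_mul, div_mul_cancel₀ _ hL.ne'] at h1
      linarith
    · have h1 := h (m⁻¹ • v) fun j => by
        rw [map_smul, smul_eq_mul, abs_mul, abs_of_pos (inv_pos.2 hm), inv_mul_le_iff₀ hm]
        exact hv j
      rw [map_smul, smul_eq_mul, inv_mul_le_iff₀ hm] at h1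
      linarith
  have hspan : L ∈ Submodule.span ℝ (Set.range ℓ) := by
    refine mem_span_of_iInf_ker_le_ker fun v hv => ?_
    have hv' : ∀ j, ℓ j v = 0 := by simpa using hv
    have h1 := hscale v 0 le_rfl fun j => by simp [hv']
    have h2 := hscale (-v) 0 le_rfl fun j => by simp [hv']
    rw [map_neg] at h2
    exact le_antisymm (by linarith) (by linarith)
  obtain ⟨c, hc⟩ := (Submodule.mem_span_range_iff_exists_fun ℝ).1 hspan
  have hLc : ∀ v, L v = ∑ j, c j * ℓ j v := fun v => by
    rw [← hc]; simp [LinearMap.sum_apply]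
  -- Indices with δ j = 0 (in the application, a node at z) act as linear constraints. Hahn–Banach
  -- is applied on the values of vectors satisfying them, and those weights are restored at the end.
  let V₀ : Submodule ℝ V := ⨅ j : {j // δ j = 0}, LinearMap.ker (ℓ j)
  let T : V →ₗ[ℝ] (Fin N → ℝ) := LinearMap.pi ℓ
  let f₀ : (Fin N → ℝ) →ₗ[ℝ] ℝ := ∑ j, c j • LinearMap.proj j
  -- A weighted sup norm. Since 0⁻¹ = 0, the coordinates with δ j = 0 do not enter it.
  let nrm : (Fin N → ℝ) → ℝ := fun y => ρ * ‖fun j => y j * (δ j)⁻¹‖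
  obtain ⟨g, hgf, hgn⟩ := exists_extension_of_le_sublinear
    ⟨V₀.map T, f₀.domRestrict (V₀.map T)⟩ nrm
    (fun b hb y => by
      have : (fun j => (b • y) j * (δ j)⁻¹) = b • fun j => y j * (δ j)⁻¹ := by
        funext j; simp [mul_assoc]
      simp only [nrm, this, norm_smul, Real.norm_eq_abs, abs_of_pos hb]
      ring)
    (fun y y' => by
      have : (fun j => (y + y') j * (δ j)⁻¹) =
          (fun j => y j * (δ j)⁻¹) + fun j => y' j * (δ j)⁻¹ := by
        funext j; simp [add_mul]
      simp only [nrm, this, ← mul_add]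
      exact mul_le_mul_of_nonneg_left (norm_add_le _ _) hρ)
    (by
      rintro ⟨_, v, hv, rfl⟩
      have hv0 : ∀ j, δ j = 0 → ℓ j v = 0 := fun j hj => by
        have := (Submodule.mem_iInf _).1 hv ⟨j, hj⟩
        exact this
      have h1 : f₀ (T v) = L v := by
        simp [f₀, T, hLc v, LinearMap.sum_apply]
      change f₀ (T v) ≤ ρ * ‖fun j => T v j * (δ j)⁻¹‖
      rw [h1]
      refine hscale v _ (norm_nonneg _) fun j => ?_
      rcases (hδ j).eq_or_lt with hj | hj
      · simp [hv0 j hj.symm, ← hj]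
      · have h2 := norm_le_pi_norm (fun j => T v j * (δ j)⁻¹) j
        rw [Real.norm_eq_abs, abs_mul, abs_of_pos (inv_pos.2 hj), ← div_eq_mul_inv,
          div_le_iff₀ hj] at h2
        exact h2)
  let w : Fin N → ℝ := fun j => g (Pi.single j 1)
  have hgw : ∀ y, g y = ∑ j, w j * y j := fun y => by
    conv_lhs => rw [pi_eq_sum_univ' y]
    simp [w, map_sum, mul_comm]
  have hsum : ∑ j, |w j| * δ j ≤ ρ := by
    -- The sign vector is extremal for the duality between the weighted sup norm and the weighted ℓ¹
    -- norm.
    have h1 := hgn fun j => SignType.sign (w j) * δ j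
    rw [hgw] at h1
    have h2 : ∑ j, |w j| * δ j = ∑ j, w j * (SignType.sign (w j) * δ j) :=
      Finset.sum_congr rfl fun j _ => by rw [← mul_assoc, self_mul_sign]
    rw [h2]
    refine h1.trans (mul_le_of_le_one_right hρ ?_)
    refine (pi_norm_le_iff_of_nonneg zero_le_one).2 fun j => ?_
    rw [Real.norm_eq_abs, abs_mul, abs_mul]
    have h3 : |((SignType.sign (w j) : SignType) : ℝ)| ≤ 1 := by
      rcases lt_trichotomy (w j) 0 with h | h | h
      · simp [sign_neg h]
      · simp [h]
      · simp [sign_pos h]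
    have h4 : |δ j| * |(δ j)⁻¹| ≤ 1 := by
      rw [← abs_mul]
      rcases eq_or_ne (δ j) 0 with h0 | h0
      · simp [h0]
      · simp [mul_inv_cancel₀ h0]
    rw [mul_assoc]
    exact mul_le_one₀ h3 (by positivity) h4
  -- The extension represents L only on V₀. The defect is a combination of the ℓ j with δ j = 0, and
  -- adding its coefficients to w costs nothing in the weighted sum.
  have hspan' : L - ∑ j, w j • ℓ j ∈
      Submodule.span ℝ (Set.range fun j : {j // δ j = 0} => ℓ j) := by
    refine mem_span_of_iInf_ker_le_ker fun v hv => ?_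
    have h1 := hgf ⟨T v, Submodule.mem_map_of_mem hv⟩
    have h2 : f₀ (T v) = L v := by
      simp [f₀, T, hLc v, LinearMap.sum_apply]
    have h3 : g (T v) = L v := h1.trans h2
    rw [hgw] at h3
    rw [LinearMap.mem_ker, LinearMap.sub_apply, sub_eq_zero, ← h3]
    simp [T, LinearMap.sum_apply]
  obtain ⟨e, he⟩ := (Submodule.mem_span_range_iff_exists_fun ℝ).1 hspan'
  refine ⟨fun j => w j + if hj : δ j = 0 then e ⟨j, hj⟩ else 0, fun v => ?_, ?_⟩
  · have h1 := congrArg (fun φ : V →ₗ[ℝ] ℝ => φ v) he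
    simp only [LinearMap.sum_apply, LinearMap.smul_apply, LinearMap.sub_apply, smul_eq_mul] at h1
    have h2 : ∑ j, (if hj : δ j = 0 then e ⟨j, hj⟩ else 0) * ℓ j v =
        ∑ j : {j // δ j = 0}, e j * ℓ j v := by
      rw [← Finset.sum_filter_add_sum_filter_not Finset.univ (fun j => δ j = 0),
        Finset.sum_subtype (p := fun j => δ j = 0) _ (by simp)]
      have h3 : ∑ j ∈ Finset.univ.filter (fun j => ¬ δ j = 0),
          (if hj : δ j = 0 then e ⟨j, hj⟩ else 0) * ℓ j v = 0 :=
        Finset.sum_eq_zero fun j hj => by simp [(Finset.mem_filter.1 hj).2]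
      rw [h3, add_zero]
      exact Finset.sum_congr rfl fun j _ => by simp [j.2]
    simp only [add_mul, Finset.sum_add_distrib, h2, h1]
    ring
  · refine le_trans (le_of_eq ?_) hsum
    refine Finset.sum_congr rfl fun j _ => ?_
    by_cases hj : δ j = 0
    · simp [hj]
    · simp [hj]

end Functional

/-! ### Smooth feature maps and kernel weights as minimizers of the error norm -/

section Smooth

variable {d : ℕ}

local notation "E" => EuclideanSpace ℝ (Fin d)

/-- A feature map of the native space of `Φ (x - y)` that is smooth at `z`. -/
structure IsSmoothFeatureMap {H : Type*} [NormedAddCommGroup H] [InnerProductSpace ℝ H]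
    {M : ℕ} (s n : ℕ) (P : Fin M → EuclideanSpace ℝ (Fin d) → ℝ)
    (Φ : EuclideanSpace ℝ (Fin d) → ℝ) (z : EuclideanSpace ℝ (Fin d))
    (F : EuclideanSpace ℝ (Fin d) → H) (C S : Fin M → EuclideanSpace ℝ (Fin d) → ℝ) : Prop where
  contDiffAt : ContDiffAt ℝ n F z
  contDiffAt_coeff : ∀ l, ContDiffAt ℝ n (S l) z
  contDiffAt_poly : ∀ l, ContDiffAt ℝ n (P l) z
  kernel_eq : ∀ x y, Φ (x - y) =
    inner ℝ (F x) (F y) + ∑ l, C l y * P l x + ∑ l, P l y * S l x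
  native : ∀ f t, HasNativeSeminorm (fun x y => Φ (x - y)) s f t → ∃ g : H, ‖g‖ = t ∧
    ∃ e : Fin M → ℝ, ∀ x, f x = inner ℝ (F x) g + ∑ l, e l * P l x
  indep : ∀ (N : ℕ) (x : Fin N → EuclideanSpace ℝ (Fin d)), Function.Injective x →
    ∀ u : Fin N → ℝ, (∀ l, ∑ j, u j * P l (x j) = 0) → ∑ j, u j • F (x j) = 0 → u = 0

/-- With arguments and correcting points all in the ball of radius R/2 about z, every difference
stays in the ball where Φ is smooth. So the kernel of F is C^{2n} there. -/
theorem IsCondPosDef.exists_isSmoothFeatureMap {s M n : ℕ} {Φ : E → ℝ}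
    (hK : IsCondPosDef s fun x y => Φ (x - y)) (p : Module.Basis (Fin M) ℝ (polySpace d s))
    (z : E) {R : ℝ} (hR : 0 < R) (hΦ : ContDiffOn ℝ ((2 * n : ℕ) : ℕ∞) Φ (Metric.ball 0 R)) :
    ∃ (H : Type) (_ : NormedAddCommGroup H) (_ : InnerProductSpace ℝ H) (_ : CompleteSpace H)
      (F : E → H) (C S : Fin M → E → ℝ),
      IsSmoothFeatureMap s n (fun l => polyFun (p l : MvPolynomial (Fin d) ℝ)) Φ z F C S := by
  obtain ⟨H, i1, i2, i3, F, c, b, hsupp, hF, hnat, hind⟩ :=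
    hK.exists_feature_map p z (half_pos hR)
  set P : Fin M → E → ℝ := fun l => polyFun (p l : MvPolynomial (Fin d) ℝ) with hP
  set K : E → E → ℝ := fun x y => Φ (x - y) with hKdef
  set U : Set E := Metric.ball z (R / 2) with hU
  have hzU : z ∈ U := by simp [hU, hR]
  have hdiff : ∀ x ∈ U, ∀ y ∈ U, x - y ∈ Metric.ball (0 : E) R := by
    intro x hx y hy
    rw [mem_ball_zero_iff, ← dist_eq_norm]
    have := dist_triangle_right x y z
    rw [hU, Metric.mem_ball] at hx hy
    linarith
  have hPc : ∀ (m : WithTop ℕ∞) l, ContDiff ℝ m (P l) := fun m l => contDiff_polyFun _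
  have hC : ∀ l, ContDiffOn ℝ ((2 * n : ℕ) : ℕ∞) (kernelComb K (c l)) U := by
    intro l
    have : kernelComb K (c l) = fun x => ∑ ξ ∈ (c l).support, c l ξ * Φ (x - ξ) := rfl
    rw [this]
    refine ContDiffOn.sum fun ξ hξ => contDiffOn_const.mul ?_
    exact hΦ.comp (contDiffOn_id.sub contDiffOn_const) fun x hx => hdiff x hx ξ (hsupp l ξ hξ)
  have hFU : ContDiffOn ℝ (n : ℕ∞) F U := by
    refine contDiffOn_of_contDiffOn_inner Metric.isOpen_ball n ?_
    simp only [hF]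
    have hfst : ContDiffOn ℝ ((2 * n : ℕ) : ℕ∞) (fun q : E × E => q.1) (U ×ˢ U) := contDiffOn_fst
    have hsnd : ContDiffOn ℝ ((2 * n : ℕ) : ℕ∞) (fun q : E × E => q.2) (U ×ˢ U) := contDiffOn_snd
    have h1 : ContDiffOn ℝ ((2 * n : ℕ) : ℕ∞) (fun q : E × E => K q.1 q.2) (U ×ˢ U) :=
      hΦ.comp (hfst.sub hsnd) fun q hq => hdiff _ hq.1 _ hq.2
    have h2 : ∀ l, ContDiffOn ℝ ((2 * n : ℕ) : ℕ∞) (fun q : E × E => P l q.1) (U ×ˢ U) :=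
      fun l => (hPc _ l).comp_contDiffOn hfst
    have h3 : ∀ l, ContDiffOn ℝ ((2 * n : ℕ) : ℕ∞) (fun q : E × E => P l q.2) (U ×ˢ U) :=
      fun l => (hPc _ l).comp_contDiffOn hsnd
    have h4 : ∀ l, ContDiffOn ℝ ((2 * n : ℕ) : ℕ∞) (fun q : E × E => kernelComb K (c l) q.1)
        (U ×ˢ U) := fun l => (hC l).comp hfst fun q hq => hq.1
    have h5 : ∀ l, ContDiffOn ℝ ((2 * n : ℕ) : ℕ∞) (fun q : E × E => kernelComb K (c l) q.2)
        (U ×ˢ U) := fun l => (hC l).comp hsnd fun q hq => hq.2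
    refine ((h1.sub (ContDiffOn.sum fun l _ => (h2 l).mul (h5 l))).sub
      (ContDiffOn.sum fun l _ => (h3 l).mul (h4 l))).add
      (ContDiffOn.sum fun l _ => ContDiffOn.sum fun m _ => ((h2 l).mul (h3 m)).mul contDiffOn_const)
  -- The terms with b are absorbed into S. No smoothness of C is recorded, since it only supplies
  -- coefficients of polynomials when y is fixed.
  refine ⟨H, i1, i2, i3, F, fun l => kernelComb K (c l),
    fun l x => kernelComb K (c l) x - ∑ m, P m x * b m l, ⟨?_, ?_, ?_, ?_, hnat, hind⟩⟩
  · exact hFU.contDiffAt (Metric.isOpen_ball.mem_nhds hzU)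
  · intro l
    refine ContDiffAt.sub ?_ (ContDiffAt.sum fun m _ => (hPc _ m).contDiffAt.mul contDiffAt_const)
    refine ((hC l).contDiffAt (Metric.isOpen_ball.mem_nhds hzU)).of_le ?_
    exact_mod_cast (by omega : n ≤ 2 * n)
  · exact fun l => (hPc _ l).contDiffAt
  · intro x y
    rw [hF]
    have h1 : ∑ l, P l y * (kernelComb K (c l) x - ∑ m, P m x * b m l) =
        ∑ l, P l y * kernelComb K (c l) x - ∑ l, ∑ m, P l x * P m y * b l m := by
      simp only [mul_sub, Finset.sum_sub_distrib, Finset.mul_sum]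
      congr 1
      rw [Finset.sum_comm]
      exact Finset.sum_congr rfl fun l _ => Finset.sum_congr rfl fun m _ => by ring
    rw [h1]
    simp only [mul_comm (kernelComb K _ y)]
    simp only [hKdef]
    ring

namespace IsSmoothFeatureMap

variable {H : Type*} [NormedAddCommGroup H] [InnerProductSpace ℝ H]
    {M s n : ℕ} {P : Fin M → EuclideanSpace ℝ (Fin d) → ℝ}
    {Φ : EuclideanSpace ℝ (Fin d) → ℝ} {z : EuclideanSpace ℝ (Fin d)}
    {F : EuclideanSpace ℝ (Fin d) → H} {C S : Fin M → EuclideanSpace ℝ (Fin d) → ℝ}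

theorem contDiffAt_kernel (h : IsSmoothFeatureMap s n P Φ z F C S) (y : E) :
    ContDiffAt ℝ n (fun x => Φ (x - y)) z := by
  simp only [h.kernel_eq]
  exact ((h.contDiffAt.inner ℝ contDiffAt_const).add (ContDiffAt.sum fun l _ =>
    contDiffAt_const.mul (h.contDiffAt_poly l))).add
    (ContDiffAt.sum fun l _ => contDiffAt_const.mul (h.contDiffAt_coeff l))

/-- By translation invariance, smoothness of all Φ(· - y) at the single point z is smoothness of Φ
everywhere. -/
theorem contDiff_kernel (h : IsSmoothFeatureMap s n P Φ z F C S) : ContDiff ℝ n Φ := by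
  refine contDiff_iff_contDiffAt.2 fun w => ?_
  have h1 := h.contDiffAt_kernel (z - w)
  have h2 : ContDiffAt ℝ n (fun y : E => y + (z - w)) w := by fun_prop
  have h3 : ContDiffAt ℝ n ((fun x => Φ (x - (z - w))) ∘ fun y : E => y + (z - w)) w :=
    ContDiffAt.comp w (by simpa using h1) h2
  simpa [Function.comp_def] using h3

theorem contDiffAt_native (h : IsSmoothFeatureMap s n P Φ z F C S) {f : E → ℝ} {t : ℝ}
    (hf : HasNativeSeminorm (fun x y => Φ (x - y)) s f t) : ContDiffAt ℝ n f z := by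
  obtain ⟨g, -, e, hfe⟩ := h.native f t hf
  rw [funext hfe]
  exact (h.contDiffAt.inner ℝ contDiffAt_const).add (ContDiffAt.sum fun l _ =>
    contDiffAt_const.mul (h.contDiffAt_poly l))

variable {N k : ℕ} {a : (Fin d → ℕ) → EuclideanSpace ℝ (Fin d) → ℝ}
  {x : Fin N → EuclideanSpace ℝ (Fin d)} {w : Fin N → ℝ}

theorem formulaError_native_le (h : IsSmoothFeatureMap s n P Φ z F C S) (hk : k ≤ n)
    (hw : ∀ l, formulaError k a z x w (P l) = 0) {f : E → ℝ} {t : ℝ}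
    (hf : HasNativeSeminorm (fun x y => Φ (x - y)) s f t) :
    |formulaError k a z x w f| ≤ ‖errorRepresenter k a z x w F‖ * t := by
  have hk' : (k : WithTop ℕ∞) ≤ n := by exact_mod_cast hk
  obtain ⟨g, hg, e, hfe⟩ := h.native f t hf
  have hF := h.contDiffAt.of_le hk'
  have hP := fun l => (h.contDiffAt_poly l).of_le hk'
  rw [funext hfe, formulaError_add (hF.inner ℝ contDiffAt_const)
    (ContDiffAt.sum fun l _ => contDiffAt_const.mul (hP l)),
    formulaError_sum _ fun l _ => contDiffAt_const.mul (hP l), formulaError_inner hF, ← hg]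
  simp only [formulaError_const_mul (hP _), hw, mul_zero, Finset.sum_const_zero, add_zero]
  exact abs_real_inner_le_norm _ _

/-- Exactness kills the C-part, which is polynomial in the differentiated argument; the S-part
survives as a polynomial in y. -/
theorem formulaError_kernel (h : IsSmoothFeatureMap s n P Φ z F C S) (hk : k ≤ n)
    (hw : ∀ l, formulaError k a z x w (P l) = 0) (y : E) :
    formulaError k a z x w (fun x' => Φ (x' - y)) =
      inner ℝ (errorRepresenter k a z x w F) (F y) +
        ∑ l, P l y * formulaError k a z x w (S l) := by
  have hk' : (k : WithTop ℕ∞) ≤ n := by exact_mod_cast hk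
  have hF := h.contDiffAt.of_le hk'
  have hP := fun l => (h.contDiffAt_poly l).of_le hk'
  have hS := fun l => (h.contDiffAt_coeff l).of_le hk'
  have h1 : ContDiffAt ℝ k (fun x' => inner ℝ (F x') (F y)) z := hF.inner ℝ contDiffAt_const
  have h2 : ContDiffAt ℝ k (fun x' => ∑ l, C l y * P l x') z :=
    ContDiffAt.sum fun l _ => contDiffAt_const.mul (hP l)
  simp only [h.kernel_eq]
  rw [formulaError_add (h1.add h2) (ContDiffAt.sum fun l _ => contDiffAt_const.mul (hS l)),
    formulaError_add h1 h2, formulaError_inner hF,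
    formulaError_sum _ fun l _ => contDiffAt_const.mul (hP l),
    formulaError_sum _ fun l _ => contDiffAt_const.mul (hS l)]
  simp only [formulaError_const_mul (hP _), formulaError_const_mul (hS _), hw, mul_zero,
    Finset.sum_const_zero, add_zero]

end IsSmoothFeatureMap

theorem polyExact_iff {N M k : ℕ} {p : Fin M → MvPolynomial (Fin d) ℝ}
    {a : (Fin d → ℕ) → E → ℝ} {z : E} {x : Fin N → E} {w : Fin N → ℝ} :
    PolyExact p k a z x w ↔ ∀ l, formulaError k a z x w (polyFun (p l)) = 0 := by
  refine forall_congr' fun l => ?_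
  rw [formulaError, sub_eq_zero, eq_comm]

/-- The surviving polynomial in y is absorbed by shifting the multipliers v by the errors of the
functions S l. What is left is an orthogonality condition in feature space. -/
theorem isKernelWeights_iff {H : Type*} [NormedAddCommGroup H] [InnerProductSpace ℝ H]
    {M N s n k : ℕ} {p : Fin M → MvPolynomial (Fin d) ℝ} {Φ : E → ℝ} {z : E}
    {F : E → H} {C S : Fin M → E → ℝ} {a : (Fin d → ℕ) → E → ℝ} {x : Fin N → E} {w : Fin N → ℝ}
    (hsymm : ∀ x y, Φ (x - y) = Φ (y - x))
    (h : IsSmoothFeatureMap s n (fun l => polyFun (p l)) Φ z F C S) (hk : k ≤ n) :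
    IsKernelWeights (fun x y => Φ (x - y)) p k a z x w ↔ PolyExact p k a z x w ∧
      ∃ v : Fin M → ℝ, ∀ i, inner ℝ (errorRepresenter k a z x w F) (F (x i)) =
        ∑ l, v l * polyFun (p l) (x i) := by
  rw [IsKernelWeights, and_comm]
  refine and_congr_right fun hw => ?_
  have hw' := polyExact_iff.1 hw
  have key : ∀ i, formulaError k a z x w (fun x' => Φ (x' - x i)) =
      diffOp k a (fun y => Φ (y - x i)) z - ∑ j, w j * Φ (x i - x j) := fun i => by
    simp only [formulaError, hsymm (x i)]
  have key2 : ∀ i, diffOp k a (fun y => Φ (y - x i)) z - ∑ j, w j * Φ (x i - x j) =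
      inner ℝ (errorRepresenter k a z x w F) (F (x i)) +
        ∑ l, polyFun (p l) (x i) * formulaError k a z x w (S l) := fun i => by
    rw [← key, h.formulaError_kernel hk hw']
  constructor
  · rintro ⟨v, hv⟩
    refine ⟨fun l => v l - formulaError k a z x w (S l), fun i => ?_⟩
    have h1 := hv i
    have h2 := key2 i
    simp only [sub_mul, Finset.sum_sub_distrib]
    simp only [mul_comm (polyFun _ _)] at h2
    linarith
  · rintro ⟨v, hv⟩
    refine ⟨fun l => v l + formulaError k a z x w (S l), fun i => ?_⟩
    have h1 := hv i
    have h2 := key2 i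
    simp only [add_mul, Finset.sum_add_distrib]
    simp only [mul_comm (polyFun _ _)] at h2
    linarith

theorem errorRepresenter_sub {H : Type*} [NormedAddCommGroup H] [InnerProductSpace ℝ H]
    {N k : ℕ} (a : (Fin d → ℕ) → E → ℝ) (z : E) (x : Fin N → E) (w u : Fin N → ℝ) (F : E → H) :
    errorRepresenter k a z x (w - u) F = errorRepresenter k a z x w F + ∑ j, u j • F (x j) := by
  simp only [errorRepresenter, Pi.sub_apply, sub_smul, Finset.sum_sub_distrib]
  abel

/-! ### Existence, uniqueness and minimality of the kernel weights -/

section Weights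

variable {H : Type*} [NormedAddCommGroup H] [InnerProductSpace ℝ H]
    {M N s n k : ℕ} {p : Fin M → MvPolynomial (Fin d) ℝ} {Φ : EuclideanSpace ℝ (Fin d) → ℝ}
    {z : EuclideanSpace ℝ (Fin d)} {F : EuclideanSpace ℝ (Fin d) → H}
    {C S : Fin M → EuclideanSpace ℝ (Fin d) → ℝ} {a : (Fin d → ℕ) → EuclideanSpace ℝ (Fin d) → ℝ}
    {x : Fin N → EuclideanSpace ℝ (Fin d)} {w w' : Fin N → ℝ}

theorem PolyExact.sum_sub_mul_eq_zero (hw : PolyExact p k a z x w) (hw' : PolyExact p k a z x w')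
    (l : Fin M) : ∑ j, (w - w') j * polyFun (p l) (x j) = 0 := by
  simp only [Pi.sub_apply, sub_mul, Finset.sum_sub_distrib, hw l, hw' l, sub_self]

/-- Pythagoras: two exact formulas differ by weights annihilating the polynomials, and the
representer of the kernel formula is orthogonal to the corresponding combinations of feature
vectors. -/
theorem IsKernelWeights.norm_errorRepresenter_sq (hsymm : ∀ x y, Φ (x - y) = Φ (y - x))
    (h : IsSmoothFeatureMap s n (fun l => polyFun (p l)) Φ z F C S) (hk : k ≤ n)
    (hw : IsKernelWeights (fun x y => Φ (x - y)) p k a z x w) (hw' : PolyExact p k a z x w') :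
    ‖errorRepresenter k a z x w' F‖ ^ 2 = ‖errorRepresenter k a z x w F‖ ^ 2 +
      ‖∑ j, (w - w') j • F (x j)‖ ^ 2 := by
  obtain ⟨hwe, v, hv⟩ := (isKernelWeights_iff hsymm h hk).1 hw
  have h1 : errorRepresenter k a z x w' F =
      errorRepresenter k a z x w F + ∑ j, (w - w') j • F (x j) := by
    rw [← errorRepresenter_sub, sub_sub_cancel]
  have h2 : inner ℝ (errorRepresenter k a z x w F) (∑ j, (w - w') j • F (x j)) = 0 := by
    simp only [inner_sum, inner_smul_right, hv, Finset.mul_sum]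
    rw [Finset.sum_comm]
    refine Finset.sum_eq_zero fun l _ => ?_
    have h3 := hwe.sum_sub_mul_eq_zero hw' l
    calc ∑ j, (w - w') j * (v l * polyFun (p l) (x j))
        = v l * ∑ j, (w - w') j * polyFun (p l) (x j) := by
          rw [Finset.mul_sum]; exact Finset.sum_congr rfl fun j _ => by ring
      _ = 0 := by rw [h3, mul_zero]
  rw [h1, norm_add_sq_real, h2]
  ring

theorem IsKernelWeights.norm_errorRepresenter_le (hsymm : ∀ x y, Φ (x - y) = Φ (y - x))
    (h : IsSmoothFeatureMap s n (fun l => polyFun (p l)) Φ z F C S) (hk : k ≤ n)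
    (hw : IsKernelWeights (fun x y => Φ (x - y)) p k a z x w) (hw' : PolyExact p k a z x w') :
    ‖errorRepresenter k a z x w F‖ ≤ ‖errorRepresenter k a z x w' F‖ := by
  refine abs_le_of_sq_le_sq' ?_ (norm_nonneg _) |>.2
  rw [hw.norm_errorRepresenter_sq hsymm h hk hw']
  exact le_add_of_nonneg_right (sq_nonneg _)

theorem IsKernelWeights.unique (hsymm : ∀ x y, Φ (x - y) = Φ (y - x))
    (h : IsSmoothFeatureMap s n (fun l => polyFun (p l)) Φ z F C S) (hk : k ≤ n)
    (hx : Function.Injective x)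
    (hw : IsKernelWeights (fun x y => Φ (x - y)) p k a z x w)
    (hw' : IsKernelWeights (fun x y => Φ (x - y)) p k a z x w') : w = w' := by
  have h1 := hw.norm_errorRepresenter_sq hsymm h hk hw'.2
  have h2 := hw'.norm_errorRepresenter_le hsymm h hk hw.2
  have h3 : ‖∑ j, (w - w') j • F (x j)‖ ^ 2 = 0 :=
    le_antisymm (by nlinarith [norm_nonneg (errorRepresenter k a z x w' F)]) (sq_nonneg _)
  have h4 := h.indep N x hx (w - w') (hw.2.sum_sub_mul_eq_zero hw'.2)
    (by simpa using h3)
  exact sub_eq_zero.1 h4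

/-- Project the representer of any exact formula onto the orthogonal complement of the
finite-dimensional space of admissible corrections. -/
theorem exists_isKernelWeights (hsymm : ∀ x y, Φ (x - y) = Φ (y - x))
    (h : IsSmoothFeatureMap s n (fun l => polyFun (p l)) Φ z F C S) (hk : k ≤ n)
    (hw : PolyExact p k a z x w) :
    ∃ w, IsKernelWeights (fun x y => Φ (x - y)) p k a z x w := by
  let ev : Fin M → (Fin N → ℝ) →ₗ[ℝ] ℝ := fun l =>
    ∑ j, polyFun (p l) (x j) • LinearMap.proj j
  have hev : ∀ l u, ev l u = ∑ j, u j * polyFun (p l) (x j) := fun l u => by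
    simp [ev, LinearMap.sum_apply, mul_comm]
  let U₀ : Submodule ℝ (Fin N → ℝ) := ⨅ l, LinearMap.ker (ev l)
  have hU₀ : ∀ u, u ∈ U₀ ↔ ∀ l, ∑ j, u j * polyFun (p l) (x j) = 0 := fun u => by
    simp [U₀, Submodule.mem_iInf, hev]
  let T : (Fin N → ℝ) →ₗ[ℝ] H := ∑ j, (LinearMap.proj j).smulRight (F (x j))
  have hT : ∀ u, T u = ∑ j, u j • F (x j) := fun u => by
    simp [T, LinearMap.sum_apply]
  let V : Submodule ℝ H := U₀.map T
  obtain ⟨y, ⟨u, hu, rfl⟩, g, hg, hsum⟩ :=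
    V.exists_add_mem_mem_orthogonal (errorRepresenter k a z x w F)
  refine ⟨w + u, (isKernelWeights_iff hsymm h hk).2 ⟨fun l => ?_, ?_⟩⟩
  · simp only [Pi.add_apply, add_mul, Finset.sum_add_distrib, (hU₀ u).1 hu l, hw l, add_zero]
  · have h1 : errorRepresenter k a z x (w + u) F = g := by
      have h2 := errorRepresenter_sub (k := k) a z x w (-u) F
      rw [sub_neg_eq_add] at h2
      rw [h2, hsum, hT]
      simp only [Pi.neg_apply, neg_smul, Finset.sum_neg_distrib]
      abel
    rw [h1]
    let φ : (Fin N → ℝ) →ₗ[ℝ] ℝ := (innerSL ℝ g).toLinearMap.comp T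
    -- Lagrange multipliers: a functional vanishing on the common kernel of the constraints is a
    -- combination of them, and its coefficients are v.
    have h3 : φ ∈ Submodule.span ℝ (Set.range ev) := by
      refine mem_span_of_iInf_ker_le_ker fun u' hu' => ?_
      have := (Submodule.mem_orthogonal' _ _).1 hg (T u') (Submodule.mem_map_of_mem hu')
      exact this
    obtain ⟨v, hv⟩ := (Submodule.mem_span_range_iff_exists_fun ℝ).1 h3
    refine ⟨v, fun i => ?_⟩
    have h4 := congrArg (fun ψ : (Fin N → ℝ) →ₗ[ℝ] ℝ => ψ (Pi.single i 1)) hv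
    simp only [LinearMap.sum_apply, LinearMap.smul_apply, smul_eq_mul, hev] at h4
    have h5 : φ (Pi.single i 1) = inner ℝ g (F (x i)) := by
      simp [φ, hT, Pi.single_apply]
    rw [h5] at h4
    rw [← h4]
    simp [Pi.single_apply]

end Weights

/-! ### The power function on formulas that are exact for polynomials -/

theorem taylorRemainder_kernel_eq {n : ℕ} {Φ : E → ℝ} (hΦ : ContDiff ℝ n Φ) (z y x : E) :
    taylorRemainder n z (fun x' => Φ (x' - y)) x = Φ (x - y) -
      ∑ m ∈ Finset.range (n + 1), (m.factorial : ℝ)⁻¹ *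
        dirDeriv (List.replicate m (x - z)) Φ (z - y) := by
  rw [taylorRemainder]
  congr 1
  refine Finset.sum_congr rfl fun m hm => ?_
  rw [iteratedFDeriv_comp_sub, iteratedFDeriv_const_eq_dirDeriv isOpen_univ
    (hΦ.contDiffOn.of_le (by
      have : m ≤ n := by simp at hm; omega
      exact_mod_cast this)) _ (Set.mem_univ _)]
  ring

theorem iteratedFDeriv_comp_const_sub_const {U : Set E} (hU : IsOpen U) {f : E → ℝ} {l : ℕ}
    (hf : ContDiffOn ℝ (l : ℕ∞) f U) {c y : E} (hy : c - y ∈ U) (v : E) :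
    iteratedFDeriv ℝ l (fun y => f (c - y)) y (fun _ => v) =
      dirDeriv (List.replicate l (-v)) f (c - y) := by
  have hc : Continuous fun y : E => c - y := by fun_prop
  rw [iteratedFDeriv_const_eq_dirDeriv (hU.preimage hc) ?_ v hy, dirDeriv_comp_const_sub]
  exact hf.comp (s := (fun y : E => c - y) ⁻¹' U) (by fun_prop) fun y hy => hy

theorem contDiffAt_taylorRemainder_kernel {n : ℕ} {Φ : E → ℝ} (hΦ : ContDiff ℝ n Φ) {R : ℝ}
    (hR : 0 < R) (hΦ' : ContDiffOn ℝ ((2 * n : ℕ) : ℕ∞) Φ (Metric.ball 0 R)) (z x : E) :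
    ContDiffAt ℝ n (fun y => taylorRemainder n z (fun x' => Φ (x' - y)) x) z := by
  simp only [taylorRemainder_kernel_eq hΦ]
  refine ContDiffAt.sub ?_ (ContDiffAt.sum fun m hm => contDiffAt_const.mul ?_)
  · exact (hΦ.comp (by fun_prop : ContDiff ℝ n fun y : E => x - y)).contDiffAt
  · have h1 : ContDiffOn ℝ (n : ℕ∞) (dirDeriv (List.replicate m (x - z)) Φ) (Metric.ball 0 R) := by
      refine ContDiffOn.dirDeriv Metric.isOpen_ball _ (hΦ'.of_le ?_)
      have : (List.replicate m (x - z)).length + n ≤ 2 * n := by simp at hm ⊢; omega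
      exact_mod_cast this
    have h2 : ContDiffAt ℝ n (dirDeriv (List.replicate m (x - z)) Φ) (z - z) :=
      h1.contDiffAt (Metric.isOpen_ball.mem_nhds (by simpa using hR))
    exact ContDiffAt.comp z h2 (by fun_prop)

/-- Here x - x' = (x - z) + (z - x'). Expanding in the second argument of Φ(x - y) reverses the
direction x' - z, so the two Taylor directions are x - z and z - x', and the mixed derivatives are
taken at 0. -/
theorem taylorRemainder_taylorRemainder_kernel {n : ℕ} {Φ : E → ℝ} (hΦ : ContDiff ℝ n Φ) {R : ℝ}
    (hR : 0 < R) (hΦ' : ContDiffOn ℝ ((2 * n : ℕ) : ℕ∞) Φ (Metric.ball 0 R)) (z x x' : E) :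
    taylorRemainder n z (fun y => taylorRemainder n z (fun x' => Φ (x' - y)) x) x' =
      doubleRemainder n Φ (x - z) (z - x') := by
  have hm' : ∀ m ≤ n, ContDiffOn ℝ (n : ℕ∞) (dirDeriv (List.replicate m (x - z)) Φ)
      (Metric.ball 0 R) := fun m hm => by
    refine ContDiffOn.dirDeriv Metric.isOpen_ball _ (hΦ'.of_le ?_)
    have : (List.replicate m (x - z)).length + n ≤ 2 * n := by simp; omega
    exact_mod_cast this
  have hz0 : z - z ∈ Metric.ball (0 : E) R := by simpa using hR
  rw [taylorRemainder]
  simp only [taylorRemainder_kernel_eq hΦ]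
  have hder : ∀ l ≤ n, iteratedFDeriv ℝ l (fun y => Φ (x - y) -
      ∑ m ∈ Finset.range (n + 1), (m.factorial : ℝ)⁻¹ *
        dirDeriv (List.replicate m (x - z)) Φ (z - y)) z (fun _ => x' - z) =
      dirDeriv (List.replicate l (z - x')) Φ (x - z) -
        ∑ m ∈ Finset.range (n + 1), (m.factorial : ℝ)⁻¹ *
          dirDeriv (List.replicate l (z - x') ++ List.replicate m (x - z)) Φ 0 := by
    intro l hl
    have hl' : (l : WithTop ℕ∞) ≤ n := by exact_mod_cast hl
    have h1 : ContDiffAt ℝ l (fun y => Φ (x - y)) z :=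
      ((hΦ.comp (by fun_prop : ContDiff ℝ n fun y : E => x - y)).contDiffAt).of_le hl'
    have h2 : ∀ m ∈ Finset.range (n + 1), ContDiffAt ℝ l (fun y =>
        dirDeriv (List.replicate m (x - z)) Φ (z - y)) z := fun m hm => by
      have h3 : ContDiffAt ℝ n (dirDeriv (List.replicate m (x - z)) Φ) (z - z) :=
        (hm' m (by simp at hm; omega)).contDiffAt (Metric.isOpen_ball.mem_nhds hz0)
      exact (ContDiffAt.comp z h3 (by fun_prop)).of_le hl'
    rw [fun_iteratedFDeriv_sub_apply h1 (ContDiffAt.sum fun m hm => contDiffAt_const.mul (h2 m hm)),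
      iteratedFDeriv_fun_sum_apply fun m hm => contDiffAt_const.mul (h2 m hm)]
    simp only [sub_apply, sum_apply]
    rw [iteratedFDeriv_comp_const_sub_const isOpen_univ (hΦ.contDiffOn.of_le hl')
      (Set.mem_univ _), neg_sub]
    congr 1
    refine Finset.sum_congr rfl fun m hm => ?_
    have h4 := iteratedFDeriv_const_smul_apply' (a := (m.factorial : ℝ)⁻¹) (h2 m hm)
    simp only [smul_eq_mul] at h4
    rw [h4, smul_apply, smul_eq_mul, iteratedFDeriv_comp_const_sub_const Metric.isOpen_ball
      ((hm' m (by simp at hm; omega)).of_le hl') hz0, neg_sub, dirDeriv_append, sub_self]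
  have hsum : ∑ l ∈ Finset.range (n + 1), iteratedFDeriv ℝ l (fun y => Φ (x - y) -
      ∑ m ∈ Finset.range (n + 1), (m.factorial : ℝ)⁻¹ *
        dirDeriv (List.replicate m (x - z)) Φ (z - y)) z (fun _ => x' - z) / l.factorial =
      ∑ l ∈ Finset.range (n + 1), (dirDeriv (List.replicate l (z - x')) Φ (x - z) -
        ∑ m ∈ Finset.range (n + 1), (m.factorial : ℝ)⁻¹ *
          dirDeriv (List.replicate l (z - x') ++ List.replicate m (x - z)) Φ 0) / l.factorial :=
    Finset.sum_congr rfl fun l hl => by rw [hder l (by simp at hl; omega)]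
  rw [hsum, doubleRemainder]
  simp only [sub_div, Finset.sum_sub_distrib, Finset.sum_div]
  have h6 : x - z + (z - x') = x - x' := by abel
  rw [h6, Finset.sum_comm]
  have h7 : ∀ m l : ℕ, (m.factorial : ℝ)⁻¹ *
      dirDeriv (List.replicate l (z - x') ++ List.replicate m (x - z)) Φ 0 / l.factorial =
      dirDeriv (List.replicate l (z - x') ++ List.replicate m (x - z)) Φ 0 / l.factorial /
        m.factorial := fun m l => by ring
  have h8 := Finset.sum_congr (s₁ := Finset.range (n + 1)) rfl fun m _ =>
    Finset.sum_congr (s₁ := Finset.range (n + 1)) rfl fun l _ => h7 m l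
  rw [h8]
  simp only [inv_mul_eq_div]
  ring

/-- ‖e_w‖² is the error of y ↦ ⟨F y, e_w⟩, which is, up to a polynomial that is integrated exactly,
the error of the kernel in its first argument. Exactness of degree n replaces both errors by sums of
Taylor remainders. -/
theorem IsSmoothFeatureMap.norm_errorRepresenter_sq {H : Type*} [NormedAddCommGroup H]
    [InnerProductSpace ℝ H] {M N s n k : ℕ} {P : Fin M → E → ℝ} {Φ : E → ℝ} {z : E} {F : E → H}
    {C S : Fin M → E → ℝ} {a : (Fin d → ℕ) → E → ℝ} {x : Fin N → E} {w : Fin N → ℝ}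
    (h : IsSmoothFeatureMap s n P Φ z F C S) (hk : k ≤ n) {R : ℝ}
    (hR : 0 < R) (hΦ' : ContDiffOn ℝ ((2 * n : ℕ) : ℕ∞) Φ (Metric.ball 0 R))
    (hw : ∀ l, formulaError k a z x w (P l) = 0)
    (hwn : ∀ q ∈ polySpace d (n + 1), formulaError k a z x w (polyFun q) = 0) :
    ‖errorRepresenter k a z x w F‖ ^ 2 =
      ∑ i, ∑ j, w i * w j * doubleRemainder n Φ (x i - z) (z - x j) := by
  have hk' : (k : WithTop ℕ∞) ≤ n := by exact_mod_cast hk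
  have hΦ := h.contDiff_kernel
  set Re : H := errorRepresenter k a z x w F with hRe
  set T : Fin N → E → ℝ := fun i y => taylorRemainder n z (fun x' => Φ (x' - y)) (x i) with hT
  have hTc : ∀ i, ContDiffAt ℝ n (T i) z := fun i =>
    contDiffAt_taylorRemainder_kernel hΦ hR hΦ' z (x i)
  have h1 : ∀ y, inner ℝ (F y) Re = (∑ i, (-w i) * T i y) +
      ∑ l, (-formulaError k a z x w (S l)) * P l y := by
    intro y
    have h2 := h.formulaError_kernel hk hw y
    rw [formulaError_eq_sum_taylorRemainder hk hwn (h.contDiffAt_kernel y)] at h2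
    rw [real_inner_comm]
    simp only [neg_mul, Finset.sum_neg_distrib]
    simp only [mul_comm (P _ y)] at h2
    linarith
  have hP := fun l => (h.contDiffAt_poly l).of_le hk'
  have hTk := fun i => (hTc i).of_le hk'
  rw [← real_inner_self_eq_norm_sq]
  conv_lhs => rw [hRe]
  rw [← formulaError_inner (h.contDiffAt.of_le hk'), funext h1,
    formulaError_add (ContDiffAt.sum fun i _ => contDiffAt_const.mul (hTk i))
      (ContDiffAt.sum fun l _ => contDiffAt_const.mul (hP l)),
    formulaError_sum _ (fun i _ => contDiffAt_const.mul (hTk i)),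
    formulaError_sum _ (fun l _ => contDiffAt_const.mul (hP l))]
  simp only [formulaError_const_mul (hP _), formulaError_const_mul (hTk _), hw, mul_zero,
    Finset.sum_const_zero, add_zero]
  refine Finset.sum_congr rfl fun i _ => ?_
  rw [formulaError_eq_sum_taylorRemainder hk hwn (hTc i), neg_mul_neg, Finset.mul_sum]
  refine Finset.sum_congr rfl fun j _ => ?_
  rw [hT, taylorRemainder_taylorRemainder_kernel hΦ hR hΦ']
  ring

theorem IsSmoothFeatureMap.norm_errorRepresenter_le {H : Type*} [NormedAddCommGroup H]
    [InnerProductSpace ℝ H] {M N s r k : ℕ} {P : Fin M → E → ℝ} {Φ : E → ℝ} {z : E} {F : E → H}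
    {C S : Fin M → E → ℝ} {a : (Fin d → ℕ) → E → ℝ} {x : Fin N → E} {w : Fin N → ℝ}
    (h : IsSmoothFeatureMap s (r / 2) P Φ z F C S) (hk : k ≤ r / 2) {R γ ρ : ℝ} (hγ : 0 < γ)
    (hR : 0 < R) (hΦ : MemHolderClass r γ (Metric.closedBall 0 R) Φ)
    (hw : ∀ l, formulaError k a z x w (P l) = 0)
    (hwn : ∀ q ∈ polySpace d (r / 2 + 1), formulaError k a z x w (polyFun q) = 0)
    (hx : ∀ i j, ∀ t ∈ Set.Icc (0 : ℝ) 1, ∀ u ∈ Set.Icc (0 : ℝ) 1,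
      ‖t • (x i - z) + u • (z - x j)‖ ≤ R)
    (hρ : ∑ j, |w j| * ‖x j - z‖ ^ (((r : ℝ) + γ) / 2) ≤ ρ) :
    ‖errorRepresenter k a z x w F‖ ≤ ρ * √(holderConst d r γ *
      (holderSeminorm r γ (Metric.closedBall 0 R) Φ).toReal) := by
  have hΦ' : ContDiffOn ℝ ((2 * (r / 2) : ℕ) : ℕ∞) Φ (Metric.ball 0 R) :=
    (hΦ.1.mono Metric.ball_subset_closedBall).of_le
      (by exact_mod_cast (by omega : 2 * (r / 2) ≤ r))
  set μ := ((r : ℝ) + γ) / 2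
  set A := holderConst d r γ * (holderSeminorm r γ (Metric.closedBall 0 R) Φ).toReal with hA
  have hsum0 : 0 ≤ ∑ j, |w j| * ‖x j - z‖ ^ μ := Finset.sum_nonneg fun j _ => by positivity
  have hC0 : 0 ≤ holderConst d r γ := by
    unfold holderConst
    split_ifs
    · exact div_nonneg (by positivity) (Finset.prod_nonneg fun j _ => by positivity)
    · exact div_nonneg (by positivity) (Finset.prod_nonneg fun j _ => by positivity)
  have hA0 : 0 ≤ A := mul_nonneg hC0 ENNReal.toReal_nonneg
  have h1 : ‖errorRepresenter k a z x w F‖ ^ 2 ≤ A * (∑ j, |w j| * ‖x j - z‖ ^ μ) ^ 2 := by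
    rw [h.norm_errorRepresenter_sq hk hR hΦ' hw hwn, sq (∑ j, |w j| * ‖x j - z‖ ^ μ),
      Finset.sum_mul_sum, Finset.mul_sum]
    refine Finset.sum_le_sum fun i _ => ?_
    rw [Finset.mul_sum]
    refine Finset.sum_le_sum fun j _ => ?_
    have h2 := abs_doubleRemainder_le_holderSeminorm hγ hR hΦ h.contDiff_kernel (hx i j)
    refine (le_abs_self _).trans ?_
    rw [abs_mul, abs_mul]
    refine (mul_le_mul_of_nonneg_left h2 (by positivity)).trans (le_of_eq ?_)
    rw [norm_sub_rev z (x j)]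
    ring
  have h3 : ‖errorRepresenter k a z x w F‖ ≤ (∑ j, |w j| * ‖x j - z‖ ^ μ) * √A := by
    refine abs_le_of_sq_le_sq' ?_ (by positivity) |>.2
    rw [mul_pow, Real.sq_sqrt hA0]
    linarith
  exact h3.trans (mul_le_mul_of_nonneg_right hρ (Real.sqrt_nonneg _))

end Smooth

section ErrorBound

variable {d : ℕ}

local notation "E" => EuclideanSpace ℝ (Fin d)

/-! ### The growth function and exact formulas -/

instance polySpace_finite (s : ℕ) : Module.Finite ℝ (polySpace d s) := by
  have hfin : {n : Fin d →₀ ℕ | n.degree < s}.Finite := by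
    refine Set.Finite.subset (Finset.finite_toSet
      ((Finset.Icc (0 : Fin d →₀ ℕ) (Finsupp.equivFunOnFinite.symm fun _ => s)))) fun n hn => ?_
    simp only [Finset.coe_Icc, Set.mem_Icc, zero_le, true_and]
    intro i
    have h1 : n i ≤ n.degree := Finsupp.le_degree i n
    have h2 : n.degree < s := hn
    simp only [Finsupp.equivFunOnFinite_symm_apply_apply]
    omega
  have := hfin.to_subtype
  exact Module.Finite.of_basis (MvPolynomial.basisRestrictSupport ℝ {n : Fin d →₀ ℕ | n.degree < s})

variable {N k q : ℕ} {a : (Fin d → ℕ) → EuclideanSpace ℝ (Fin d) → ℝ}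
  {z : EuclideanSpace ℝ (Fin d)} {x : Fin N → EuclideanSpace ℝ (Fin d)} {w : Fin N → ℝ} {μ : ℝ}

theorem exists_weights_of_growthFunction_ne_top (h : growthFunction q k a z x μ ≠ ∞) :
    ∃ w : Fin N → ℝ, (∀ p ∈ polySpace d q, formulaError k a z x w (polyFun p) = 0) ∧
      ∑ j, |w j| * ‖x j - z‖ ^ μ ≤ (growthFunction q k a z x μ).toReal := by
  let L : polySpace d q →ₗ[ℝ] ℝ :=
    { toFun := fun p => diffOp k a (polyFun (p : MvPolynomial (Fin d) ℝ)) z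
      map_add' := fun p p' => by
        rw [Submodule.coe_add, polyFun_add]
        exact diffOp_add (contDiff_polyFun _).contDiffAt (contDiff_polyFun _).contDiffAt
      map_smul' := fun c p => by
        rw [Submodule.coe_smul, polyFun_smul]
        exact diffOp_const_mul (contDiff_polyFun _).contDiffAt c }
  let ℓ : Fin N → polySpace d q →ₗ[ℝ] ℝ := fun j =>
    (LinearMap.proj (x j)).comp ((polyFunₗ d).comp (polySpace d q).subtype)
  obtain ⟨w, hw, hsum⟩ := exists_weights_of_le L ℓ (δ := fun j => ‖x j - z‖ ^ μ)
    (fun j => by positivity) (ρ := (growthFunction q k a z x μ).toReal) ENNReal.toReal_nonneg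
    fun p hp => by
      refine (ENNReal.ofReal_le_iff_le_toReal h).1 ?_
      exact le_iSup₂_of_le (p : MvPolynomial (Fin d) ℝ) p.2 (le_iSup_of_le hp le_rfl)
  exact ⟨w, fun p hp => sub_eq_zero.2 (hw ⟨p, hp⟩), hsum⟩

theorem growthFunction_le_of_exact
    (hw : ∀ p ∈ polySpace d q, formulaError k a z x w (polyFun p) = 0) :
    growthFunction q k a z x μ ≤ ENNReal.ofReal (∑ j, |w j| * ‖x j - z‖ ^ μ) := by
  refine iSup₂_le fun p hp => iSup_le fun h => ENNReal.ofReal_le_ofReal ?_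
  rw [sub_eq_zero.1 (hw p hp)]
  refine Finset.sum_le_sum fun j _ => (le_abs_self _).trans ?_
  rw [abs_mul]
  exact mul_le_mul_of_nonneg_left (h j) (abs_nonneg _)

/-- Formulas for the homogeneous parts of an operator give formulas for the operator on scaled
points. -/
theorem exists_weights_scalePoints {W : ℕ → Fin N → ℝ}
    (hW : ∀ i ≤ k, ∀ p ∈ polySpace d q,
      formulaError k (homogeneousPart a i) z x (W i) (polyFun p) = 0)
    {h : ℝ} (h0 : 0 < h) (h1 : h ≤ 1) :
    ∃ w : Fin N → ℝ,
      (∀ p ∈ polySpace d q, formulaError k a z (scalePoints z x h) w (polyFun p) = 0) ∧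
      ∑ j, |w j| * ‖scalePoints z x h j - z‖ ^ μ ≤
        h ^ (μ - k) * ∑ i ∈ Finset.range (k + 1), ∑ j, |W i j| * ‖x j - z‖ ^ μ := by
  -- Rescaling a polynomial by h multiplies the i-th homogeneous part of the operator by h^i, which
  -- the factor h^{-i} undoes.
  refine ⟨fun j => ∑ i ∈ Finset.range (k + 1), (h ^ i)⁻¹ * W i j, fun p hp => ?_, ?_⟩
  · obtain ⟨p', hp', hpp⟩ := exists_polyFun_comp_scale z h hp
    rw [formulaError, sub_eq_zero, diffOp_eq_sum_homogeneousPart]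
    simp only [Finset.sum_mul]
    rw [Finset.sum_comm]
    refine Finset.sum_congr rfl fun i hi => ?_
    have h2 := hW i (Nat.lt_succ_iff.1 (Finset.mem_range.1 hi)) p' hp'
    rw [funext hpp, formulaError, sub_eq_zero,
      diffOp_homogeneousPart_comp_scale (contDiff_polyFun p)] at h2
    have h3 : h ^ i ≠ 0 := pow_ne_zero _ h0.ne'
    simp only [mul_assoc, ← Finset.mul_sum]
    rw [eq_inv_mul_iff_mul_eq₀ h3, h2]
    rfl
  · rw [Finset.sum_comm, Finset.mul_sum]
    refine Finset.sum_le_sum fun j _ => ?_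
    have h2 : ‖scalePoints z x h j - z‖ ^ μ = h ^ μ * ‖x j - z‖ ^ μ := by
      rw [scalePoints, add_sub_cancel_left, norm_smul, Real.norm_of_nonneg h0.le,
        Real.mul_rpow h0.le (norm_nonneg _)]
    have h3 : |∑ i ∈ Finset.range (k + 1), (h ^ i)⁻¹ * W i j| ≤
        ∑ i ∈ Finset.range (k + 1), (h ^ i)⁻¹ * |W i j| := by
      refine (Finset.abs_sum_le_sum_abs _ _).trans (Finset.sum_le_sum fun i _ => ?_)
      rw [abs_mul, abs_of_nonneg (by positivity)]
    rw [h2]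
    refine (mul_le_mul_of_nonneg_right h3 (by positivity)).trans ?_
    rw [Finset.sum_mul, Finset.mul_sum]
    refine Finset.sum_le_sum fun i hi => ?_
    have h4 : h ^ μ * (h ^ i)⁻¹ ≤ h ^ (μ - k) := by
      rw [← Real.rpow_natCast, ← Real.rpow_neg h0.le, ← Real.rpow_add h0]
      refine Real.rpow_le_rpow_of_exponent_ge h0 h1 ?_
      have : (i : ℝ) ≤ k := by exact_mod_cast Nat.lt_succ_iff.1 (Finset.mem_range.1 hi)
      linarith
    calc (h ^ i)⁻¹ * |W i j| * (h ^ μ * ‖x j - z‖ ^ μ)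
        = (h ^ μ * (h ^ i)⁻¹) * (|W i j| * ‖x j - z‖ ^ μ) := by ring
      _ ≤ _ := mul_le_mul_of_nonneg_right h4 (by positivity)

/-! ### Geometry of the star of segments -/

theorem bddAbove_norm_sub (z : E) (x : Fin N → E) : BddAbove (Set.range fun j => ‖z - x j‖) :=
  Set.finite_range _ |>.bddAbove

theorem radiusAt_pos (hxz : ∃ j, x j ≠ z) : 0 < radiusAt z x := by
  obtain ⟨j, hj⟩ := hxz
  exact (norm_pos_iff.2 (sub_ne_zero.2 hj.symm)).trans_le (le_ciSup (bddAbove_norm_sub z x) j)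

theorem radiusAt_scalePoints {h : ℝ} (h0 : 0 ≤ h) :
    radiusAt z (scalePoints z x h) = h * radiusAt z x := by
  rw [radiusAt, radiusAt, Real.mul_iSup_of_nonneg h0]
  refine iSup_congr fun j => ?_
  rw [scalePoints, sub_add_cancel_left, norm_neg, norm_smul, Real.norm_of_nonneg h0, norm_sub_rev]

theorem isBounded_starSet (z : E) (x : Fin N → E) : Bornology.IsBounded (starSet z x) := by
  rw [starSet, Bornology.isBounded_iUnion]
  intro i
  rw [← convexHull_pair, isBounded_convexHull]
  exact (Set.toFinite _).isBounded

theorem add_smul_mem_starSet (i : Fin N) {t : ℝ} (ht : t ∈ Set.Icc (0 : ℝ) 1) :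
    z + t • (x i - z) ∈ starSet z x := by
  refine Set.mem_iUnion.2 ⟨i, ?_⟩
  rw [segment_eq_image']
  exact ⟨t, ht, rfl⟩

theorem diam_starSet_pos (hxz : ∃ j, x j ≠ z) : 0 < Metric.diam (starSet z x) := by
  obtain ⟨j, hj⟩ := hxz
  refine (dist_pos.2 hj).trans_le (Metric.dist_le_diam_of_mem (isBounded_starSet z x) ?_ ?_)
  · simpa using add_smul_mem_starSet (z := z) (x := x) j (t := 1) (by simp)
  · simpa using add_smul_mem_starSet (z := z) (x := x) j (t := 0) (by simp)

theorem norm_add_smul_le_diam_starSet (i j : Fin N) {t u : ℝ} (ht : t ∈ Set.Icc (0 : ℝ) 1)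
    (hu : u ∈ Set.Icc (0 : ℝ) 1) :
    ‖t • (x i - z) + u • (z - x j)‖ ≤ Metric.diam (starSet z x) := by
  have h := Metric.dist_le_diam_of_mem (isBounded_starSet z x)
    (add_smul_mem_starSet (z := z) i ht) (add_smul_mem_starSet (z := z) j hu)
  rw [dist_eq_norm] at h
  have h1 : t • (x i - z) + u • (z - x j) = z + t • (x i - z) - (z + u • (x j - z)) := by
    rw [smul_sub u, smul_sub u]
    abel
  rwa [h1]

/-! ### The error bound -/

theorem HasNativeSeminorm.nonneg {K : E → E → ℝ} {s : ℕ} {f : E → ℝ} {t : ℝ}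
    (h : HasNativeSeminorm K s f t) : 0 ≤ t := by
  obtain ⟨c, p, -, -, -, -, ht⟩ := h
  exact ge_of_tendsto' ht fun n => Real.sqrt_nonneg _

theorem nativeSeminorm_nonneg {K : E → E → ℝ} {s : ℕ} (f : E → ℝ) : 0 ≤ nativeSeminorm K s f :=
  Real.sInf_nonneg fun _ ht => ht.nonneg

/-- A bound valid for every admissible t passes to the infimum, so uniqueness of the semi-norm value
is not needed. -/
theorem le_mul_nativeSeminorm {K : E → E → ℝ} {s : ℕ} {f : E → ℝ} (hf : f ∈ nativeSpace K s)
    {b c : ℝ} (hc : 0 ≤ c) (h : ∀ t, HasNativeSeminorm K s f t → b ≤ c * t) :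
    b ≤ c * nativeSeminorm K s f := by
  obtain ⟨t₀, ht₀⟩ := hf
  rcases hc.eq_or_lt with rfl | hc
  · simpa using h t₀ ht₀
  · rw [← div_le_iff₀' hc]
    exact le_csInf ⟨t₀, ht₀⟩ fun t ht => (div_le_iff₀' hc).2 (h t ht)

variable {H : Type*} [NormedAddCommGroup H] [InnerProductSpace ℝ H] {s r M : ℕ} {γ : ℝ}
  {p : Module.Basis (Fin M) ℝ (polySpace d s)} {Φ : EuclideanSpace ℝ (Fin d) → ℝ}
  {F : EuclideanSpace ℝ (Fin d) → H} {C S : Fin M → EuclideanSpace ℝ (Fin d) → ℝ} {R : ℝ}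

theorem PolyExact.of_forall_polySpace {p : Fin M → polySpace d s} (hsq : s ≤ q)
    (hw : ∀ p ∈ polySpace d q, formulaError k a z x w (polyFun p) = 0) :
    PolyExact (fun i => (p i : MvPolynomial (Fin d) ℝ)) k a z x w :=
  polyExact_iff.2 fun l => hw _ (polySpace_mono hsq (p l).2)

theorem IsKernelWeights.abs_sub_le_norm_mul_nativeSeminorm
    (h : IsSmoothFeatureMap s (r / 2) (fun l => polyFun (p l : MvPolynomial (Fin d) ℝ)) Φ z F C S)
    (hk : k ≤ r / 2)
    (hw : IsKernelWeights (fun x y => Φ (x - y)) (fun i => (p i : MvPolynomial (Fin d) ℝ))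
      k a z x w) {f : E → ℝ} (hf : f ∈ nativeSpace (fun x y => Φ (x - y)) s) :
    |diffOp k a f z - ∑ j, w j * f (x j)| ≤
      ‖errorRepresenter k a z x w F‖ * nativeSeminorm (fun x y => Φ (x - y)) s f :=
  le_mul_nativeSeminorm hf (norm_nonneg _) fun _ ht =>
    h.formulaError_native_le hk (polyExact_iff.1 hw.2) ht

/-- The error of the kernel-based formula is bounded by means of any formula that is exact for
polynomials. -/
theorem IsKernelWeights.abs_sub_le_of_exact (hsymm : ∀ x y, Φ (x - y) = Φ (y - x))
    (h : IsSmoothFeatureMap s (r / 2) (fun l => polyFun (p l : MvPolynomial (Fin d) ℝ)) Φ z F C S)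
    (hk : k ≤ r / 2) (hγ : 0 < γ) (hR : 0 < R)
    (hΦ : MemHolderClass r γ (Metric.closedBall 0 R) Φ)
    (hx : ∀ i j, ∀ t ∈ Set.Icc (0 : ℝ) 1, ∀ u ∈ Set.Icc (0 : ℝ) 1,
      ‖t • (x i - z) + u • (z - x j)‖ ≤ R)
    (hw : IsKernelWeights (fun x y => Φ (x - y)) (fun i => (p i : MvPolynomial (Fin d) ℝ))
      k a z x w) {w' : Fin N → ℝ} {ρ : ℝ}
    (hw' : ∀ p ∈ polySpace d (max s (r / 2 + 1)), formulaError k a z x w' (polyFun p) = 0)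
    (hρ : ∑ j, |w' j| * ‖x j - z‖ ^ (((r : ℝ) + γ) / 2) ≤ ρ) {f : E → ℝ}
    (hf : f ∈ nativeSpace (fun x y => Φ (x - y)) s) :
    |diffOp k a f z - ∑ j, w j * f (x j)| ≤
      ρ * √(holderConst d r γ * (holderSeminorm r γ (Metric.closedBall 0 R) Φ).toReal) *
        nativeSeminorm (fun x y => Φ (x - y)) s f := by
  have hp : PolyExact (fun i => (p i : MvPolynomial (Fin d) ℝ)) k a z x w' :=
    .of_forall_polySpace (le_max_left _ _) hw'
  refine (hw.abs_sub_le_norm_mul_nativeSeminorm h hk hf).trans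
    (mul_le_mul_of_nonneg_right ?_ (nativeSeminorm_nonneg f))
  exact (hw.norm_errorRepresenter_le hsymm h hk hp).trans
    (h.norm_errorRepresenter_le hk hγ hR hΦ (polyExact_iff.1 hp)
      (fun q hq => hw' q (polySpace_mono (le_max_right _ _) hq)) hx hρ)

/-- A ball in positive dimension contains more points than the dimension of the dual of Π^d_q, so
some evaluations are linearly dependent. -/
theorem exists_ne_zero_forall_polyFun_sum_eq_zero (hd : 0 < d) (z : E) (hR : 0 < R) (q : ℕ) :
    ∃ (N : ℕ) (y : Fin N → E) (w : Fin N → ℝ), Function.Injective y ∧ w ≠ 0 ∧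
      (∀ j, ‖y j - z‖ < R) ∧ ∀ p ∈ polySpace d q, ∑ j, w j * polyFun p (y j) = 0 := by
  have : Nonempty (Fin d) := ⟨⟨0, hd⟩⟩
  have hinf : (Metric.ball z R).Infinite := infinite_of_mem_nhds z (Metric.ball_mem_nhds z hR)
  set m := Module.finrank ℝ (Module.Dual ℝ (polySpace d q)) with hm
  let y : Fin (m + 1) → E := fun j => hinf.natEmbedding _ (j : ℕ)
  let ev : E → Module.Dual ℝ (polySpace d q) := fun ξ =>
    (LinearMap.proj ξ).comp ((polyFunₗ d).comp (polySpace d q).subtype)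
  have hdep : ¬ LinearIndependent ℝ fun j => ev (y j) := fun hli => by
    have := hli.fintype_card_le_finrank
    rw [Fintype.card_fin] at this
    omega
  obtain ⟨w, hw, j, hj⟩ := Fintype.not_linearIndependent_iff.1 hdep
  refine ⟨m + 1, y, w, fun i j hij => ?_, fun h0 => hj (congrFun h0 j), fun j => ?_,
    fun p hp => ?_⟩
  · exact Fin.ext ((hinf.natEmbedding _).injective (Subtype.ext hij))
  · rw [← dist_eq_norm]
    exact (hinf.natEmbedding _ (j : ℕ)).2
  · have h1 := congrArg (fun φ : Module.Dual ℝ (polySpace d q) => φ ⟨p, hp⟩) hw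
    simpa [LinearMap.sum_apply, ev, polyFunₗ_apply] using h1

/-- The Hölder semi-norm of a conditionally positive definite function does not vanish. -/
theorem IsSmoothFeatureMap.holderSeminorm_ne_zero
    (h : IsSmoothFeatureMap s (r / 2) (fun l => polyFun (p l : MvPolynomial (Fin d) ℝ)) Φ z F C S)
    (hd : 0 < d) (hγ : 0 < γ) (hR : 0 < R)
    (hΦ : MemHolderClass r γ (Metric.closedBall 0 R) Φ) :
    holderSeminorm r γ (Metric.closedBall 0 R) Φ ≠ 0 := by
  intro h0
  obtain ⟨N, y, w, hy, hw0, hyz, hw⟩ :=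
    exists_ne_zero_forall_polyFun_sum_eq_zero hd z (half_pos hR) (max s (r / 2 + 1))
  -- The annihilating weights form an exact formula for the zero operator. If the semi-norm were
  -- zero, its representer -∑ w_j F(y_j) would vanish, against the independence of the feature
  -- vectors.
  have herr : ∀ p ∈ polySpace d (max s (r / 2 + 1)), formulaError 0 0 z y w (polyFun p) = 0 :=
    fun p hp => by simp [formulaError, diffOp, hw p hp]
  have h1 := h.norm_errorRepresenter_le (k := 0) (a := 0) (x := y) (w := w) (Nat.zero_le _) hγ hR hΦ
    (fun l => herr _ (polySpace_mono (le_max_left _ _) (p l).2))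
    (fun q hq => herr q (polySpace_mono (le_max_right _ _) hq))
    (fun i j t ht u hu => by
      have h2 : ‖t • (y i - z)‖ ≤ R / 2 := by
        rw [norm_smul, Real.norm_of_nonneg ht.1]
        exact (mul_le_of_le_one_left (norm_nonneg _) ht.2).trans (hyz i).le
      have h3 : ‖u • (z - y j)‖ ≤ R / 2 := by
        rw [norm_smul, Real.norm_of_nonneg hu.1, norm_sub_rev]
        exact (mul_le_of_le_one_left (norm_nonneg _) hu.2).trans (hyz j).le
      linarith [norm_add_le (t • (y i - z)) (u • (z - y j))]) le_rfl
  rw [h0, ENNReal.toReal_zero, mul_zero, Real.sqrt_zero, mul_zero] at h1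
  have h2 : ∑ j, w j • F (y j) = 0 := by
    simpa [errorRepresenter] using norm_le_zero_iff.1 h1
  exact hw0 (h.indep N y hy w (fun l => hw _ (polySpace_mono (le_max_left _ _) (p l).2)) h2)

theorem IsKernelWeights.ofReal_abs_sub_le (hsymm : ∀ x y, Φ (x - y) = Φ (y - x))
    (h : IsSmoothFeatureMap s (r / 2) (fun l => polyFun (p l : MvPolynomial (Fin d) ℝ)) Φ z F C S)
    (hk : k ≤ r / 2) (hd : 0 < d) (hγ : 0 < γ) (hR : 0 < R)
    (hΦ : MemHolderClass r γ (Metric.closedBall 0 R) Φ)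
    (hx : ∀ i j, ∀ t ∈ Set.Icc (0 : ℝ) 1, ∀ u ∈ Set.Icc (0 : ℝ) 1,
      ‖t • (x i - z) + u • (z - x j)‖ ≤ R)
    (hw : IsKernelWeights (fun x y => Φ (x - y)) (fun i => (p i : MvPolynomial (Fin d) ℝ))
      k a z x w) {f : E → ℝ} (hf : f ∈ nativeSpace (fun x y => Φ (x - y)) s) :
    ENNReal.ofReal |diffOp k a f z - ∑ j, w j * f (x j)| ≤
      growthFunction (max s (r / 2 + 1)) k a z x (((r : ℝ) + γ) / 2)
        * ENNReal.ofReal (holderConst d r γ) ^ (1 / 2 : ℝ)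
        * holderSeminorm r γ (Metric.closedBall 0 R) Φ ^ (1 / 2 : ℝ)
        * ENNReal.ofReal (nativeSeminorm (fun x y => Φ (x - y)) s f) := by
  have hC : 0 < holderConst d r γ := holderConst_pos hγ hd
  set G := growthFunction (max s (r / 2 + 1)) k a z x (((r : ℝ) + γ) / 2) with hG
  -- Since ∞ · 0 = 0 in `ℝ≥0∞`, an infinite growth function is harmless only if the other factors
  -- are nonzero; the one that can vanish is the semi-norm of f, and then the error vanishes too.
  by_cases hfin : G = ∞
  · by_cases hf0 : nativeSeminorm (fun x y => Φ (x - y)) s f = 0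
    · have h1 := hw.abs_sub_le_norm_mul_nativeSeminorm h hk hf
      rw [hf0, mul_zero] at h1
      rw [ENNReal.ofReal_of_nonpos h1]
      exact bot_le
    · have h1 : ENNReal.ofReal (holderConst d r γ) ^ (1 / 2 : ℝ) ≠ 0 := by
        simp [ENNReal.rpow_eq_zero_iff, hC]
      have h2 : holderSeminorm r γ (Metric.closedBall 0 R) Φ ^ (1 / 2 : ℝ) ≠ 0 := by
        simp [ENNReal.rpow_eq_zero_iff, h.holderSeminorm_ne_zero hd hγ hR hΦ]
      have h3 : ENNReal.ofReal (nativeSeminorm (fun x y => Φ (x - y)) s f) ≠ 0 := by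
        simpa using (nativeSeminorm_nonneg f).lt_of_ne' hf0
      rw [hfin, ENNReal.top_mul h1, ENNReal.top_mul h2, ENNReal.top_mul h3]
      exact le_top
  · obtain ⟨w', hw', hsum⟩ := exists_weights_of_growthFunction_ne_top hfin
    have h1 := hw.abs_sub_le_of_exact hsymm h hk hγ hR hΦ hx hw' hsum hf
    refine (ENNReal.ofReal_le_ofReal h1).trans (le_of_eq ?_)
    rw [ENNReal.ofReal_mul (by positivity), ENNReal.ofReal_mul ENNReal.toReal_nonneg,
      ENNReal.ofReal_toReal hfin, Real.sqrt_eq_rpow,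
      ← ENNReal.ofReal_rpow_of_nonneg (by positivity) (by norm_num), ENNReal.ofReal_mul hC.le,
      ENNReal.ofReal_toReal hΦ.2.ne, ENNReal.mul_rpow_of_nonneg _ _ (by norm_num), ← mul_assoc]

end ErrorBound

theorem corollary2 {d s k r N M : ℕ} {γ : ℝ} (hγ₀ : 0 < γ) (hγ₁ : γ ≤ 1) (hr : 2 * k ≤ r)
    (a : (Fin d → ℕ) → EuclideanSpace ℝ (Fin d) → ℝ)
    (Φ : EuclideanSpace ℝ (Fin d) → ℝ)
    (hK : IsCondPosDef s (fun x y => Φ (x - y)))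
    (p : Module.Basis (Fin M) ℝ (polySpace d s))
    (z : EuclideanSpace ℝ (Fin d)) (x : Fin N → EuclideanSpace ℝ (Fin d))
    (hx : Function.Injective x) (hxz : ∃ j, x j ≠ z)
    (hcons : ∃ w : Fin N → ℝ, PolyExact (fun i => (p i : MvPolynomial (Fin d) ℝ)) k a z x w)
    (hΦ : MemHolderClass r γ (diffBall z x) Φ) :
    -- the derivatives in the linear system exist, and the system determines the weights
    (∀ i, ContDiffAt ℝ k (fun y => Φ (y - x i)) z) ∧
    (∃! w : Fin N → ℝ, IsKernelWeights (fun x y => Φ (x - y))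
      (fun i => (p i : MvPolynomial (Fin d) ℝ)) k a z x w) ∧
    -- the error bound
    (∀ w : Fin N → ℝ, IsKernelWeights (fun x y => Φ (x - y))
        (fun i => (p i : MvPolynomial (Fin d) ℝ)) k a z x w →
      ∀ f ∈ nativeSpace (fun x y => Φ (x - y)) s,
        ContDiffAt ℝ k f z ∧
        ENNReal.ofReal |diffOp k a f z - ∑ j, w j * f (x j)| ≤
          growthFunction (max s (r / 2 + 1)) k a z x (((r : ℝ) + γ) / 2)
            * ENNReal.ofReal (holderConst d r γ) ^ (1 / 2 : ℝ)
            * holderSeminorm r γ (diffBall z x) Φ ^ (1 / 2 : ℝ)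
            * ENNReal.ofReal (nativeSeminorm (fun x y => Φ (x - y)) s f)) ∧
    -- the order of the bound when the points are scaled towards `z`
    ((∀ j ≤ k, growthFunction (max s (r / 2 + 1)) k (homogeneousPart a j) z x
        (((r : ℝ) + γ) / 2) ≠ ∞) →
      ∃ σ : ℝ, ∀ h : ℝ, 0 < h → h ≤ 1 →
        growthFunction (max s (r / 2 + 1)) k a z (scalePoints z x h) (((r : ℝ) + γ) / 2)
          ≤ ENNReal.ofReal (σ * radiusAt z (scalePoints z x h) ^ (((r : ℝ) + γ) / 2 - (k : ℝ))) ∧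
        (∃! w : Fin N → ℝ, IsKernelWeights (fun x y => Φ (x - y))
          (fun i => (p i : MvPolynomial (Fin d) ℝ)) k a z (scalePoints z x h) w) ∧
        ∀ w : Fin N → ℝ, IsKernelWeights (fun x y => Φ (x - y))
            (fun i => (p i : MvPolynomial (Fin d) ℝ)) k a z (scalePoints z x h) w →
          ∀ f ∈ nativeSpace (fun x y => Φ (x - y)) s,
            |diffOp k a f z - ∑ j, w j * f (scalePoints z x h j)| ≤
              σ * radiusAt z (scalePoints z x h) ^ (((r : ℝ) + γ) / 2 - (k : ℝ))
                * holderConst d r γ ^ (1 / 2 : ℝ)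
                * (holderSeminorm r γ (diffBall z x) Φ).toReal ^ (1 / 2 : ℝ)
                * nativeSeminorm (fun x y => Φ (x - y)) s f) := by

  have hk : k ≤ r / 2 := by omega
  obtain ⟨j₀, hj₀⟩ := hxz
  have hd : 0 < d := by
    rcases Nat.eq_zero_or_pos d with rfl | hd
    · exact absurd (Subsingleton.elim _ _) hj₀
    · exact hd
  have hxz : ∃ j, x j ≠ z := ⟨j₀, hj₀⟩
  set R := Metric.diam (starSet z x) with hRdef
  have hR : 0 < R := diam_starSet_pos hxz
  have hball : diffBall z x = Metric.closedBall 0 R := rfl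
  rw [hball] at hΦ ⊢
  have hsymm : ∀ x y, Φ (x - y) = Φ (y - x) := hK.symm
  obtain ⟨H, _, _, _, F, C, S, h⟩ := hK.exists_isSmoothFeatureMap (n := r / 2) p z hR
    ((hΦ.1.mono Metric.ball_subset_closedBall).of_le
      (by exact_mod_cast (by omega : 2 * (r / 2) ≤ r)))
  have hk' : (k : WithTop ℕ∞) ≤ (r / 2 : ℕ) := by exact_mod_cast hk
  have hseg : ∀ i j, ∀ t ∈ Set.Icc (0 : ℝ) 1, ∀ u ∈ Set.Icc (0 : ℝ) 1,
      ‖t • (x i - z) + u • (z - x j)‖ ≤ R :=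
    fun i j t ht u hu => norm_add_smul_le_diam_starSet i j ht hu
  refine ⟨fun i => (h.contDiffAt_kernel (x i)).of_le hk', ?_, fun w hw f hf => ⟨?_, ?_⟩,
    fun hfin => ?_⟩
  · obtain ⟨w₀, hw₀⟩ := hcons
    obtain ⟨w, hw⟩ := exists_isKernelWeights hsymm h hk hw₀
    exact ⟨w, hw, fun w' hw' => hw'.unique hsymm h hk hx hw⟩
  · obtain ⟨t, ht⟩ := hf
    exact (h.contDiffAt_native ht).of_le hk'
  · exact hw.ofReal_abs_sub_le hsymm h hk hd hγ₀ hR hΦ hseg hf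
  · choose! W hW using fun j (hj : j ≤ k) => exists_weights_of_growthFunction_ne_top (hfin j hj)
    set μ := ((r : ℝ) + γ) / 2 with hμ
    have hr₀ : 0 < radiusAt z x := radiusAt_pos hxz
    set A := ∑ i ∈ Finset.range (k + 1), ∑ j, |W i j| * ‖x j - z‖ ^ μ with hA
    -- Since `radiusAt` is homogeneous under scaling, dividing by this power turns h^{μ-k} into the
    -- power of the scaled radius.
    refine ⟨A / radiusAt z x ^ (μ - k), fun h' h0 h1 => ?_⟩
    have hσ : A / radiusAt z x ^ (μ - k) * radiusAt z (scalePoints z x h') ^ (μ - k) =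
        h' ^ (μ - k) * A := by
      rw [radiusAt_scalePoints h0.le, Real.mul_rpow h0.le hr₀.le]
      have : radiusAt z x ^ (μ - k) ≠ 0 := (Real.rpow_pos_of_pos hr₀ _).ne'
      field_simp
    obtain ⟨w₀, hw₀, hsum⟩ := exists_weights_scalePoints (μ := μ) (fun i hi => (hW i hi).1) h0 h1
    have hinj : Function.Injective (scalePoints z x h') := fun i j hij => hx <| by
      simpa [scalePoints, h0.ne'] using hij
    rw [hσ]
    refine ⟨(growthFunction_le_of_exact hw₀).trans (ENNReal.ofReal_le_ofReal hsum), ?_,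
      fun w hw f hf => ?_⟩
    · obtain ⟨w, hw⟩ := exists_isKernelWeights hsymm h hk
        (PolyExact.of_forall_polySpace (p := p) (le_max_left _ _) hw₀)
      exact ⟨w, hw, fun w' hw' => hw'.unique hsymm h hk hinj hw⟩
    -- For h ≤ 1 the scaled segments lie in the original ones, so the ball and the Hölder semi-norm
    -- of the unscaled configuration serve for all h.
    · have hseg' : ∀ i j, ∀ t ∈ Set.Icc (0 : ℝ) 1, ∀ u ∈ Set.Icc (0 : ℝ) 1,
          ‖t • (scalePoints z x h' i - z) + u • (z - scalePoints z x h' j)‖ ≤ R := by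
        intro i j t ht u hu
        have hmul : ∀ t ∈ Set.Icc (0 : ℝ) 1, t * h' ∈ Set.Icc (0 : ℝ) 1 := fun t ht =>
          ⟨mul_nonneg ht.1 h0.le, mul_le_one₀ ht.2 h0.le h1⟩
        have h2 := hseg i j _ (hmul t ht) _ (hmul u hu)
        rw [mul_smul, mul_smul] at h2
        have h3 : z - scalePoints z x h' j = h' • (z - x j) := by
          rw [scalePoints, sub_add_cancel_left, ← smul_neg, neg_sub]
        rw [h3, scalePoints, add_sub_cancel_left]
        exact h2
      refine (hw.abs_sub_le_of_exact hsymm h hk hγ₀ hR hΦ hseg' hw₀ hsum hf).trans (le_of_eq ?_)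
      rw [Real.sqrt_eq_rpow, Real.mul_rpow (holderConst_pos hγ₀ hd).le ENNReal.toReal_nonneg]
      ring
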